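/- **Setting.** Let $d\in\{2,3\}$. Let $T\subset\mathbb{R}^d$ be a closed simplex with vertices $p_1,\dots,p_{d+1}$, presented as $T=\Phi(\widehat T)$ with $\Phi=\Phi_T\circ\Phi_{\widetilde T}$, $\Phi_{\widetilde T}(\hat x)=\widetilde A\,\mathrm{diag}(h_1,\dots,h_d)\,\hat x$, $\Phi_T(\tilde x)=A_T\tilde x+b_T$, where $h_i>0$, $A_T\in O(d)$, $b_T\in\mathbb{R}^d$, $p_i=\Phi(\hat p_i)$, and $\widehat T$ with vertices $\hat p_i$ and $\widetilde A$ are as follows. * $d=2$: $\widehat T$ has vertices $(0,0),(1,0),(0,1)$ and $\widetilde A=\begin{pmatrix}1&s\\0&t\end{pmatrix}$, $s^2+t^2=1$, $t>0$; $p_2p_3$ is a longest edge of $T$ and $h_2\le h_1$. * $d=3$: $\widehat T$ has vertices $(0,0,0),(1,0,0),\hat p_3,(0,0,1)$ with $\hat p_3=(0,1,0)$ in case (i) and $\hat p_3=(1,1,0)$ in case (ii), and $\widetilde A=\begin{pmatrix}1&\pm s_1&s_{21}\\0&t_1&s_{22}\\0&0&t_2\end{pmatrix}$ with sign $+$ in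 case (i) and $-$ in case (ii), where $s_1^2+t_1^2=1$, $s_1,t_1>0$, $h_2s_1\le h_1/2$, $s_{21}^2+s_{22}^2+t_2^2=1$, $t_2>0$, $h_3s_{21}\le h_1/2$. A shortest edge $L_{\min}$ of $T$ is $p_1p_3$ in case (i) and $p_2p_3$ in case (ii), and $p_1p_2$ is longest among the four edges that share exactly one endpoint with $L_{\min}$. Put $r_1=\frac{p_2-p_1}{|p_2-p_1|}$, $r_2=\frac{p_3-p_1}{|p_3-p_1|}$ (but $r_2=\frac{p_3-p_2}{|p_3-p_2|}$ in case (ii)) and, for $d=3$, $r_3=\frac{p_4-p_1}{|p_4-p_1|}$; $\widetilde{\mathscr H}_1=h_1$, and $\widetilde{\mathscr H}_2=h_2t$ for $d=2$, $\widetilde{\mathscr H}_2=h_2t_1$, $\widetilde{\mathscr H}_3=h_3t_2$ for $d=3$. Let $|v|_{W^{k,p}}=\big(\sum_{|\alpha|=k}\|\partial^\alpha v\|_{L^p}^p\big)^{1/p}$, let $\mathbb{P}^k(T)$ be the polynomials of degree at most $k$ on $T$, let $|T|$ be the Lebesgue measure of $T$, and let $\Pi_T^0 v=\frac1{|T|}\int_T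 v\,dx$. **Theorem 2.** Let $k\ge1$ be an integer and let $p,q\in[1,\infty)$ satisfy $1-\frac dp\ge-\frac dq$ (that is, $W^{1,p}(T)\hookrightarrow L^q(T)$). There is a constant $c$ depending only on $d,k,p,q$ such that, for every $T$ as above, every operator $I_T:W^{k,p}(T)\to\mathbb{P}^k(T)$ with $$\partial^\alpha(I_T\varphi)=\Pi_T^0(\partial^\alpha\varphi)\qquad\text{for all }\varphi\in W^{k,p}(T)\text{ and all }|\alpha|=k,$$ and every $\varphi\in W^{k+1,p}(T)$, one has $I_T\varphi-\varphi\in W^{k,q}(T)$ and $$|I_T\varphi-\varphi|_{W^{k,q}(T)}\le c\,|T|^{\frac1q-\frac1p}\sum_{i=1}^d h_i\Big|\frac{\partial\varphi}{\partial r_i}\Big|_{W^{k,p}(T)} .$$ Moreover, for every $M>0$ there is a constant $c$ depending only on $d,k,p,q,M$ such that, for all $T$ as above that in the case $d=3$ also satisfy $|s_{22}|\le M\frac{h_2t_1}{h_3}$ (no further condition if $d=2$), and all such $I_T$ and $\varphi$, $$|I_T\varphi-\varphi|_{W^{k,q}(T)}\le c\,|T|^{\frac1q-\frac1p}\sum_{i=1}^d\widetilde{\mathscr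 H}_i\Big|\frac{\partial(\varphi\circ\Phi_T)}{\partial\tilde x_i}\Big|_{W^{k,p}(\Phi_T^{-1}(T))} .$$ -/

import Mathlib

open MeasureTheory
open scoped ENNReal NNReal ContDiff

noncomputable section

namespace Aniso

/-- Euclidean `d`-space. -/
abbrev Space (d : ℕ) : Type := EuclideanSpace ℝ (Fin d)

/-! ### Multi-indices, weak derivatives, Sobolev spaces -/

/-- The multi-indices `α ∈ ℕ₀^d` of order `|α| = k`. -/
def multiIndices (d k : ℕ) : Finset (Fin d → ℕ) :=
  Finset.piAntidiag (Finset.univ : Finset (Fin d)) k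

/-- The classical first partial derivative `∂f/∂x_i`. -/
def partialDeriv {d : ℕ} (i : Fin d) (f : Space d → ℝ) : Space d → ℝ :=
  fun x => fderiv ℝ f x (EuclideanSpace.single i 1)

/-- The classical derivative `∂^α f = ∂_1^{α_1} ⋯ ∂_d^{α_d} f`. -/
def classicalDeriv {d : ℕ} (α : Fin d → ℕ) (f : Space d → ℝ) : Space d → ℝ :=
  (List.finRange d).foldr (fun i g => (partialDeriv i)^[α i] g) f

/-- `g` is a weak derivative `∂^α f` on the open set `U`. -/
def IsWeakDeriv {d : ℕ} (U : Set (Space d)) (α : Fin d → ℕ) (f g : Space d → ℝ) : Prop :=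
  LocallyIntegrableOn f U volume ∧ LocallyIntegrableOn g U volume ∧
    ∀ η : Space d → ℝ, ContDiff ℝ ∞ η → HasCompactSupport η → tsupport η ⊆ U →
      ∫ x in U, f x * classicalDeriv α η x = (-1) ^ (∑ i, α i) * ∫ x in U, g x * η x

open Classical in
/-- The weak derivative `∂^α f` on `U`, determined up to a null set of `U`
(and `0` if it does not exist). -/
def weakDeriv {d : ℕ} (U : Set (Space d)) (α : Fin d → ℕ) (f : Space d → ℝ) : Space d → ℝ :=
  if h : ∃ g, IsWeakDeriv U α f g then h.choose else 0

/-- `f ∈ W^{k,p}(U)`: all weak derivatives of order at most `k` exist and lie in `L^p(U)`. -/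
def MemSobolev {d : ℕ} (U : Set (Space d)) (k : ℕ) (p : ℝ) (f : Space d → ℝ) : Prop :=
  ∀ α : Fin d → ℕ, ∑ i, α i ≤ k →
    ∃ g, IsWeakDeriv U α f g ∧ MemLp g (ENNReal.ofReal p) (volume.restrict U)

/-- The seminorm `|f|_{W^{k,p}(U)} = (∑_{|α| = k} ‖∂^α f‖_{L^p(U)}^p)^{1/p}`, for `1 ≤ p < ∞`. -/
def sobolevSeminorm {d : ℕ} (U : Set (Space d)) (k : ℕ) (p : ℝ) (f : Space d → ℝ) : ℝ≥0∞ :=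
  (∑ α ∈ multiIndices d k,
    eLpNorm (weakDeriv U α f) (ENNReal.ofReal p) (volume.restrict U) ^ p) ^ (1 / p)

/-- The weak first partial derivative `∂f/∂x_i` on `U`. -/
def weakPartial {d : ℕ} (U : Set (Space d)) (i : Fin d) (f : Space d → ℝ) : Space d → ℝ :=
  weakDeriv U (Pi.single i 1) f

/-- The weak directional derivative `∂f/∂r = (r · ∇) f` on `U`. -/
def weakDirDeriv {d : ℕ} (U : Set (Space d)) (r : Space d) (f : Space d → ℝ) : Space d → ℝ :=
  fun x => ∑ j, r j * weakPartial U j f x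

/-- Polynomial functions of degree at most `k`. A polynomial on a simplex with nonempty interior
is identified with its unique polynomial extension to the whole space. -/
def polySpace (d k : ℕ) : Set (Space d → ℝ) :=
  {v | ∃ P : MvPolynomial (Fin d) ℝ, P.totalDegree ≤ k ∧ ∀ x, v x = MvPolynomial.eval (fun i => x i) P}

/-! ### Simplices as images of reference simplices -/

/-- The parameters of the shear matrix `Ã`, one constructor for each reference simplex:
the triangle, and the tetrahedra of cases (i) and (ii). -/
inductive Shape : ℕ → Type
  | tri (s t : ℝ) : Shape 2
  | tet₁ (s₁ t₁ s₂₁ s₂₂ t₂ : ℝ) : Shape 3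
  | tet₂ (s₁ t₁ s₂₁ s₂₂ t₂ : ℝ) : Shape 3

/-- The vertices `p̂_1, …, p̂_{d+1}` of the reference simplex. -/
def Shape.refVertex : {d : ℕ} → Shape d → Fin (d + 1) → Space d
  | _, .tri _ _ => ![!₂[0, 0], !₂[1, 0], !₂[0, 1]]
  | _, .tet₁ _ _ _ _ _ => ![!₂[0, 0, 0], !₂[1, 0, 0], !₂[0, 1, 0], !₂[0, 0, 1]]
  | _, .tet₂ _ _ _ _ _ => ![!₂[0, 0, 0], !₂[1, 0, 0], !₂[1, 1, 0], !₂[0, 0, 1]]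

/-- The matrix `Ã`. -/
def Shape.shear : {d : ℕ} → Shape d → Matrix (Fin d) (Fin d) ℝ
  | _, .tri s t => !![1, s; 0, t]
  | _, .tet₁ s₁ t₁ s₂₁ s₂₂ t₂ => !![1, s₁, s₂₁; 0, t₁, s₂₂; 0, 0, t₂]
  | _, .tet₂ s₁ t₁ s₂₁ s₂₂ t₂ => !![1, -s₁, s₂₁; 0, t₁, s₂₂; 0, 0, t₂]

/-- The edge (as a pair: initial and final vertex) that carries the direction `r_i`. -/
def Shape.edge : {d : ℕ} → Shape d → Fin d → Fin (d + 1) × Fin (d + 1)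
  | _, .tri _ _ => ![(0, 1), (0, 2)]
  | _, .tet₁ _ _ _ _ _ => ![(0, 1), (0, 2), (0, 3)]
  | _, .tet₂ _ _ _ _ _ => ![(0, 1), (1, 2), (0, 3)]

/-- The diagonal entries of `Ã`, so that `H̃_i = h_i * diag_i`. -/
def Shape.diag : {d : ℕ} → Shape d → Fin d → ℝ
  | _, .tri _ t => ![1, t]
  | _, .tet₁ _ t₁ _ _ t₂ => ![1, t₁, t₂]
  | _, .tet₂ _ t₁ _ _ t₂ => ![1, t₁, t₂]

/-- The data that present a simplex `T` as the image of a reference simplex under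
`x̂ ↦ A_T Ã diag(h) x̂ + b_T`. The conditions on the data are in `Element.Admissible`. -/
structure Element (d : ℕ) where
  /-- the lengths `h_1, …, h_d` -/
  h : Fin d → ℝ
  /-- the reference simplex and the parameters of `Ã` -/
  shape : Shape d
  /-- the matrix `A_T` -/
  rot : Matrix (Fin d) (Fin d) ℝ
  /-- the vector `b_T` -/
  shift : Space d

namespace Element

variable {d : ℕ} (K : Element d)

/-- The map `Φ_T̃ : x̂ ↦ Ã diag(h) x̂`. -/
def stretch (x : Space d) : Space d :=
  WithLp.toLp 2 (Matrix.mulVec (K.shape.shear * Matrix.diagonal K.h) x.ofLp)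

/-- The map `Φ_T : x̃ ↦ A_T x̃ + b_T`. -/
def move (x : Space d) : Space d :=
  WithLp.toLp 2 (Matrix.mulVec K.rot x.ofLp) + K.shift

/-- The map `Φ = Φ_T ∘ Φ_T̃`. -/
def map (x : Space d) : Space d := K.move (K.stretch x)

/-- The reference simplex `T̂`. -/
def refSimplex : Set (Space d) := convexHull ℝ (Set.range K.shape.refVertex)

/-- The closed simplex `T = Φ(T̂)`. -/
def simplex : Set (Space d) := K.map '' K.refSimplex

/-- The simplex `T̃ = Φ_T⁻¹(T)`. -/
def tildeSimplex : Set (Space d) := K.move ⁻¹' K.simplex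

/-- The vertices `p_1, …, p_{d+1}` of `T`. -/
def vertex (j : Fin (d + 1)) : Space d := K.map (K.shape.refVertex j)

/-- The unit edge directions `r_1, …, r_d`. -/
def dir (i : Fin d) : Space d :=
  let v := K.vertex (K.shape.edge i).2 - K.vertex (K.shape.edge i).1
  ‖v‖⁻¹ • v

/-- The parameters `H̃_1, …, H̃_d`. -/
def tildeH (i : Fin d) : ℝ := K.h i * K.shape.diag i

/-- The length of the edge between the vertices `p_i` and `p_j`. -/
def len (i j : Fin (d + 1)) : ℝ := dist (K.vertex i) (K.vertex j)

end Element

/-- The conditions on the parameters of `Ã` and on the numbering of the vertices.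

* Triangle: the edge `p_2 p_3` is the longest one, and `h_2 ≤ h_1`.
* Tetrahedron: `h_2` is the length of a shortest edge `L`, which is `p_1 p_3` in case (i) and
  `p_2 p_3` in case (ii); `p_1 p_2`, of length `h_1`, is longest among the four edges that share
  exactly one endpoint with `L`. The inequalities `h_2 s₁ ≤ h_1 / 2` and `h_3 s₂₁ ≤ h_1 / 2` say
  on which side of the plane that bisects `p_1 p_2` the vertices `p_3` and `p_4` lie: `p_4` on the
  side of `p_1`; `p_3` on the side of `p_1` in case (i) and of `p_2` in case (ii). -/
def ShapeConditions : {d : ℕ} → (K : Element d) → Shape d → Prop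
  | _, K, .tri s t =>
      s ^ 2 + t ^ 2 = 1 ∧ 0 < t ∧ K.h 1 ≤ K.h 0 ∧
      K.len 0 1 ≤ K.len 1 2 ∧ K.len 0 2 ≤ K.len 1 2
  | _, K, .tet₁ s₁ t₁ s₂₁ s₂₂ t₂ =>
      (s₁ ^ 2 + t₁ ^ 2 = 1 ∧ 0 < s₁ ∧ 0 < t₁ ∧ K.h 1 * s₁ ≤ K.h 0 / 2) ∧
      (s₂₁ ^ 2 + s₂₂ ^ 2 + t₂ ^ 2 = 1 ∧ 0 < t₂ ∧ K.h 2 * s₂₁ ≤ K.h 0 / 2) ∧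
      (∀ i j, i ≠ j → K.len 0 2 ≤ K.len i j) ∧
      (K.len 0 3 ≤ K.len 0 1 ∧ K.len 2 1 ≤ K.len 0 1 ∧ K.len 2 3 ≤ K.len 0 1)
  | _, K, .tet₂ s₁ t₁ s₂₁ s₂₂ t₂ =>
      (s₁ ^ 2 + t₁ ^ 2 = 1 ∧ 0 < s₁ ∧ 0 < t₁ ∧ K.h 1 * s₁ ≤ K.h 0 / 2) ∧
      (s₂₁ ^ 2 + s₂₂ ^ 2 + t₂ ^ 2 = 1 ∧ 0 < t₂ ∧ K.h 2 * s₂₁ ≤ K.h 0 / 2) ∧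
      (∀ i j, i ≠ j → K.len 1 2 ≤ K.len i j) ∧
      (K.len 1 3 ≤ K.len 0 1 ∧ K.len 2 0 ≤ K.len 0 1 ∧ K.len 2 3 ≤ K.len 0 1)

/-- The standing conditions on the presentation of a simplex: `h_i > 0`, `A_T ∈ O(d)`, and the
conditions on the parameters and on the numbering of the vertices. -/
def Element.Admissible {d : ℕ} (K : Element d) : Prop :=
  (∀ i, 0 < K.h i) ∧ K.rot ∈ Matrix.orthogonalGroup (Fin d) ℝ ∧ ShapeConditions K K.shape

/-- The geometric condition with constant `M`: none for triangles, and
`|s₂₂| ≤ M h_2 t₁ / h_3` for tetrahedra. -/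
def GeometricBound (M : ℝ) : {d : ℕ} → (K : Element d) → Shape d → Prop
  | _, _, .tri _ _ => True
  | _, K, .tet₁ _ t₁ _ s₂₂ _ => |s₂₂| ≤ M * (K.h 1 * t₁ / K.h 2)
  | _, K, .tet₂ _ t₁ _ s₂₂ _ => |s₂₂| ≤ M * (K.h 1 * t₁ / K.h 2)

/-- `I : W^{k,p}(T) → P^k(T)` is an operator (not assumed to be linear) such that, for every
`φ ∈ W^{k,p}(T)` and every `|α| = k`, the derivative `∂^α (I φ)` is on `T` equal to the mean
value over `T` of `∂^α φ`. The values of `I` outside `W^{k,p}(T)` are irrelevant. -/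
def PreservesMeanDerivs {d : ℕ} (T : Set (Space d)) (k : ℕ) (p : ℝ)
    (I : (Space d → ℝ) → (Space d → ℝ)) : Prop :=
  ∀ φ, MemSobolev (interior T) k p φ →
    I φ ∈ polySpace d k ∧
    ∀ α ∈ multiIndices d k, ∀ x ∈ T,
      classicalDeriv α (I φ) x = ⨍ y in T, weakDeriv (interior T) α φ y

end Aniso

end

/-! For $|\alpha|=k$ the hypothesis on $I_T$ says that $\partial^\alpha(I_T\varphi-\varphi)$ is the
mean of $g=\partial^\alpha\varphi$ minus $g$. So everything reduces to a Sobolev–Poincaré inequality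
for $g$ on $T$, in which the norm of the gradient must be measured anisotropically.

Pull $g$ back to the reference simplex by $\Phi$. There are at most two reference simplices for each
$d$, so the inequality there has a fixed constant. The $i$-th derivative of $g\circ\Phi$ is the
derivative of $g$ along the $i$-th column of the linear part of $\Phi$, and this column is $h_ir_i$
(`Element.mapEquiv_single`). The Jacobians of the $L^q$ and $L^p$ norms combine to $|T|^{1/q-1/p}$
(`exists_anisotropic_sobolev_poincare`). This gives the first estimate with no condition on the
shape of $T$.

For the second estimate, write the same column as a combination of the rotated coordinate
directions, with coefficients the entries of $\widetilde A\,\mathrm{diag}(h)$. Those in row $l$ are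
at most $(M+2)\widetilde{\mathscr H}_l$ (`Element.abs_entry_le`). Passing from $\partial^\alpha$ in
the coordinates $x$ to derivatives in $\tilde x$ costs a constant in $d,k$ only, since the rotation
preserves measure and its matrix and inverse have entries at most $1$ in modulus
(`MemSobolev.eLpNorm_dirDeriv_le_comp`).

The Sobolev–Poincaré inequality on a fixed simplex is proved without extension operators. For $C^1$
functions, multiply by a cutoff that is $1$ off a layer of width $\delta$ at the faces, and apply
the Gagliardo–Nirenberg–Sobolev inequality for compactly supported functions. The cutoff has
gradient of size $\delta^{-1}$, but the integral of $|G|$ over the layer is $O(\delta)$ times its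
$W^{1,1}$ norm (`lintegral_layer_le`), so the bound survives $\delta\to0$. Applying this to
$|G|^\gamma$ gives the other exponents, and a double integral over segments gives the Poincaré part.
Weakly differentiable functions are mollified on slightly contracted simplices, and the limit is
taken by a Fatou argument modulo constants. -/

noncomputable section

namespace Aniso

/-! ### Classical partial derivatives of smooth functions -/

section Classical

variable {d : ℕ}

/-- Smooth functions on Euclidean space. -/
abbrev Smooth (f : Space d → ℝ) : Prop := ContDiff ℝ ∞ f

lemma Smooth.partialDeriv {f : Space d → ℝ} (hf : Smooth f) (i : Fin d) :
    Smooth (partialDeriv i f) :=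
  (hf.fderiv_right (m := ∞) (by norm_cast)).clm_apply contDiff_const

lemma Smooth.iterate_partialDeriv {f : Space d → ℝ} (hf : Smooth f) (i : Fin d) (n : ℕ) :
    Smooth ((Aniso.partialDeriv i)^[n] f) := by
  induction n generalizing f with
  | zero => exact hf
  | succ n ih => exact ih (hf.partialDeriv i)

lemma Smooth.differentiable {f : Space d → ℝ} (hf : Smooth f) : Differentiable ℝ f :=
  ContDiff.differentiable hf (by norm_cast)

lemma partialDeriv_comm {f : Space d → ℝ} (hf : Smooth f) (i j : Fin d) :
    partialDeriv i (partialDeriv j f) = partialDeriv j (partialDeriv i f) := by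
  have key : ∀ (i j : Fin d) (x : Space d), partialDeriv i (partialDeriv j f) x
      = fderiv ℝ (fderiv ℝ f) x (EuclideanSpace.single i 1) (EuclideanSpace.single j 1) := by
    intro i j x
    have hd : DifferentiableAt ℝ (fderiv ℝ f) x :=
      ((hf.fderiv_right (m := ∞) (by norm_cast)).differentiable (by norm_cast)) x
    have : HasFDerivAt (partialDeriv j f)
        ((ContinuousLinearMap.apply ℝ ℝ (EuclideanSpace.single j (1 : ℝ))).comp
          (fderiv ℝ (fderiv ℝ f) x)) x :=
      (ContinuousLinearMap.apply ℝ ℝ (EuclideanSpace.single j (1 : ℝ))).hasFDerivAt.comp x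
        hd.hasFDerivAt
    rw [partialDeriv, this.fderiv]
    rfl
  ext x
  rw [key, key]
  exact (hf.contDiffAt.isSymmSndFDerivAt (by simp [minSmoothness_of_isRCLikeNormedField]; norm_cast)) _ _

lemma iterate_partialDeriv_comm {f : Space d → ℝ} (hf : Smooth f) (i j : Fin d) (n : ℕ) :
    partialDeriv i ((partialDeriv j)^[n] f) = (partialDeriv j)^[n] (partialDeriv i f) := by
  induction n generalizing f with
  | zero => rfl
  | succ n ih => rw [Function.iterate_succ_apply, ih (hf.partialDeriv j), partialDeriv_comm hf,
      Function.iterate_succ_apply]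

/-- The derivative `∂^α` restricted to the coordinates in a list. -/
def listDeriv (l : List (Fin d)) (α : Fin d → ℕ) (f : Space d → ℝ) : Space d → ℝ :=
  l.foldr (fun i g => (partialDeriv i)^[α i] g) f

lemma Smooth.listDeriv {f : Space d → ℝ} (hf : Smooth f) (l : List (Fin d)) (α : Fin d → ℕ) :
    Smooth (listDeriv l α f) := by
  induction l with
  | nil => exact hf
  | cons i l ih => exact ih.iterate_partialDeriv i _

lemma partialDeriv_listDeriv {f : Space d → ℝ} (hf : Smooth f) (l : List (Fin d))
    (α : Fin d → ℕ) (j : Fin d) :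
    partialDeriv j (listDeriv l α f) = listDeriv l α (partialDeriv j f) := by
  induction l with
  | nil => rfl
  | cons i l ih =>
    change partialDeriv j ((partialDeriv i)^[α i] (listDeriv l α f)) =
      (partialDeriv i)^[α i] (listDeriv l α (partialDeriv j f))
    rw [iterate_partialDeriv_comm (hf.listDeriv l α), ih]

lemma iterate_partialDeriv_listDeriv {f : Space d → ℝ} (hf : Smooth f) (l : List (Fin d))
    (α : Fin d → ℕ) (j : Fin d) (n : ℕ) :
    (partialDeriv j)^[n] (listDeriv l α f) = listDeriv l α ((partialDeriv j)^[n] f) := by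
  induction n generalizing f with
  | zero => rfl
  | succ n ih => rw [Function.iterate_succ_apply, partialDeriv_listDeriv hf,
      ih (hf.partialDeriv j), Function.iterate_succ_apply]

/-- The block of derivatives in direction `i` must be moved past those of the tail of the list.
Symmetry of second derivatives allows it, and this is where smoothness is used. -/
lemma listDeriv_add {f : Space d → ℝ} (hf : Smooth f) (l : List (Fin d)) (α β : Fin d → ℕ) :
    listDeriv l (α + β) f = listDeriv l α (listDeriv l β f) := by
  induction l with
  | nil => rfl
  | cons i l ih =>
    change (partialDeriv i)^[α i + β i] (listDeriv l (α + β) f) =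
      (partialDeriv i)^[α i] (listDeriv l α ((partialDeriv i)^[β i] (listDeriv l β f)))
    rw [ih, Function.iterate_add_apply, iterate_partialDeriv_listDeriv (hf.listDeriv l β)]

lemma listDeriv_single (l : List (Fin d)) (hl : l.Nodup) (i : Fin d) (f : Space d → ℝ) :
    listDeriv l (Pi.single i 1) f = if i ∈ l then partialDeriv i f else f := by
  induction l with
  | nil => rfl
  | cons j l ih =>
    rw [List.nodup_cons] at hl
    change (partialDeriv j)^[(Pi.single i 1 : Fin d → ℕ) j] (listDeriv l (Pi.single i 1) f) = _
    rw [ih hl.2]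
    rcases eq_or_ne i j with rfl | hij
    · simp [hl.1]
    · simp [hij]

lemma Smooth.classicalDeriv {f : Space d → ℝ} (hf : Smooth f) (α : Fin d → ℕ) :
    Smooth (classicalDeriv α f) := hf.listDeriv _ α

lemma classicalDeriv_add {f : Space d → ℝ} (hf : Smooth f) (α β : Fin d → ℕ) :
    classicalDeriv (α + β) f = classicalDeriv α (classicalDeriv β f) := listDeriv_add hf _ α β

@[simp] lemma classicalDeriv_single (i : Fin d) (f : Space d → ℝ) :
    classicalDeriv (Pi.single i 1) f = partialDeriv i f := by
  exact (listDeriv_single (List.finRange d) (List.nodup_finRange d) i f).trans (by simp)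

@[simp] lemma classicalDeriv_zero (f : Space d → ℝ) : classicalDeriv 0 f = f := by
  have : ∀ l : List (Fin d), listDeriv l 0 f = f := by
    intro l
    induction l with
    | nil => rfl
    | cons i l ih => exact ih
  exact this _

/-- Induction on multi-indices: a multi-index of positive order has the form `α + e_i`. -/
lemma multiIndex_induction {P : (Fin d → ℕ) → Prop} (h0 : P 0)
    (hs : ∀ α i, P α → P (α + Pi.single i 1)) (α : Fin d → ℕ) : P α := by
  induction hn : ∑ i, α i generalizing α with
  | zero =>
    have : α = 0 := by
      ext i
      exact (Finset.sum_eq_zero_iff.1 hn) i (Finset.mem_univ i)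
    exact this ▸ h0
  | succ n ih =>
    obtain ⟨i, hi⟩ : ∃ i, α i ≠ 0 := by
      by_contra! h
      simp [h] at hn
    have e : (α - Pi.single i 1) + Pi.single i 1 = α := by
      ext j
      rcases eq_or_ne j i with rfl | hj
      · simp; omega
      · simp [Pi.single_eq_of_ne hj]
    rw [← e]
    apply hs
    apply ih
    have : ∑ j, ((α - Pi.single i 1) + Pi.single i 1 : Fin d → ℕ) j = n + 1 := by rw [e, hn]
    simp only [Pi.add_apply, Finset.sum_add_distrib] at this
    simpa using this

lemma sum_add_single (α : Fin d → ℕ) (i : Fin d) :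
    ∑ j, (α + Pi.single i 1 : Fin d → ℕ) j = ∑ j, α j + 1 := by
  simp [Finset.sum_add_distrib]

lemma tsupport_partialDeriv_subset (f : Space d → ℝ) (i : Fin d) :
    tsupport (partialDeriv i f) ⊆ tsupport f :=
  (closure_mono (fun x hx => by
    simp only [Function.mem_support, partialDeriv] at hx ⊢
    intro h
    simp [h] at hx)).trans (tsupport_fderiv_subset ℝ (f := f))

lemma tsupport_classicalDeriv_subset {f : Space d → ℝ} (hf : Smooth f) (α : Fin d → ℕ) :
    tsupport (classicalDeriv α f) ⊆ tsupport f := by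
  induction α using multiIndex_induction generalizing f with
  | h0 => simp
  | hs α i ih =>
    rw [classicalDeriv_add hf, classicalDeriv_single]
    exact (ih (hf.partialDeriv i)).trans (tsupport_partialDeriv_subset f i)

lemma hasCompactSupport_classicalDeriv {f : Space d → ℝ} (hf : Smooth f)
    (hc : HasCompactSupport f) (α : Fin d → ℕ) : HasCompactSupport (classicalDeriv α f) :=
  hc.of_isClosed_subset (isClosed_tsupport _) (tsupport_classicalDeriv_subset hf α)

lemma classicalDeriv_sum {ι : Type*} (s : Finset ι) {f : ι → Space d → ℝ}
    (hf : ∀ i ∈ s, Smooth (f i)) (c : ι → ℝ) (α : Fin d → ℕ) :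
    classicalDeriv α (fun x => ∑ i ∈ s, c i * f i x) =
      fun x => ∑ i ∈ s, c i * classicalDeriv α (f i) x := by
  induction α using multiIndex_induction generalizing f with
  | h0 => simp
  | hs α j ih =>
    have hsm : Smooth (fun x => ∑ i ∈ s, c i * f i x) :=
      ContDiff.sum fun i hi => contDiff_const.mul (hf i hi)
    rw [classicalDeriv_add hsm, classicalDeriv_single]
    have : partialDeriv j (fun x => ∑ i ∈ s, c i * f i x) =
        fun x => ∑ i ∈ s, c i * partialDeriv j (f i) x := by
      ext x
      have h : HasFDerivAt (fun x => ∑ i ∈ s, c i * f i x)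
          (∑ i ∈ s, c i • fderiv ℝ (f i) x) x :=
        HasFDerivAt.fun_sum fun i hi => ((hf i hi).differentiable x).hasFDerivAt.const_mul (c i)
      simp only [partialDeriv]
      rw [h.fderiv]
      simp
    rw [this, ih fun i hi => (hf i hi).partialDeriv j]
    ext x
    refine Finset.sum_congr rfl fun i hi => ?_
    rw [classicalDeriv_add (hf i hi), classicalDeriv_single]

/-- Integration by parts against a test function. -/
lemma integral_mul_classicalDeriv {f η : Space d → ℝ} (hf : Smooth f) (hη : Smooth η)
    (hc : HasCompactSupport η) (α : Fin d → ℕ) :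
    ∫ x, f x * classicalDeriv α η x = (-1) ^ (∑ i, α i) * ∫ x, classicalDeriv α f x * η x := by
  induction α using multiIndex_induction generalizing f η with
  | h0 => simp
  | hs α j ih =>
    have hηj : HasCompactSupport (partialDeriv j η) :=
      hc.of_isClosed_subset (isClosed_tsupport _) (tsupport_partialDeriv_subset η j)
    rw [classicalDeriv_add hη, classicalDeriv_single, ih hf (hη.partialDeriv j) hηj,
      sum_add_single, pow_succ, mul_assoc]
    congr 1
    have hint : ∀ {u v : Space d → ℝ}, Smooth u → Smooth v → HasCompactSupport v →
        Integrable (fun x => u x * v x) := fun hu hv hcv =>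
      (hu.continuous.mul hv.continuous).integrable_of_hasCompactSupport hcv.mul_left
    have hfa := hf.classicalDeriv α
    have := integral_mul_fderiv_eq_neg_fderiv_mul_of_integrable (μ := volume)
      (f := classicalDeriv α f) (g := η) (v := EuclideanSpace.single j (1 : ℝ))
      (hint (hfa.partialDeriv j) hη hc) (hint hfa (hη.partialDeriv j) hηj) (hint hfa hη hc)
      (fun x _ => hfa.differentiable x) (fun x _ => hη.differentiable x)
    rw [add_comm, classicalDeriv_add hf, classicalDeriv_single]
    simpa [partialDeriv] using this

/-- The affine homeomorphism `x ↦ L x + b`. -/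
def affineHomeo (L : Space d ≃L[ℝ] Space d) (b : Space d) : Space d ≃ₜ Space d :=
  L.toHomeomorph.trans (Homeomorph.addRight b)

@[simp] lemma affineHomeo_apply (L : Space d ≃L[ℝ] Space d) (b x : Space d) :
    affineHomeo L b x = L x + b := rfl

lemma affineHomeo_symm (L : Space d ≃L[ℝ] Space d) (b : Space d) :
    (affineHomeo L b).symm = affineHomeo L.symm (-L.symm b) := by
  ext1 y
  rw [Homeomorph.symm_apply_eq]
  simp

lemma hasFDerivAt_affineHomeo (L : Space d ≃L[ℝ] Space d) (b x : Space d) :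
    HasFDerivAt (affineHomeo L b) (L : Space d →L[ℝ] Space d) x :=
  (L.hasFDerivAt (x := x)).add_const b

lemma contDiff_affineHomeo (L : Space d ≃L[ℝ] Space d) (b : Space d) {n : WithTop ℕ∞} :
    ContDiff ℝ n (affineHomeo L b) := L.contDiff.add contDiff_const

lemma eq_sum_single (v : Space d) : v = ∑ j, v j • EuclideanSpace.single j (1 : ℝ) := by
  ext i
  simp [Pi.single_apply]

lemma fderiv_apply_eq_sum (f : Space d → ℝ) (x v : Space d) :
    fderiv ℝ f x v = ∑ j, v j * partialDeriv j f x := by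
  conv_lhs => rw [eq_sum_single v]
  simp [partialDeriv]

lemma partialDeriv_comp_affine {f : Space d → ℝ} (hf : Differentiable ℝ f)
    (L : Space d ≃L[ℝ] Space d) (b : Space d) (i : Fin d) (x : Space d) :
    partialDeriv i (f ∘ affineHomeo L b) x =
      ∑ j, L (EuclideanSpace.single i 1) j * partialDeriv j f (affineHomeo L b x) := by
  rw [partialDeriv, ((hf _).hasFDerivAt.comp x (hasFDerivAt_affineHomeo L b x)).fderiv,
    ← fderiv_apply_eq_sum]
  rfl

lemma mem_multiIndices {k : ℕ} {α : Fin d → ℕ} : α ∈ multiIndices d k ↔ ∑ i, α i = k := by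
  simp [multiIndices]

/-- The chain rule for `∂^α` and an affine change of variables, with a bound for the
coefficients. -/
lemma exists_chainRule_coeff (L : Space d ≃L[ℝ] Space d) (b : Space d) {B : ℝ}
    (hB : ∀ i j, |L (EuclideanSpace.single i 1) j| ≤ B) (α : Fin d → ℕ) :
    ∃ c : (Fin d → ℕ) → ℝ, (∀ β, |c β| ≤ (d * B) ^ (∑ i, α i)) ∧
      ∀ η : Space d → ℝ, Smooth η → classicalDeriv α (η ∘ affineHomeo L b) =
        fun x => ∑ β ∈ multiIndices d (∑ i, α i), c β * classicalDeriv β η (affineHomeo L b x) := by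
  induction α using multiIndex_induction with
  | h0 =>
    refine ⟨fun _ => 1, by simp, fun η _ => ?_⟩
    have : multiIndices d (∑ i, (0 : Fin d → ℕ) i) = {0} := by
      ext β
      simp [mem_multiIndices, funext_iff]
    rw [this]
    ext x
    simp
  | hs α i ih =>
    obtain ⟨c, hc, hη⟩ := ih
    set k := ∑ i, α i with hk
    -- The coefficient of `β` collects every way of writing `β = γ + e_j`. The guard removes the `j`
    -- for which truncated subtraction would give a wrong `γ`. Each of the `d` directions
    -- contributes at most `(d * B) ^ k * B`.
    refine ⟨fun β => ∑ j, if 1 ≤ β j then c (β - Pi.single j 1) *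
      L (EuclideanSpace.single i 1) j else 0, fun β => ?_, fun η hs => ?_⟩
    · rw [sum_add_single, ← hk]
      have hB0 : 0 ≤ B := (abs_nonneg _).trans (hB i i)
      calc |∑ j, if 1 ≤ β j then c (β - Pi.single j 1) * L (EuclideanSpace.single i 1) j else 0|
          ≤ ∑ j : Fin d, (d * B) ^ k * B := by
            refine (Finset.abs_sum_le_sum_abs _ _).trans (Finset.sum_le_sum fun j _ => ?_)
            split_ifs
            · rw [abs_mul]
              exact mul_le_mul (hc _) (hB i j) (abs_nonneg _) (by positivity)
            · simp; positivity
        _ = (d * B) ^ (k + 1) := by simp; ring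
    · have hcomp : Smooth (η ∘ affineHomeo L b) := hs.comp (contDiff_affineHomeo L b)
      rw [add_comm α, classicalDeriv_add hcomp, classicalDeriv_single, hη η hs,
        add_comm _ α, sum_add_single, ← hk]
      ext x
      have h1 : (fun x => ∑ β ∈ multiIndices d k, c β *
          classicalDeriv β η (affineHomeo L b x)) = (fun y => ∑ β ∈ multiIndices d k, c β *
          classicalDeriv β η y) ∘ affineHomeo L b := rfl
      have hsm : Smooth (fun y => ∑ β ∈ multiIndices d k, c β * classicalDeriv β η y) :=
        ContDiff.sum fun β _ => contDiff_const.mul (hs.classicalDeriv β)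
      have h2 : ∀ j, partialDeriv j (fun y => ∑ β ∈ multiIndices d k, c β *
          classicalDeriv β η y) = fun y => ∑ β ∈ multiIndices d k, c β *
            classicalDeriv (β + Pi.single j 1) η y := by
        intro j
        rw [← classicalDeriv_single, classicalDeriv_sum _ fun β _ => hs.classicalDeriv β]
        ext y
        refine Finset.sum_congr rfl fun β _ => ?_
        rw [add_comm β, classicalDeriv_add hs]
      rw [h1, partialDeriv_comp_affine hsm.differentiable]
      simp only [h2, Finset.sum_mul, Finset.mul_sum]
      rw [Finset.sum_comm (s := multiIndices d (k + 1))]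
      refine Finset.sum_congr rfl fun j _ => ?_
      simp only [ite_mul, zero_mul]
      rw [← Finset.sum_filter]
      have hcancel : ∀ β : Fin d → ℕ, 1 ≤ β j → β - Pi.single j 1 + Pi.single j 1 = β := by
        intro β hβ
        ext l
        rcases eq_or_ne l j with rfl | hl
        · simp; omega
        · simp [Pi.single_eq_of_ne hl]
      refine Finset.sum_nbij' (fun β => β + Pi.single j 1) (fun β => β - Pi.single j 1)
        ?_ ?_ ?_ ?_ ?_
      · intro β hβ
        simp only [Finset.mem_filter, mem_multiIndices] at hβ ⊢
        exact ⟨by rw [sum_add_single, hβ], by simp⟩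
      · intro β hβ
        simp only [Finset.mem_filter, mem_multiIndices] at hβ ⊢
        have := sum_add_single (β - Pi.single j 1) j
        rw [hcancel β hβ.2, hβ.1] at this
        omega
      · intro β _
        simp
      · intro β hβ
        simp only [Finset.mem_filter] at hβ
        exact hcancel β hβ.2
      · intro β _
        simp
        ring

end Classical

/-! ### Affine changes of variables -/

section AffineMeasure

variable {d : ℕ} (L : Space d ≃L[ℝ] Space d) (b : Space d)

/-- The factor by which `(affineHomeo L b)⁻¹` scales volumes. -/
def jac : ℝ≥0∞ := ENNReal.ofReal |(LinearMap.det (L : Space d →ₗ[ℝ] Space d))⁻¹|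

lemma jac_ne_zero : jac L ≠ 0 := by
  have : LinearMap.det (L : Space d →ₗ[ℝ] Space d) ≠ 0 := L.toLinearEquiv.isUnit_det'.ne_zero
  simp [jac, this]

lemma jac_ne_top : jac L ≠ ⊤ := ENNReal.ofReal_ne_top

/-- The pushforward identity from which the formulas below for integrals, volumes and $L^p$ norms
are read off. -/
lemma map_affineHomeo_restrict (s : Set (Space d)) :
    Measure.map (affineHomeo L b) (volume.restrict (affineHomeo L b ⁻¹' s)) =
      jac L • volume.restrict s := by
  have h1 : Measure.map (affineHomeo L b) volume = jac L • volume := by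
    have : (affineHomeo L b : Space d → Space d) =
        (fun y => y + b) ∘ (L : Space d →ₗ[ℝ] Space d) := rfl
    rw [this, ← Measure.map_map (by fun_prop) (by exact L.continuous.measurable),
      Measure.map_linearMap_addHaar_eq_smul_addHaar _ L.toLinearEquiv.isUnit_det'.ne_zero,
      Measure.map_smul, map_add_right_eq_self]
    rfl
  rw [← (affineHomeo L b).measurableEmbedding.restrict_map, h1, Measure.restrict_smul]

variable (s : Set (Space d))

lemma lintegral_comp_affineHomeo (F : Space d → ℝ≥0∞) :
    ∫⁻ x in affineHomeo L b ⁻¹' s, F (affineHomeo L b x) = jac L * ∫⁻ x in s, F x := by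
  rw [← (affineHomeo L b).measurableEmbedding.lintegral_map, map_affineHomeo_restrict,
    lintegral_smul_measure, smul_eq_mul]

lemma integral_comp_affineHomeo (F : Space d → ℝ) :
    ∫ x in affineHomeo L b ⁻¹' s, F (affineHomeo L b x) = (jac L).toReal * ∫ x in s, F x := by
  rw [← (affineHomeo L b).measurableEmbedding.integral_map, map_affineHomeo_restrict,
    integral_smul_measure, smul_eq_mul]

lemma volume_preimage_affineHomeo : volume (affineHomeo L b ⁻¹' s) = jac L * volume s := by
  simpa using lintegral_comp_affineHomeo L b s 1

lemma eLpNorm_comp_affineHomeo (F : Space d → ℝ) (p : ℝ≥0∞) :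
    eLpNorm (F ∘ affineHomeo L b) p (volume.restrict (affineHomeo L b ⁻¹' s)) =
      jac L ^ (1 / p).toReal * eLpNorm F p (volume.restrict s) := by
  rw [← (affineHomeo L b).measurableEmbedding.eLpNorm_map_measure, map_affineHomeo_restrict,
    eLpNorm_smul_measure_of_ne_zero (jac_ne_zero L), smul_eq_mul]

variable {s}

lemma tendsto_ae_affineHomeo : Filter.Tendsto (affineHomeo L b)
    (ae (volume.restrict (affineHomeo L b ⁻¹' s))) (ae (volume.restrict s)) := by
  have : Measure.QuasiMeasurePreserving (affineHomeo L b)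
      (volume.restrict (affineHomeo L b ⁻¹' s)) (volume.restrict s) :=
    ⟨(affineHomeo L b).measurable, by
      rw [map_affineHomeo_restrict]; exact Measure.smul_absolutelyContinuous⟩
  exact this.tendsto_ae

lemma ae_eq_comp_affineHomeo {F G : Space d → ℝ} (h : F =ᵐ[volume.restrict s] G) :
    F ∘ affineHomeo L b =ᵐ[volume.restrict (affineHomeo L b ⁻¹' s)] G ∘ affineHomeo L b :=
  (tendsto_ae_affineHomeo L b).eventually h

lemma integrableOn_comp_affineHomeo {F : Space d → ℝ} (h : IntegrableOn F s) :
    IntegrableOn (F ∘ affineHomeo L b) (affineHomeo L b ⁻¹' s) := by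
  rw [IntegrableOn, ← (affineHomeo L b).measurableEmbedding.integrable_map_iff,
    map_affineHomeo_restrict]
  exact Integrable.smul_measure h (jac_ne_top L)

lemma memLp_comp_affineHomeo {F : Space d → ℝ} {p : ℝ≥0∞} (h : MemLp F p (volume.restrict s)) :
    MemLp (F ∘ affineHomeo L b) p (volume.restrict (affineHomeo L b ⁻¹' s)) := by
  rw [← (affineHomeo L b).measurableEmbedding.memLp_map_measure_iff, map_affineHomeo_restrict]
  exact h.smul_measure (jac_ne_top L)

lemma locallyIntegrableOn_comp_affineHomeo {F : Space d → ℝ} (hs : IsOpen s)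
    (h : LocallyIntegrableOn F s) :
    LocallyIntegrableOn (F ∘ affineHomeo L b) (affineHomeo L b ⁻¹' s) := by
  rw [locallyIntegrableOn_iff (hs.preimage (affineHomeo L b).continuous).isLocallyClosed]
  intro k hk hkc
  have h2 := integrableOn_comp_affineHomeo L b
    (h.integrableOn_compact_subset (Set.image_subset_iff.2 hk)
      (hkc.image (affineHomeo L b).continuous))
  rwa [Set.preimage_image_eq _ (affineHomeo L b).injective] at h2

end AffineMeasure

/-! ### Weak derivatives -/

section Weak

variable {d : ℕ} {U : Set (Space d)}

/-- A test function on `U`. -/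
structure IsTest (U : Set (Space d)) (η : Space d → ℝ) : Prop where
  smooth : Smooth η
  compact : HasCompactSupport η
  subset : tsupport η ⊆ U

lemma IsTest.classicalDeriv {η : Space d → ℝ} (h : IsTest U η) (α : Fin d → ℕ) :
    IsTest U (Aniso.classicalDeriv α η) :=
  ⟨h.smooth.classicalDeriv α, hasCompactSupport_classicalDeriv h.smooth h.compact α,
    (tsupport_classicalDeriv_subset h.smooth α).trans h.subset⟩

/-- The product lives on the compact support of `η`, which lies in `U`, and there local
integrability is integrability. -/
lemma IsTest.integrableOn_mul {η f : Space d → ℝ} (h : IsTest U η)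
    (hf : LocallyIntegrableOn f U) : IntegrableOn (fun x => f x * η x) U := by
  have h1 : IntegrableOn (fun x => f x * η x) (tsupport η) :=
    (hf.integrableOn_compact_subset h.subset h.compact).mul_continuousOn
      h.smooth.continuous.continuousOn h.compact
  have h2 : Integrable (fun x => f x * η x) := by
    rw [← integrableOn_iff_integrable_of_support_subset (s := tsupport η)]
    · exact h1
    · intro x hx
      exact subset_tsupport _ (right_ne_zero_of_mul hx)
  exact h2.integrableOn

lemma IsTest.setIntegral_eq {η f : Space d → ℝ} (h : IsTest U η) :
    ∫ x in U, f x * η x = ∫ x, f x * η x := by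
  apply setIntegral_eq_integral_of_forall_compl_eq_zero
  intro x hx
  rw [image_eq_zero_of_notMem_tsupport fun hx' => hx (h.subset hx'), mul_zero]

lemma IsWeakDeriv.integral_eq {α : Fin d → ℕ} {f g η : Space d → ℝ} (h : IsWeakDeriv U α f g)
    (hη : IsTest U η) :
    ∫ x in U, f x * classicalDeriv α η x = (-1) ^ (∑ i, α i) * ∫ x in U, g x * η x :=
  h.2.2 η hη.smooth hη.compact hη.subset

lemma isWeakDeriv_of_isTest {α : Fin d → ℕ} {f g : Space d → ℝ}
    (hf : LocallyIntegrableOn f U) (hg : LocallyIntegrableOn g U)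
    (h : ∀ η, IsTest U η → ∫ x in U, f x * classicalDeriv α η x =
      (-1) ^ (∑ i, α i) * ∫ x in U, g x * η x) : IsWeakDeriv U α f g :=
  ⟨hf, hg, fun η h1 h2 h3 => h η ⟨h1, h2, h3⟩⟩

/-- The fundamental lemma of the calculus of variations, applied to `f - g`. It yields the
uniqueness of weak derivatives. -/
lemma ae_eq_of_integral_mul_test_eq (hU : IsOpen U) {f g : Space d → ℝ}
    (hf : LocallyIntegrableOn f U) (hg : LocallyIntegrableOn g U)
    (h : ∀ η, IsTest U η → ∫ x in U, f x * η x = ∫ x in U, g x * η x) :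
    f =ᵐ[volume.restrict U] g := by
  have := hU.ae_eq_zero_of_integral_contDiff_smul_eq_zero (hf.sub hg) fun η h1 h2 h3 => by
    have ht : IsTest U η := ⟨h1, h2, h3⟩
    have h4 := h η ht
    rw [← sub_eq_zero, ← integral_sub (ht.integrableOn_mul hf) (ht.integrableOn_mul hg)] at h4
    simp_rw [← sub_mul] at h4
    rw [ht.setIntegral_eq (f := fun x => f x - g x)] at h4
    simpa [mul_comm] using h4
  rw [Filter.EventuallyEq, ae_restrict_iff' hU.measurableSet]
  filter_upwards [this] with x hx hxU
  exact sub_eq_zero.1 (hx hxU)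

lemma neg_one_pow_mul_self_cancel {n : ℕ} {a b : ℝ} (h : (-1) ^ n * a = (-1) ^ n * b) : a = b :=
  mul_left_cancel₀ (pow_ne_zero n (by norm_num)) h

lemma IsWeakDeriv.ae_eq (hU : IsOpen U) {α : Fin d → ℕ} {f g g' : Space d → ℝ}
    (h : IsWeakDeriv U α f g) (h' : IsWeakDeriv U α f g') : g =ᵐ[volume.restrict U] g' :=
  ae_eq_of_integral_mul_test_eq hU h.2.1 h'.2.1 fun _ hη =>
    neg_one_pow_mul_self_cancel ((h.integral_eq hη).symm.trans (h'.integral_eq hη))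

lemma IsWeakDeriv.isWeakDeriv_weakDeriv {α : Fin d → ℕ} {f g : Space d → ℝ}
    (h : IsWeakDeriv U α f g) : IsWeakDeriv U α f (weakDeriv U α f) := by
  have h' : ∃ g, IsWeakDeriv U α f g := ⟨g, h⟩
  rw [weakDeriv, dif_pos h']
  exact h'.choose_spec

lemma IsWeakDeriv.weakDeriv_ae_eq (hU : IsOpen U) {α : Fin d → ℕ} {f g : Space d → ℝ}
    (h : IsWeakDeriv U α f g) : weakDeriv U α f =ᵐ[volume.restrict U] g :=
  h.isWeakDeriv_weakDeriv.ae_eq hU h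

lemma locallyIntegrableOn_congr {f g : Space d → ℝ}
    (hf : LocallyIntegrableOn f U) (h : f =ᵐ[volume.restrict U] g) : LocallyIntegrableOn g U := by
  intro x hx
  obtain ⟨s, hs, hfs⟩ := hf x hx
  refine ⟨s ∩ U, Filter.inter_mem hs self_mem_nhdsWithin, ?_⟩
  exact (hfs.mono_set Set.inter_subset_left).congr
    (ae_mono (Measure.restrict_mono Set.inter_subset_right le_rfl) h)

lemma IsWeakDeriv.congr {α : Fin d → ℕ} {f f' g g' : Space d → ℝ}
    (h : IsWeakDeriv U α f g) (hf : f =ᵐ[volume.restrict U] f')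
    (hg : g =ᵐ[volume.restrict U] g') : IsWeakDeriv U α f' g' := by
  refine isWeakDeriv_of_isTest (locallyIntegrableOn_congr h.1 hf)
    (locallyIntegrableOn_congr h.2.1 hg) fun η hη => ?_
  have e1 : ∫ x in U, f' x * classicalDeriv α η x = ∫ x in U, f x * classicalDeriv α η x :=
    integral_congr_ae (by filter_upwards [hf] with x hx; rw [hx])
  have e2 : ∫ x in U, g' x * η x = ∫ x in U, g x * η x :=
    integral_congr_ae (by filter_upwards [hg] with x hx; rw [hx])
  rw [e1, e2]
  exact h.integral_eq hη

lemma LocallyIntegrableOn.sum_mul {ι : Type*} (s : Finset ι) (c : ι → ℝ) {f : ι → Space d → ℝ}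
    (hf : ∀ i ∈ s, LocallyIntegrableOn (f i) U) :
    LocallyIntegrableOn (fun x => ∑ i ∈ s, c i * f i x) U := by
  classical
  induction s using Finset.induction_on with
  | empty => simpa using (locallyIntegrable_const (0 : ℝ)).locallyIntegrableOn U
  | insert i s hi ih =>
    simp only [Finset.sum_insert hi]
    exact ((hf i (Finset.mem_insert_self i s)).smul (c i)).add
      (ih fun j hj => hf j (Finset.mem_insert_of_mem hj))

lemma IsTest.integral_sum_mul {ι : Type*} (s : Finset ι) (c : ι → ℝ) {f : ι → Space d → ℝ}
    (hf : ∀ i ∈ s, LocallyIntegrableOn (f i) U) {η : Space d → ℝ} (hη : IsTest U η) :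
    ∫ x in U, (∑ i ∈ s, c i * f i x) * η x = ∑ i ∈ s, c i * ∫ x in U, f i x * η x := by
  simp_rw [Finset.sum_mul, mul_assoc]
  rw [integral_finsetSum _ fun i hi => (hη.integrableOn_mul (hf i hi)).const_mul (c i)]
  simp_rw [integral_const_mul]

lemma IsWeakDeriv.sum {ι : Type*} (s : Finset ι) (c : ι → ℝ) {α : Fin d → ℕ}
    {f g : ι → Space d → ℝ} (h : ∀ i ∈ s, IsWeakDeriv U α (f i) (g i)) :
    IsWeakDeriv U α (fun x => ∑ i ∈ s, c i * f i x) (fun x => ∑ i ∈ s, c i * g i x) := by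
  refine isWeakDeriv_of_isTest (LocallyIntegrableOn.sum_mul s c fun i hi => (h i hi).1)
    (LocallyIntegrableOn.sum_mul s c fun i hi => (h i hi).2.1) fun η hη => ?_
  rw [(hη.classicalDeriv α).integral_sum_mul s c fun i hi => (h i hi).1,
    hη.integral_sum_mul s c fun i hi => (h i hi).2.1, Finset.mul_sum]
  refine Finset.sum_congr rfl fun i hi => ?_
  rw [(h i hi).integral_eq hη]
  ring

lemma IsWeakDeriv.sub {α : Fin d → ℕ} {f g f' g' : Space d → ℝ} (h : IsWeakDeriv U α f g)
    (h' : IsWeakDeriv U α f' g') : IsWeakDeriv U α (f - f') (g - g') := by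
  have := IsWeakDeriv.sum Finset.univ ![1, -1] (f := ![f, f']) (g := ![g, g']) (U := U) (α := α)
    (by intro i _; fin_cases i; exacts [h, h'])
  convert this using 1 <;> (ext x; simp; ring)

lemma Smooth.isWeakDeriv {f : Space d → ℝ} (hf : Smooth f) (α : Fin d → ℕ) :
    IsWeakDeriv U α f (Aniso.classicalDeriv α f) := by
  refine isWeakDeriv_of_isTest (hf.continuous.locallyIntegrable.locallyIntegrableOn U)
    ((hf.classicalDeriv α).continuous.locallyIntegrable.locallyIntegrableOn U) fun η hη => ?_
  rw [(hη.classicalDeriv α).setIntegral_eq, hη.setIntegral_eq,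
    integral_mul_classicalDeriv hf hη.smooth hη.compact]

/-- If `g = ∂^α f` and `G = ∂^(α+β) f`, then `G = ∂^β g`. -/
lemma IsWeakDeriv.of_add {α β : Fin d → ℕ} {f g G : Space d → ℝ} (h : IsWeakDeriv U α f g)
    (h' : IsWeakDeriv U (α + β) f G) : IsWeakDeriv U β g G := by
  refine isWeakDeriv_of_isTest h.2.1 h'.2.1 fun η hη => ?_
  have h1 := h.integral_eq (hη.classicalDeriv β)
  have h2 := h'.integral_eq hη
  rw [classicalDeriv_add hη.smooth, h1] at h2
  simp only [Pi.add_apply, Finset.sum_add_distrib, pow_add, mul_assoc] at h2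
  exact neg_one_pow_mul_self_cancel h2

lemma IsTest.comp_affineHomeo_symm (L : Space d ≃L[ℝ] Space d) (b : Space d) {η : Space d → ℝ}
    (hη : IsTest (affineHomeo L b ⁻¹' U) η) : IsTest U (η ∘ (affineHomeo L b).symm) := by
  refine ⟨?_, hη.compact.comp_homeomorph _, ?_⟩
  · rw [affineHomeo_symm]
    exact ContDiff.comp hη.smooth (contDiff_affineHomeo _ _)
  · rw [tsupport_comp_eq_preimage]
    intro y hy
    have := hη.subset hy
    rwa [Set.mem_preimage, Homeomorph.apply_symm_apply] at this

/-- Weak derivatives and affine changes of variables. -/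
lemma IsWeakDeriv.comp_affineHomeo (L : Space d ≃L[ℝ] Space d) (b : Space d) (hU : IsOpen U)
    {α : Fin d → ℕ} {f : Space d → ℝ} {ι : Type*} {M : Finset ι} {β : ι → Fin d → ℕ}
    {g : ι → Space d → ℝ} {c : ι → ℝ} (hM : ∀ a ∈ M, ∑ i, β a i = ∑ i, α i)
    (hf : LocallyIntegrableOn f U) (h : ∀ a ∈ M, IsWeakDeriv U (β a) f (g a))
    (hc : ∀ η : Space d → ℝ, Smooth η → classicalDeriv α (η ∘ affineHomeo L b) =
        fun x => ∑ a ∈ M, c a * classicalDeriv (β a) η (affineHomeo L b x)) :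
    IsWeakDeriv (affineHomeo L b ⁻¹' U) α (f ∘ affineHomeo L b)
      (fun x => ∑ a ∈ M, c a * g a (affineHomeo L b x)) := by
  have hg : LocallyIntegrableOn (fun y => ∑ a ∈ M, c a * g a y) U :=
    LocallyIntegrableOn.sum_mul M c fun a ha => (h a ha).2.1
  refine isWeakDeriv_of_isTest (locallyIntegrableOn_comp_affineHomeo L b hU hf)
    (locallyIntegrableOn_comp_affineHomeo L b hU hg) fun η hη => ?_
  -- Every test function on the preimage is the pullback of a test function on `U`. The classical
  -- chain rule `hc` then moves the derivative onto `ζ`, and all integrals become integrals over `U`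
  -- with the same Jacobian.
  obtain ⟨ζ, hηζ, htest⟩ : ∃ ζ : Space d → ℝ, η = ζ ∘ affineHomeo L b ∧ IsTest U ζ :=
    ⟨η ∘ (affineHomeo L b).symm, by rw [Function.comp_assoc, Homeomorph.symm_comp_self]; rfl,
      hη.comp_affineHomeo_symm L b⟩
  have e1 : ∀ x, f (affineHomeo L b x) * classicalDeriv α η x =
      (fun y => f y * ∑ a ∈ M, c a * classicalDeriv (β a) ζ y) (affineHomeo L b x) := by
    intro x
    rw [hηζ, hc ζ htest.smooth]
  have e2 : ∀ x, (∑ a ∈ M, c a * g a (affineHomeo L b x)) * η x =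
      (fun y => (∑ a ∈ M, c a * g a y) * ζ y) (affineHomeo L b x) := by
    intro x
    rw [hηζ]
    rfl
  simp only [Function.comp_apply, e1, e2]
  rw [integral_comp_affineHomeo L b U (fun y => f y * ∑ a ∈ M, c a * classicalDeriv (β a) ζ y),
    integral_comp_affineHomeo L b U (fun y => (∑ a ∈ M, c a * g a y) * ζ y),
    htest.integral_sum_mul M c fun a ha => (h a ha).2.1]
  simp_rw [Finset.mul_sum]
  rw [integral_finsetSum _ fun a ha => ?_, Finset.mul_sum]
  · refine Finset.sum_congr rfl fun a ha => ?_
    have := (h a ha).integral_eq htest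
    rw [hM a ha] at this
    simp_rw [mul_left_comm (f _)]
    rw [integral_const_mul, this]
    ring
  · simp_rw [mul_left_comm (f _)]
    exact ((htest.classicalDeriv (β a)).integrableOn_mul hf).const_mul (c a)

lemma IsWeakDeriv.comp_affineHomeo_single (L : Space d ≃L[ℝ] Space d) (b : Space d)
    (hU : IsOpen U) {f : Space d → ℝ} {g : Fin d → Space d → ℝ}
    (hf : LocallyIntegrableOn f U) (h : ∀ j, IsWeakDeriv U (Pi.single j 1) f (g j)) (i : Fin d) :
    IsWeakDeriv (affineHomeo L b ⁻¹' U) (Pi.single i 1) (f ∘ affineHomeo L b)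
      ((fun y => ∑ j, L (EuclideanSpace.single i 1) j * g j y) ∘ affineHomeo L b) := by
  refine IsWeakDeriv.comp_affineHomeo L b hU (M := Finset.univ) (β := fun j => Pi.single j 1)
    (c := fun j => L (EuclideanSpace.single i 1) j) (by simp) hf (fun j _ => h j) fun η hη => ?_
  ext x
  simp only [classicalDeriv_single]
  exact partialDeriv_comp_affine hη.differentiable L b i x

end Weak

/-! ### Integral inequalities on convex sets -/

section Convex

variable {d : ℕ}

/-- Scaling by a nonzero factor. -/
def scaleEquiv (d : ℕ) (r : ℝ) (hr : r ≠ 0) : Space d ≃L[ℝ] Space d :=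
  ContinuousLinearEquiv.smulLeft (Units.mk0 r hr)

@[simp] lemma scaleEquiv_apply (r : ℝ) (hr : r ≠ 0) (x : Space d) :
    scaleEquiv d r hr x = r • x := rfl

lemma jac_scaleEquiv (r : ℝ) (hr : r ≠ 0) :
    jac (scaleEquiv d r hr) = ENNReal.ofReal |(r ^ d)⁻¹| := by
  have : ((scaleEquiv d r hr : Space d ≃L[ℝ] Space d) : Space d →ₗ[ℝ] Space d) =
      r • LinearMap.id := rfl
  rw [jac, this, LinearMap.det_smul]
  simp

lemma jac_scaleEquiv_le {r : ℝ} (hr : r ≠ 0) (h : 1 / 2 ≤ r) :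
    jac (scaleEquiv d r hr) ≤ 2 ^ d := by
  rw [jac_scaleEquiv, abs_of_nonneg (by positivity)]
  refine (ENNReal.ofReal_le_ofReal (q := 2 ^ d) ?_).trans (by
    rw [ENNReal.ofReal_pow (by norm_num)]; simp)
  rw [← inv_pow]
  refine pow_le_pow_left₀ (by positivity) ?_ _
  rw [inv_le_comm₀ (by linarith) (by norm_num)]
  linarith

/-- Contracting homotheties with ratio at least `1/2` do not increase integrals by more
than `2^d`. -/
lemma lintegral_homothety_le {s s' : Set (Space d)} {r : ℝ} (h : 1 / 2 ≤ r) (v : Space d)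
    (hs : ∀ x ∈ s, r • x + v ∈ s') (F : Space d → ℝ≥0∞) :
    ∫⁻ x in s, F (r • x + v) ≤ 2 ^ d * ∫⁻ x in s', F x := by
  have hr : r ≠ 0 := by linarith
  calc ∫⁻ x in s, F (r • x + v)
      ≤ ∫⁻ x in affineHomeo (scaleEquiv d r hr) v ⁻¹' s', F (r • x + v) :=
        lintegral_mono_set fun x hx => hs x hx
    _ = jac (scaleEquiv d r hr) * ∫⁻ x in s', F x :=
        lintegral_comp_affineHomeo (scaleEquiv d r hr) v s' F
    _ ≤ _ := by gcongr; exact jac_scaleEquiv_le hr h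

/-- The fundamental theorem of calculus along a segment. The length parameter `T` is free because
the Poincaré inequality runs the whole segment and the layer estimate only an initial piece. -/
lemma enorm_sub_le_lintegral_fderiv {G : Space d → ℝ} (hG : ContDiff ℝ 1 G) (x v : Space d)
    {T : ℝ} (hT : 0 ≤ T) :
    ‖G (x + T • v) - G x‖ₑ ≤ ∫⁻ t in Set.Ioc 0 T, ‖fderiv ℝ G (x + t • v)‖ₑ * ‖v‖ₑ := by
  have hcont : Continuous fun t : ℝ => fderiv ℝ G (x + t • v) v :=
    ((hG.continuous_fderiv one_ne_zero).comp (by fun_prop)).clm_apply continuous_const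
  have hderiv : ∀ t : ℝ, HasDerivAt (fun t : ℝ => G (x + t • v)) (fderiv ℝ G (x + t • v) v) t := by
    intro t
    have h1 : HasDerivAt (fun t : ℝ => x + t • v) v t := by
      simpa using ((hasDerivAt_id t).smul_const v).const_add x
    exact ((hG.differentiable one_ne_zero) _).hasFDerivAt.comp_hasDerivAt t h1
  have h := intervalIntegral.integral_eq_sub_of_hasDerivAt (a := 0) (b := T)
    (fun t _ => hderiv t) (hcont.intervalIntegrable _ _)
  simp only [zero_smul, add_zero] at h
  rw [← h, intervalIntegral.integral_of_le hT]
  refine (enorm_integral_le_lintegral_enorm _).trans (lintegral_mono fun t => ?_)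
  exact ContinuousLinearMap.le_opENorm _ _

/-- Jensen's inequality, obtained from the monotonicity of $L^p$ norms in the exponent on a
probability space. -/
lemma lintegral_rpow_le {α : Type*} [MeasurableSpace α] {μ : Measure α} [IsProbabilityMeasure μ]
    {f : α → ℝ≥0∞} (hf : AEMeasurable f μ) {p : ℝ} (hp : 1 ≤ p) :
    (∫⁻ a, f a ∂μ) ^ p ≤ ∫⁻ a, f a ^ p ∂μ := by
  have := eLpNorm'_le_eLpNorm'_of_exponent_le (f := f) one_pos hp μ hf.aestronglyMeasurable
  simp only [eLpNorm', enorm_eq_self, ENNReal.rpow_one, div_one] at this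
  calc _ ≤ ((∫⁻ a, f a ^ p ∂μ) ^ (1 / p)) ^ p := ENNReal.rpow_le_rpow this (by linarith)
    _ = _ := by rw [← ENNReal.rpow_mul, one_div, inv_mul_cancel₀ (by linarith), ENNReal.rpow_one]

variable {U : Set (Space d)} {D : ℝ≥0}

/-- The Poincaré inequality on convex sets, in double integral form. -/
lemma lintegral_lintegral_sub_rpow_le (hU : Convex ℝ U) (hUm : MeasurableSet U)
    (hD : ∀ x ∈ U, ∀ y ∈ U, ‖y - x‖₊ ≤ D) {p : ℝ} (hp : 1 ≤ p) {G : Space d → ℝ}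
    (hG : ContDiff ℝ 1 G) :
    ∫⁻ y in U, ∫⁻ x in U, ‖G y - G x‖ₑ ^ p ≤
      2 ^ d * D ^ p * volume U * ∫⁻ x in U, ‖fderiv ℝ G x‖ₑ ^ p := by
  have hp0 : 0 ≤ p := by linarith
  set F : Space d → ℝ≥0∞ := fun z => ‖fderiv ℝ G z‖ₑ ^ p with hF
  have hFc : Continuous F :=
    ENNReal.continuous_rpow_const.comp (hG.continuous_fderiv one_ne_zero).enorm
  set I : Set ℝ := Set.Ioc 0 1
  have : IsProbabilityMeasure (volume.restrict I) := ⟨by simp [I]⟩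
  have h1 : ∀ y ∈ U, ∀ x ∈ U, ‖G y - G x‖ₑ ^ p ≤
      D ^ p * ∫⁻ t in I, F (x + t • (y - x)) := by
    intro y hy x hx
    have h2 : ‖G y - G x‖ₑ ≤ ∫⁻ t in I, D * ‖fderiv ℝ G (x + t • (y - x))‖ₑ := by
      have := enorm_sub_le_lintegral_fderiv hG x (y - x) zero_le_one
      simp only [one_smul, add_sub_cancel] at this
      refine this.trans (lintegral_mono fun t => ?_)
      rw [mul_comm]
      gcongr
      exact ENNReal.coe_le_coe.2 (hD x hx y hy)
    have hm : Continuous fun t : ℝ => ‖fderiv ℝ G (x + t • (y - x))‖ₑ :=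
      ((hG.continuous_fderiv one_ne_zero).comp (by fun_prop)).enorm
    calc ‖G y - G x‖ₑ ^ p ≤ (∫⁻ t in I, D * ‖fderiv ℝ G (x + t • (y - x))‖ₑ) ^ p :=
          ENNReal.rpow_le_rpow h2 hp0
      _ = D ^ p * (∫⁻ t in I, ‖fderiv ℝ G (x + t • (y - x))‖ₑ) ^ p := by
          rw [lintegral_const_mul _ hm.measurable, ENNReal.mul_rpow_of_nonneg _ _ hp0]
      _ ≤ _ := by
          gcongr
          exact lintegral_rpow_le hm.measurable.aemeasurable hp
  have hmeas : Measurable fun z : (Space d × Space d) × ℝ => F (z.1.2 + z.2 • (z.1.1 - z.1.2)) :=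
    hFc.measurable.comp (by fun_prop)
  have hmeas2 : Measurable fun z : Space d × Space d =>
      ∫⁻ t in I, F (z.2 + t • (z.1 - z.2)) := hmeas.lintegral_prod_right'
  -- The point on the segment depends on `x` by a homothety of ratio `1 - t` and on `y` by one of
  -- ratio `t`. One ratio is at least `1/2`: that variable is integrated first, at the cost of `2 ^
  -- d`, and the other contributes the volume of `U`.
  have h2 : ∀ t ∈ I, ∫⁻ y in U, ∫⁻ x in U, F (x + t • (y - x)) ≤
      2 ^ d * volume U * ∫⁻ x in U, F x := by
    intro t ht
    have hconv : ∀ x ∈ U, ∀ y ∈ U, x + t • (y - x) ∈ U := fun x hx y hy =>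
      hU.add_smul_sub_mem hx hy ⟨ht.1.le, ht.2⟩
    have hle : ∀ (A : Space d → ℝ≥0∞), (∀ y ∈ U, A y ≤ 2 ^ d * ∫⁻ x in U, F x) →
        ∫⁻ y in U, A y ≤ 2 ^ d * volume U * ∫⁻ x in U, F x := by
      intro A hA
      calc ∫⁻ y in U, A y ≤ ∫⁻ y in U, 2 ^ d * ∫⁻ x in U, F x := setLIntegral_mono' hUm hA
        _ = _ := by rw [setLIntegral_const]; ring
    rcases le_total t (1 / 2) with h | h
    · refine hle _ fun y hy => ?_
      have e : ∀ x, x + t • (y - x) = (1 - t) • x + t • y := fun x => by module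
      simp_rw [e]
      exact lintegral_homothety_le (by linarith) _ (fun x hx => e x ▸ hconv x hx y hy) F
    · rw [lintegral_lintegral_swap (f := fun y x => F (x + t • (y - x))) (by
        exact (hFc.measurable.comp (by fun_prop)).aemeasurable)]
      refine hle _ fun x hx => ?_
      have e : ∀ y, x + t • (y - x) = t • y + (1 - t) • x := fun x => by module
      simp_rw [e]
      exact lintegral_homothety_le h _ (fun y hy => e y ▸ hconv x hx y hy) F
  calc ∫⁻ y in U, ∫⁻ x in U, ‖G y - G x‖ₑ ^ p
      ≤ ∫⁻ y in U, ∫⁻ x in U, D ^ p * ∫⁻ t in I, F (x + t • (y - x)) :=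
        setLIntegral_mono' hUm fun y hy => setLIntegral_mono' hUm fun x hx => h1 y hy x hx
    _ = D ^ p * ∫⁻ y in U, ∫⁻ x in U, ∫⁻ t in I, F (x + t • (y - x)) := by
        have hm : Measurable fun y : Space d => ∫⁻ x in U, ∫⁻ t in I, F (x + t • (y - x)) :=
          hmeas2.lintegral_prod_right'
        rw [← lintegral_const_mul _ hm]
        refine lintegral_congr fun y => ?_
        have hm : Measurable fun x : Space d => ∫⁻ t in I, F (x + t • (y - x)) := by
          have hm : Measurable fun z : Space d × ℝ => F (z.1 + z.2 • (y - z.1)) :=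
            hFc.measurable.comp (by fun_prop)
          exact hm.lintegral_prod_right'
        rw [lintegral_const_mul _ hm]
    _ = D ^ p * ∫⁻ t in I, ∫⁻ y in U, ∫⁻ x in U, F (x + t • (y - x)) := by
        congr 1
        rw [← lintegral_lintegral_swap (f := fun (y : Space d) (t : ℝ) =>
          ∫⁻ x in U, F (x + t • (y - x)))]
        · refine lintegral_congr fun y => ?_
          rw [lintegral_lintegral_swap (f := fun (x : Space d) (t : ℝ) => F (x + t • (y - x)))]
          have hm : Measurable fun z : Space d × ℝ => F (z.1 + z.2 • (y - z.1)) :=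
            hFc.measurable.comp (by fun_prop)
          exact hm.aemeasurable
        · have hm : Measurable fun z : (Space d × ℝ) × Space d =>
              F (z.2 + z.1.2 • (z.1.1 - z.2)) := hFc.measurable.comp (by fun_prop)
          have hm' : Measurable fun z : Space d × ℝ => ∫⁻ x in U, F (x + z.2 • (z.1 - x)) :=
            hm.lintegral_prod_right'
          exact hm'.aemeasurable
    _ ≤ D ^ p * ∫⁻ _ in I, 2 ^ d * volume U * ∫⁻ x in U, F x := by
        exact mul_le_mul_right (setLIntegral_mono' measurableSet_Ioc h2) _
    _ = _ := by
        rw [lintegral_const, measure_univ]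
        ring

/-- The integral of a function over a thin layer `{ℓ ≤ δ}` at a face of a convex set. -/
lemma lintegral_layer_le (hUm : MeasurableSet U) {ℓ : Space d → ℝ} (hℓ : Measurable ℓ) {p : Space d}
    (hℓp : ∀ x t, ℓ (x + t • (p - x)) = ℓ x + t * (1 - ℓ x)) (hpos : ∀ x ∈ U, 0 < ℓ x)
    (hmem : ∀ x ∈ U, ∀ t ∈ Set.Ioc (0 : ℝ) (1 / 2), x + t • (p - x) ∈ U)
    (hD : ∀ x ∈ U, ‖p - x‖₊ ≤ D) {δ : ℝ} {G : Space d → ℝ} (hG : ContDiff ℝ 1 G) :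
    ∫⁻ x in U ∩ {x | ℓ x ≤ δ}, ‖G x‖ₑ ≤
      2 ^ d * ENNReal.ofReal δ * ∫⁻ x in U, (2 * ‖G x‖ₑ + D * ‖fderiv ℝ G x‖ₑ) := by
  set F : Space d → ℝ≥0∞ := fun x => 2 * ‖G x‖ₑ + D * ‖fderiv ℝ G x‖ₑ with hF
  have hGd := hG.continuous_fderiv one_ne_zero
  have hFm : Measurable F := by
    have h1 := hG.continuous.enorm.measurable
    have h2 := hGd.enorm.measurable
    fun_prop
  -- Each point of the layer is moved towards `p` for a time `t` in `J`, and the values met are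
  -- averaged. The length `1/2` of `J` produces the factor `2` in `F`, and `t ≤ 1/2` keeps the
  -- homothety ratio `1 - t` at least `1/2`.
  set J : Set ℝ := Set.Ioc 0 (1 / 2)
  have hJ : volume J = 2⁻¹ := by
    simp [J]
  set S := U ∩ {x | ℓ x ≤ δ} with hS
  have hSm : MeasurableSet S := hUm.inter (measurableSet_le hℓ measurable_const)
  have h1 : ∀ x ∈ S, ‖G x‖ₑ ≤ ∫⁻ t in J, F (x + t • (p - x)) := by
    intro x hx
    set B : ℝ≥0∞ := ∫⁻ t in J, D * ‖fderiv ℝ G (x + t • (p - x))‖ₑ with hB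
    have hmD : Measurable fun t : ℝ => D * ‖fderiv ℝ G (x + t • (p - x))‖ₑ :=
      (hGd.comp (by fun_prop)).enorm.measurable.const_mul _
    have hmG : Measurable fun t : ℝ => 2 * ‖G (x + t • (p - x))‖ₑ :=
      (hG.continuous.comp (by fun_prop)).enorm.measurable.const_mul _
    have h2 : ∀ t ∈ J, ‖G x‖ₑ ≤ ‖G (x + t • (p - x))‖ₑ + B := by
      intro t ht
      have h3 := enorm_sub_le_lintegral_fderiv hG x (p - x) ht.1.le
      have h4 : ‖G (x + t • (p - x)) - G x‖ₑ ≤ B := by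
        refine h3.trans ((lintegral_mono_set (Set.Ioc_subset_Ioc_right ht.2)).trans
          (lintegral_mono fun s => ?_))
        rw [mul_comm]
        gcongr
        exact ENNReal.coe_le_coe.2 (hD x hx.1)
      calc ‖G x‖ₑ = ‖G (x + t • (p - x)) - (G (x + t • (p - x)) - G x)‖ₑ := by
            rw [sub_sub_cancel]
        _ ≤ _ := (enorm_sub_le).trans (by gcongr)
    calc ‖G x‖ₑ = ∫⁻ _ in J, 2 * ‖G x‖ₑ := by
          rw [setLIntegral_const, hJ, mul_right_comm,
            ENNReal.mul_inv_cancel (by norm_num) (by norm_num), one_mul]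
      _ ≤ ∫⁻ t in J, (2 * ‖G (x + t • (p - x))‖ₑ + 2 * B) := by
          refine setLIntegral_mono' measurableSet_Ioc fun t ht => ?_
          rw [← mul_add]
          gcongr
          exact h2 t ht
      _ = (∫⁻ t in J, 2 * ‖G (x + t • (p - x))‖ₑ) + B := by
          rw [lintegral_add_left hmG, setLIntegral_const, hJ, mul_right_comm,
            ENNReal.mul_inv_cancel (by norm_num) (by norm_num), one_mul]
      _ = _ := by rw [hB, ← lintegral_add_left hmG]
  -- After time `t` the value of `ℓ` is `t + (1 - t) * ℓ x` with `0 < ℓ x ≤ δ`, so the layer has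
  -- been carried into the slab `t ≤ ℓ ≤ t + δ`.
  have h2 : ∀ t ∈ J, ∫⁻ x in S, F (x + t • (p - x)) ≤
      2 ^ d * ∫⁻ x in U, {x | ℓ x ∈ Set.Icc t (t + δ)}.indicator F x := by
    intro t ht
    have hset : MeasurableSet {x | ℓ x ∈ Set.Icc t (t + δ)} := hℓ measurableSet_Icc
    rw [setLIntegral_indicator hset]
    have e : ∀ x, x + t • (p - x) = (1 - t) • x + t • p := fun x => by module
    simp_rw [e]
    refine lintegral_homothety_le (by linarith [ht.2]) _ (fun x hx => ?_) F
    rw [← e]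
    refine ⟨?_, hmem x hx.1 t ht⟩
    have h3 := hpos x hx.1
    have h4 : ℓ x ≤ δ := hx.2
    have h5 : 0 < t := ht.1
    have h6 : t ≤ 1 / 2 := ht.2
    simp only [Set.mem_ofPred_eq, hℓp, Set.mem_Icc]
    constructor <;> nlinarith
  calc ∫⁻ x in S, ‖G x‖ₑ ≤ ∫⁻ x in S, ∫⁻ t in J, F (x + t • (p - x)) :=
        setLIntegral_mono' hSm h1
    _ = ∫⁻ t in J, ∫⁻ x in S, F (x + t • (p - x)) := by
        rw [lintegral_lintegral_swap (f := fun (x : Space d) (t : ℝ) => F (x + t • (p - x)))]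
        exact (hFm.comp (by fun_prop)).aemeasurable
    _ ≤ ∫⁻ t in J, 2 ^ d * ∫⁻ x in U, {x | ℓ x ∈ Set.Icc t (t + δ)}.indicator F x :=
        setLIntegral_mono' measurableSet_Ioc h2
    _ ≤ ∫⁻ t, 2 ^ d * ∫⁻ x in U, {x | ℓ x ∈ Set.Icc t (t + δ)}.indicator F x :=
        setLIntegral_le_lintegral _ _
    -- A fixed `x` belongs to the slab only for `t` in an interval of length `δ`. Integrating in `t`
    -- first is what gains the factor `δ`.
    _ = 2 ^ d * ∫⁻ t, ∫⁻ x in U, (Set.Icc (ℓ x - δ) (ℓ x)).indicator (fun _ => F x) t := by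
        rw [lintegral_const_mul']
        · congr 1
          refine lintegral_congr fun t => lintegral_congr fun x => ?_
          simp only [Set.indicator_apply, Set.mem_ofPred_eq, Set.mem_Icc]
          congr 1
          rw [sub_le_iff_le_add, and_comm]
        · simp
    _ = 2 ^ d * ∫⁻ x in U, ∫⁻ t, (Set.Icc (ℓ x - δ) (ℓ x)).indicator (fun _ => F x) t := by
        rw [lintegral_lintegral_swap]
        refine Measurable.aemeasurable ?_
        have : Function.uncurry (fun (t : ℝ) (x : Space d) =>
            (Set.Icc (ℓ x - δ) (ℓ x)).indicator (fun _ => F x) t) =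
            {z : ℝ × Space d | ℓ z.2 - δ ≤ z.1 ∧ z.1 ≤ ℓ z.2}.indicator (fun z => F z.2) := by
          ext z
          simp [Set.indicator_apply, Function.uncurry]
        rw [this]
        refine (hFm.comp measurable_snd).indicator ?_
        exact (measurableSet_le ((hℓ.comp measurable_snd).sub_const δ) measurable_fst).inter
          (measurableSet_le measurable_fst (hℓ.comp measurable_snd))
    _ = 2 ^ d * ∫⁻ x in U, F x * ENNReal.ofReal δ := by
        congr 1
        refine lintegral_congr fun x => ?_
        rw [lintegral_indicator measurableSet_Icc, setLIntegral_const, Real.volume_Icc]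
        congr 2
        ring
    _ = _ := by
        rw [lintegral_mul_const _ hFm]
        ring

end Convex

/-! ### Sobolev inequalities on simplices -/

section Simplex

variable {d : ℕ} (b : AffineBasis (Fin (d + 1)) ℝ (Space d))

/-- The open simplex spanned by an affine basis. -/
def openSimplex : Set (Space d) := interior (convexHull ℝ (Set.range b))

lemma mem_openSimplex {x : Space d} : x ∈ openSimplex b ↔ ∀ i, 0 < b.coord i x := by
  rw [openSimplex, b.interior_convexHull]
  rfl

lemma isOpen_openSimplex : IsOpen (openSimplex b) := isOpen_interior

lemma convex_openSimplex : Convex ℝ (openSimplex b) := (convex_convexHull ℝ _).interior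

lemma isCompact_convexHull_basis : IsCompact (convexHull ℝ (Set.range b)) :=
  (Set.finite_range b).isCompact_convexHull ℝ

lemma openSimplex_subset : openSimplex b ⊆ convexHull ℝ (Set.range b) := interior_subset

lemma volume_openSimplex_lt_top : volume (openSimplex b) < ⊤ :=
  (measure_mono (openSimplex_subset b)).trans_lt (isCompact_convexHull_basis b).measure_lt_top

lemma volume_openSimplex_ne_zero : volume (openSimplex b) ≠ 0 :=
  ((isOpen_openSimplex b).measure_pos volume
    ⟨_, b.centroid_mem_interior_convexHull⟩).ne'

lemma exists_diam_bound : ∃ D : ℝ≥0, ∀ x ∈ convexHull ℝ (Set.range b),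
    ∀ y ∈ convexHull ℝ (Set.range b), ‖y - x‖₊ ≤ D := by
  obtain ⟨C, hC⟩ := (isCompact_convexHull_basis b).isBounded.exists_norm_le
  refine ⟨(2 * C).toNNReal, fun x hx y hy => ?_⟩
  have h1 : ‖y - x‖ ≤ 2 * C := by linarith [norm_sub_le y x, hC x hx, hC y hy]
  exact NNReal.coe_le_coe.1 (h1.trans (Real.le_coe_toNNReal _))

lemma coord_add_smul_sub (i : Fin (d + 1)) (p x : Space d) (t : ℝ) :
    b.coord i (x + t • (p - x)) = b.coord i x + t * (b.coord i p - b.coord i x) := by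
  have : x + t • (p - x) = AffineMap.lineMap x p t := by
    rw [AffineMap.lineMap_apply, vsub_eq_sub, vadd_eq_add, add_comm]
  rw [this, AffineMap.apply_lineMap, AffineMap.lineMap_apply, vsub_eq_sub, vadd_eq_add,
    smul_eq_mul, add_comm]

lemma hasFDerivAt_coord (i : Fin (d + 1)) (x : Space d) :
    HasFDerivAt (b.coord i) (LinearMap.toContinuousLinearMap (b.coord i).linear) x := by
  have : (b.coord i : Space d → ℝ) =
      fun x => LinearMap.toContinuousLinearMap (b.coord i).linear x + b.coord i 0 := by
    ext x
    conv_lhs => rw [AffineMap.decomp (b.coord i)]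
    simp
  rw [this]
  exact (ContinuousLinearMap.hasFDerivAt _).add_const _

/-- The derivative is continuous, hence bounded on `[0, 1]`, and it vanishes elsewhere because the
function is locally constant there. -/
lemma exists_deriv_smoothTransition_bound :
    ∃ C : ℝ≥0, ∀ s, |deriv Real.smoothTransition s| ≤ C := by
  have hc : Continuous (deriv Real.smoothTransition) :=
    (Real.smoothTransition.contDiff (n := 1)).continuous_deriv (by norm_num)
  obtain ⟨C, hC⟩ := isCompact_Icc.exists_bound_of_continuousOn (s := Set.Icc (0 : ℝ) 1)
    hc.continuousOn
  have hC0 : 0 ≤ C := (norm_nonneg _).trans (hC 0 (by simp))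
  refine ⟨⟨C, hC0⟩, fun s => ?_⟩
  change |deriv Real.smoothTransition s| ≤ C
  by_cases h : s ∈ Set.Icc (0 : ℝ) 1
  · exact hC s h
  · suffices h' : deriv Real.smoothTransition s = 0 by simpa [h'] using hC0
    rw [Set.mem_Icc, not_and_or, not_le, not_le] at h
    rcases h with h | h
    · have : Real.smoothTransition =ᶠ[nhds s] fun _ => 0 := by
        filter_upwards [Iio_mem_nhds h] with y hy
        exact Real.smoothTransition.zero_of_nonpos (le_of_lt hy)
      rw [this.deriv_eq, deriv_const]
    · have : Real.smoothTransition =ᶠ[nhds s] fun _ => 1 := by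
        filter_upwards [Ioi_mem_nhds h] with y hy
        exact Real.smoothTransition.one_of_one_le (le_of_lt hy)
      rw [this.deriv_eq, deriv_const]

lemma deriv_smoothTransition_eq_zero {s : ℝ} (h : 1 < s) : deriv Real.smoothTransition s = 0 := by
  have : Real.smoothTransition =ᶠ[nhds s] fun _ => 1 := by
    filter_upwards [Ioi_mem_nhds h] with y hy
    exact Real.smoothTransition.one_of_one_le (le_of_lt hy)
  rw [this.deriv_eq, deriv_const]

/-- A cutoff function that vanishes outside the open simplex and is `1` away from its faces. -/
def simplexCutoff (δ : ℝ) (x : Space d) : ℝ := ∏ i, Real.smoothTransition (b.coord i x / δ)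

lemma simplexCutoff_nonneg (δ : ℝ) (x : Space d) : 0 ≤ simplexCutoff b δ x :=
  Finset.prod_nonneg fun _ _ => Real.smoothTransition.nonneg _

lemma simplexCutoff_le_one (δ : ℝ) (x : Space d) : simplexCutoff b δ x ≤ 1 :=
  Finset.prod_le_one (fun _ _ => Real.smoothTransition.nonneg _)
    fun _ _ => Real.smoothTransition.le_one _

lemma simplexCutoff_eq_zero {δ : ℝ} (hδ : 0 < δ) {x : Space d} (hx : x ∉ openSimplex b) :
    simplexCutoff b δ x = 0 := by
  rw [mem_openSimplex] at hx
  push Not at hx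
  obtain ⟨i, hi⟩ := hx
  exact Finset.prod_eq_zero (Finset.mem_univ i)
    (Real.smoothTransition.zero_of_nonpos (div_nonpos_of_nonpos_of_nonneg hi hδ.le))

lemma contDiff_simplexCutoff (δ : ℝ) : ContDiff ℝ 1 (simplexCutoff b δ) := by
  refine contDiff_prod fun i _ => ?_
  have h : ContDiff ℝ 1 Real.smoothTransition := Real.smoothTransition.contDiff (n := 1)
  exact h.comp (((smooth_barycentric_coord b i).of_le le_top).div_const δ)

/-- In the product rule the factors left undifferentiated lie in `[0, 1]`. The differentiated one
contributes a multiple of `δ⁻¹`, and only in its layer, since the transition is already constant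
beyond it. What matters is that `K` does not depend on `δ`. -/
lemma exists_fderiv_simplexCutoff_bound : ∃ K : ℝ≥0, ∀ δ > 0, ∀ x,
    ‖fderiv ℝ (simplexCutoff b δ) x‖ ≤ ∑ i, if b.coord i x ≤ δ then K * δ⁻¹ else 0 := by
  classical
  obtain ⟨C, hC⟩ := exists_deriv_smoothTransition_bound
  set A : Fin (d + 1) → Space d →L[ℝ] ℝ := fun i => LinearMap.toContinuousLinearMap (b.coord i).linear
  refine ⟨C * ∑ i, ‖A i‖₊, fun δ hδ x => ?_⟩
  have h1 : ∀ i, HasFDerivAt (fun x => Real.smoothTransition (b.coord i x / δ))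
      ((deriv Real.smoothTransition (b.coord i x / δ)) • (δ⁻¹ • A i)) x := by
    intro i
    have h2 : HasFDerivAt (fun x => b.coord i x / δ) (δ⁻¹ • A i) x := by
      simp_rw [div_eq_inv_mul]
      exact (hasFDerivAt_coord b i x).const_mul δ⁻¹
    have h3 : HasDerivAt Real.smoothTransition (deriv Real.smoothTransition (b.coord i x / δ))
        (b.coord i x / δ) :=
      (((Real.smoothTransition.contDiff (n := 1)).differentiable (by norm_num)) _).hasDerivAt
    exact h3.comp_hasFDerivAt x h2
  have h2 : HasFDerivAt (simplexCutoff b δ) _ x := HasFDerivAt.finsetProd fun i _ => h1 i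
  rw [h2.fderiv]
  refine (norm_sum_le _ _).trans (Finset.sum_le_sum fun i _ => ?_)
  have h3 : ‖∏ j ∈ Finset.univ.erase i, Real.smoothTransition (b.coord j x / δ)‖ ≤ 1 := by
    rw [Real.norm_of_nonneg (Finset.prod_nonneg fun _ _ => Real.smoothTransition.nonneg _)]
    exact Finset.prod_le_one (fun _ _ => Real.smoothTransition.nonneg _)
      fun _ _ => Real.smoothTransition.le_one _
  have h4 : ‖A i‖ ≤ ∑ i, ‖A i‖ :=
    Finset.single_le_sum (f := fun i => ‖A i‖) (fun _ _ => norm_nonneg _) (Finset.mem_univ i)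
  split_ifs with h
  · rw [norm_smul, norm_smul, norm_smul]
    push_cast
    calc _ ≤ 1 * (C * (δ⁻¹ * ∑ i, ‖A i‖)) := by
          gcongr
          · exact hC _
          · rw [Real.norm_of_nonneg (by positivity)]
      _ = _ := by ring
  · rw [deriv_smoothTransition_eq_zero ((one_lt_div hδ).2 (not_le.1 h))]
    simp

/-- The barycentric coordinate of a vertex is affine and equals `1` there, and moving towards that
vertex stays in the open simplex. Hence the general layer estimate applies at each face. -/
lemma lintegral_coord_layer_le {D : ℝ≥0} (hD : ∀ x ∈ convexHull ℝ (Set.range b),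
    ∀ y ∈ convexHull ℝ (Set.range b), ‖y - x‖₊ ≤ D) (i : Fin (d + 1)) (δ : ℝ) {G : Space d → ℝ}
    (hG : ContDiff ℝ 1 G) :
    ∫⁻ x in openSimplex b ∩ {x | b.coord i x ≤ δ}, ‖G x‖ₑ ≤
      2 ^ d * ENNReal.ofReal δ *
        ∫⁻ x in openSimplex b, (2 * ‖G x‖ₑ + D * ‖fderiv ℝ G x‖ₑ) := by
  refine lintegral_layer_le (isOpen_openSimplex b).measurableSet
    (continuous_barycentric_coord b i).measurable (p := b i)
    (fun x t => ?_) (fun x hx => (mem_openSimplex b).1 hx i) (fun x hx t ht => ?_)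
    (fun x hx => hD x (openSimplex_subset b hx) _ (subset_convexHull ℝ _ (Set.mem_range_self i))) hG
  · rw [coord_add_smul_sub, b.coord_apply_eq]
  · rw [mem_openSimplex] at hx ⊢
    intro j
    rw [coord_add_smul_sub]
    have h1 : 0 ≤ b.coord j (b i) := by
      classical
      rw [b.coord_apply]
      split_ifs <;> simp
    nlinarith [hx j, ht.1, ht.2, mul_nonneg ht.1.le h1, mul_pos ht.1 (hx j)]

/-- The Gagliardo–Nirenberg–Sobolev inequality with exponent `1` on a simplex. -/
theorem exists_eLpNorm_le_lintegral_add {P : ℝ≥0} (hP : NNReal.HolderConjugate d P) :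
    ∃ C : ℝ≥0, ∀ G : Space d → ℝ, ContDiff ℝ 1 G →
      eLpNorm G P (volume.restrict (openSimplex b)) ≤
        C * ∫⁻ x in openSimplex b, (‖G x‖ₑ + ‖fderiv ℝ G x‖ₑ) := by
  classical
  set U := openSimplex b with hU
  have hUm : MeasurableSet U := (isOpen_openSimplex b).measurableSet
  obtain ⟨D, hD⟩ := exists_diam_bound b
  obtain ⟨K, hK⟩ := exists_fderiv_simplexCutoff_bound b
  set C₁ : ℝ≥0 := eLpNormLESNormFDerivOneConst (volume : Measure (Space d)) P
  -- There are `d + 1` layers. In each, the gradient `K * δ⁻¹` of the cutoff meets an integral of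
  -- size `2 ^ d * δ * (2 + D) * I`, and `δ` cancels. The summand `1` comes from the gradient of
  -- `G`.
  refine ⟨C₁ * (1 + (d + 1 : ℕ) * (K * (2 ^ d * (2 + D)))), fun G hG => ?_⟩
  have hGd := hG.continuous_fderiv one_ne_zero
  set I := ∫⁻ x in U, (‖G x‖ₑ + ‖fderiv ℝ G x‖ₑ) with hI
  have hbound : ∀ δ > 0, eLpNorm (fun x => G x * simplexCutoff b δ x) P (volume.restrict U) ≤
      (C₁ * (1 + (d + 1 : ℕ) * (K * (2 ^ d * (2 + D)))) : ℝ≥0) * I := by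
    intro δ hδ
    set u : Space d → ℝ := fun x => G x * simplexCutoff b δ x with hu
    have hcd : ContDiff ℝ 1 u := hG.mul (contDiff_simplexCutoff b δ)
    have hcs : HasCompactSupport u := by
      refine HasCompactSupport.intro (isCompact_convexHull_basis b) fun x hx => ?_
      rw [hu]
      simp [simplexCutoff_eq_zero b hδ fun h => hx (openSimplex_subset b h)]
    have hgns := eLpNorm_le_eLpNorm_fderiv_one (μ := (volume : Measure (Space d))) hcd hcs
      (p := P) (by simpa using hP)
    have hpt : ∀ x, ‖fderiv ℝ u x‖ₑ ≤ U.indicator (fun x => ‖fderiv ℝ G x‖ₑ +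
        ∑ i, {x | b.coord i x ≤ δ}.indicator
          (fun x => ENNReal.ofReal (K * δ⁻¹) * ‖G x‖ₑ) x) x := by
      intro x
      have hη : DifferentiableAt ℝ (simplexCutoff b δ) x :=
        (contDiff_simplexCutoff b δ).differentiable one_ne_zero x
      rw [hu, fderiv_fun_mul (hG.differentiable one_ne_zero x) hη]
      by_cases hx : x ∈ U
      · rw [Set.indicator_of_mem hx, add_comm]
        refine (enorm_add_le (simplexCutoff b δ x • fderiv ℝ G x)
          (G x • fderiv ℝ (simplexCutoff b δ) x)).trans (add_le_add ?_ ?_)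
        · rw [enorm_smul]
          have : ‖simplexCutoff b δ x‖ₑ ≤ 1 := by
            rw [Real.enorm_eq_ofReal (simplexCutoff_nonneg b δ x)]
            exact ENNReal.ofReal_le_one.2 (simplexCutoff_le_one b δ x)
          calc _ ≤ 1 * ‖fderiv ℝ G x‖ₑ := by gcongr
            _ = _ := one_mul _
        · rw [enorm_smul]
          have h1 : ‖fderiv ℝ (simplexCutoff b δ) x‖ₑ ≤
              ∑ i, if b.coord i x ≤ δ then ENNReal.ofReal (K * δ⁻¹) else 0 := by
            rw [← ofReal_norm]
            refine (ENNReal.ofReal_le_ofReal (hK δ hδ x)).trans ?_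
            rw [ENNReal.ofReal_sum_of_nonneg (fun i _ => by split_ifs <;> positivity)]
            refine Finset.sum_le_sum fun i _ => ?_
            split_ifs <;> simp
          calc _ ≤ ‖G x‖ₑ * ∑ i, if b.coord i x ≤ δ then ENNReal.ofReal (K * δ⁻¹) else 0 := by
                gcongr
            _ = _ := by
                rw [Finset.mul_sum]
                refine Finset.sum_congr rfl fun i _ => ?_
                simp only [Set.indicator_apply, Set.mem_ofPred_eq]
                split_ifs
                · ring
                · simp
      · rw [Set.indicator_of_notMem hx]
        have h0 := simplexCutoff_eq_zero b hδ hx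
        -- Off the open simplex, including on its boundary, the nonnegative cutoff attains its
        -- minimum `0`, so its derivative vanishes as well.
        have hmin : IsLocalMin (simplexCutoff b δ) x :=
          Filter.Eventually.of_forall fun y => by rw [h0]; exact simplexCutoff_nonneg b δ y
        rw [h0, hmin.fderiv_eq_zero, smul_zero, zero_smul, add_zero, ← ofReal_norm, norm_zero,
          ENNReal.ofReal_zero]
    have hlay : ∀ i : Fin (d + 1), MeasurableSet {x : Space d | b.coord i x ≤ δ} := fun i =>
      measurableSet_le (continuous_barycentric_coord b i).measurable measurable_const
    have hGm : Measurable fun x => ENNReal.ofReal (K * δ⁻¹) * ‖G x‖ₑ :=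
      hG.continuous.enorm.measurable.const_mul _
    have hI2 : ∫⁻ x in U, (2 * ‖G x‖ₑ + D * ‖fderiv ℝ G x‖ₑ) ≤ (2 + D) * I := by
      have hm : Measurable fun x => ‖G x‖ₑ + ‖fderiv ℝ G x‖ₑ :=
        hG.continuous.enorm.measurable.add hGd.enorm.measurable
      rw [hI, ← lintegral_const_mul _ hm]
      refine lintegral_mono fun x => ?_
      rw [mul_add]
      gcongr
      · exact le_self_add
      · exact le_add_self
    calc eLpNorm u P (volume.restrict U) ≤ eLpNorm u P volume :=
          eLpNorm_mono_measure _ Measure.restrict_le_self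
      _ ≤ C₁ * ∫⁻ x, ‖fderiv ℝ u x‖ₑ := by rwa [eLpNorm_one_eq_lintegral_enorm] at hgns
      _ ≤ C₁ * ∫⁻ x in U, (‖fderiv ℝ G x‖ₑ + ∑ i, {x | b.coord i x ≤ δ}.indicator
          (fun x => ENNReal.ofReal (K * δ⁻¹) * ‖G x‖ₑ) x) := by
          rw [← lintegral_indicator hUm]
          gcongr with x
          exact hpt x
      _ = C₁ * ((∫⁻ x in U, ‖fderiv ℝ G x‖ₑ) + ∑ i, ENNReal.ofReal (K * δ⁻¹) *
          ∫⁻ x in U ∩ {x | b.coord i x ≤ δ}, ‖G x‖ₑ) := by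
          rw [lintegral_add_left hGd.enorm.measurable,
            lintegral_finsetSum _ fun i _ => hGm.indicator (hlay i)]
          congr 2
          refine Finset.sum_congr rfl fun i _ => ?_
          rw [setLIntegral_indicator (hlay i), Set.inter_comm,
            lintegral_const_mul _ hG.continuous.enorm.measurable]
      _ ≤ C₁ * (I + ∑ _i : Fin (d + 1), K * (2 ^ d * (2 + D)) * I) := by
          refine mul_le_mul_right (add_le_add (lintegral_mono fun x => le_add_self)
            (Finset.sum_le_sum fun i _ => ?_)) _
          calc _ ≤ ENNReal.ofReal (K * δ⁻¹) * (2 ^ d * ENNReal.ofReal δ * ((2 + D) * I)) := by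
                  gcongr 1
                  exact (lintegral_coord_layer_le b hD i δ hG).trans (mul_le_mul_right hI2 _)
              _ = (ENNReal.ofReal (K * δ⁻¹) * ENNReal.ofReal δ) * (2 ^ d * (2 + D)) * I := by ring
              _ = _ := by
                  rw [← ENNReal.ofReal_mul (by positivity), mul_assoc (K : ℝ),
                    inv_mul_cancel₀ hδ.ne', mul_one, ENNReal.ofReal_coe_nnreal]
      _ = _ := by
          rw [Finset.sum_const, Finset.card_univ, Fintype.card_fin, nsmul_eq_mul]
          push_cast
          ring
  -- Along `δ = 1 / (n + 1)` the cutoff is eventually equal to `1` at each point of the open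
  -- simplex. Fatou then carries the uniform bound over to `G`.
  have hlim : ∀ x ∈ U, Filter.Tendsto (fun n : ℕ => G x * simplexCutoff b (1 / ((n : ℝ) + 1)) x)
      Filter.atTop (nhds (G x)) := by
    intro x hx
    refine tendsto_const_nhds.congr' ?_
    have h1 : ∀ i, ∀ᶠ n : ℕ in Filter.atTop, 1 / ((n : ℝ) + 1) < b.coord i x := fun i =>
      tendsto_one_div_add_atTop_nhds_zero_nat.eventually
        (Iio_mem_nhds ((mem_openSimplex b).1 hx i))
    filter_upwards [Filter.eventually_all.2 h1] with n hn
    have : simplexCutoff b (1 / ((n : ℝ) + 1)) x = 1 := by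
      refine Finset.prod_eq_one fun i _ => Real.smoothTransition.one_of_one_le ?_
      rw [le_div_iff₀ (by positivity), one_mul]
      exact (hn i).le
    rw [this, mul_one]
  refine (Lp.eLpNorm_lim_le_liminf_eLpNorm (fun n => ?_) G
    ((ae_restrict_iff' hUm).2 (Filter.Eventually.of_forall hlim))).trans ?_
  · exact (hG.continuous.mul (contDiff_simplexCutoff b _).continuous).aestronglyMeasurable
  · refine Filter.liminf_le_of_le (by isBoundedDefault) fun c hc => ?_
    obtain ⟨n, hn⟩ := hc.exists
    exact hn.trans (hbound _ (by positivity))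

end Simplex

/-! ### Sobolev and Poincaré inequalities for $C^1$ functions with general exponents -/

section SobolevPoincare

lemma eLpNorm_ofReal {α E : Type*} [MeasurableSpace α] [NormedAddCommGroup E] {μ : Measure α}
    (f : α → E) {r : ℝ} (hr : 0 < r) :
    eLpNorm f (ENNReal.ofReal r) μ = (∫⁻ x, ‖f x‖ₑ ^ r ∂μ) ^ (1 / r) := by
  rw [eLpNorm_eq_lintegral_rpow_enorm_toReal (by simpa using hr) ENNReal.ofReal_ne_top,
    ENNReal.toReal_ofReal hr.le]

variable {d : ℕ} (b : AffineBasis (Fin (d + 1)) ℝ (Space d))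

/-- Continuity on the compact closed simplex gives a bound. The finiteness is needed to cancel a
power of this integral in the Sobolev inequality. -/
lemma lintegral_rpow_enorm_lt_top {G : Space d → ℝ} (hG : Continuous G) {r : ℝ} (hr : 0 ≤ r) :
    ∫⁻ x in openSimplex b, ‖G x‖ₑ ^ r < ⊤ := by
  obtain ⟨C, hC⟩ := (isCompact_convexHull_basis b).exists_bound_of_continuousOn hG.continuousOn
  calc ∫⁻ x in openSimplex b, ‖G x‖ₑ ^ r
      ≤ ∫⁻ _ in openSimplex b, ENNReal.ofReal C ^ r := by
        refine setLIntegral_mono' (isOpen_openSimplex b).measurableSet fun x hx => ?_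
        refine ENNReal.rpow_le_rpow ?_ hr
        rw [← ofReal_norm]
        exact ENNReal.ofReal_le_ofReal (hC x (openSimplex_subset b hx))
    _ < ⊤ := by
        rw [setLIntegral_const]
        exact ENNReal.mul_lt_top (ENNReal.rpow_lt_top_of_nonneg hr ENNReal.ofReal_ne_top)
          (volume_openSimplex_lt_top b)

/-- The Sobolev inequality on a simplex, for `C¹` functions. -/
theorem exists_eLpNorm_le_eLpNorm_add {P : ℝ≥0} (hP : NNReal.HolderConjugate d P) {γ p : ℝ}
    (hγ : 1 ≤ γ) (hp : 1 / p = 1 / (γ * P) + 1 / d) :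
    ∃ C : ℝ≥0, ∀ G : Space d → ℝ, ContDiff ℝ 1 G →
      eLpNorm G (ENNReal.ofReal (γ * P)) (volume.restrict (openSimplex b)) ≤
        C * (eLpNorm G (ENNReal.ofReal p) (volume.restrict (openSimplex b)) +
          eLpNorm (fderiv ℝ G) (ENNReal.ofReal p) (volume.restrict (openSimplex b))) := by
  set μ := volume.restrict (openSimplex b)
  obtain ⟨C, hC⟩ := exists_eLpNorm_le_lintegral_add b hP
  have hP0 : (0 : ℝ) < P := hP.coe.symm.pos
  have hdP : 1 / (d : ℝ) + 1 / P = 1 := by simpa using hP.coe.inv_add_inv_eq_one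
  rcases hγ.eq_or_lt with rfl | hγ
  · have hp1 : p = 1 := by
      rw [one_mul, add_comm, hdP] at hp
      simpa using hp
    refine ⟨C, fun G hG => ?_⟩
    have := hC G hG
    rw [lintegral_add_left hG.continuous.enorm.measurable] at this
    rw [one_mul, hp1, ENNReal.ofReal_one, ENNReal.ofReal_coe_nnreal, eLpNorm_one_eq_lintegral_enorm,
      eLpNorm_one_eq_lintegral_enorm]
    exact this
  · have hγ0 : 0 < γ := by linarith
    have hd0 : 0 < 1 / (d : ℝ) := by simpa using hP.coe.pos
    have hq0 : 0 < 1 / (γ * P) := by positivity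
    have hp0 : 0 < p := by
      have : 0 < 1 / p := by rw [hp]; positivity
      simpa using this
    have hq1 : 1 / (γ * P) < 1 / (P : ℝ) := by
      apply one_div_lt_one_div_of_lt hP0
      nlinarith
    have hp1 : 1 < p := by
      have : 1 / p < 1 := by rw [hp]; linarith
      rwa [div_lt_one hp0] at this
    set p' := Real.conjExponent p with hp'
    have hconj : p.HolderConjugate p' := Real.HolderConjugate.conjExponent hp1
    have hp'0 : 0 < p' := hconj.symm.pos
    have hpp' : 1 / p + 1 / p' = 1 := by simpa using hconj.inv_add_inv_eq_one
    -- This relation makes Hölder's inequality reproduce the very integral `A` that is being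
    -- estimated.
    have hexp : (γ - 1) * p' = γ * P := by
      have h1 : 1 / p' = 1 / P - 1 / (γ * P) := by linarith
      have h2 : 1 / (P : ℝ) - 1 / (γ * P) = (γ - 1) / (γ * P) := by
        field_simp
      rw [h2, one_div, inv_eq_iff_eq_inv, inv_div] at h1
      rw [h1]
      field_simp [(by linarith : γ - 1 ≠ 0)]
    refine ⟨C * γ.toNNReal, fun G hG => ?_⟩
    set A := ∫⁻ x, ‖G x‖ₑ ^ (γ * P) ∂μ with hA
    have hAtop : A ≠ ⊤ := (lintegral_rpow_enorm_lt_top b hG.continuous (by positivity)).ne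
    have hGd := hG.continuous_fderiv one_ne_zero
    set R := eLpNorm G (ENNReal.ofReal p) μ + eLpNorm (fderiv ℝ G) (ENNReal.ofReal p) μ with hR
    -- The inequality with exponent `1` is applied to the power `|G|^γ`, which is again $C^1$
    -- because `γ > 1`.
    set w : Space d → ℝ := fun x => ‖G x‖ ^ γ with hw
    have hwe : ∀ x, ‖w x‖ₑ = ‖G x‖ₑ ^ γ := fun x => by
      rw [hw, Real.enorm_rpow_of_nonneg (norm_nonneg _) hγ0.le, enorm_norm]
    have h1 := hC w (hG.norm_rpow hγ)
    have h2 : eLpNorm w P μ = A ^ (1 / (P : ℝ)) := by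
      rw [← ENNReal.ofReal_coe_nnreal, eLpNorm_ofReal _ hP0]
      congr 1
      refine lintegral_congr fun x => ?_
      rw [hwe, ← ENNReal.rpow_mul]
    have hγe : (1 : ℝ≥0∞) ≤ γ.toNNReal := by
      rw [ENNReal.one_le_coe_iff]
      exact Real.one_le_toNNReal.2 hγ.le
    have hmG : Measurable fun x => ‖G x‖ₑ := hG.continuous.enorm.measurable
    have hmD : Measurable fun x => ‖fderiv ℝ G x‖ₑ := hGd.enorm.measurable
    have h3 : ∫⁻ x, (‖w x‖ₑ + ‖fderiv ℝ w x‖ₑ) ∂μ ≤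
        γ.toNNReal * ∫⁻ x, ‖G x‖ₑ ^ (γ - 1) * (‖G x‖ₑ + ‖fderiv ℝ G x‖ₑ) ∂μ := by
      rw [← lintegral_const_mul _ (by fun_prop)]
      refine lintegral_mono fun x => ?_
      rw [mul_add, mul_add]
      refine add_le_add ?_ ?_
      · rw [hwe]
        calc ‖G x‖ₑ ^ γ = ‖G x‖ₑ ^ (γ - 1) * ‖G x‖ₑ := by
              conv_rhs => rw [← ENNReal.rpow_one ‖G x‖ₑ, ← ENNReal.rpow_mul,
                ← ENNReal.rpow_add_of_nonneg _ _ (by linarith) (by norm_num)]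
              congr 1
              ring
          _ ≤ _ := le_mul_of_one_le_left' hγe
      · have hγc : (γ.toNNReal : ℝ) = γ := Real.coe_toNNReal γ hγ0.le
        have := enorm_fderiv_norm_rpow_le (p := γ.toNNReal) (hG.differentiable one_ne_zero)
          (x := x) (by rw [← NNReal.coe_lt_coe, hγc]; exact hγ)
        rw [hγc] at this
        exact this.trans_eq (mul_assoc _ _ _)
    have h4 : ∫⁻ x, ‖G x‖ₑ ^ (γ - 1) * (‖G x‖ₑ + ‖fderiv ℝ G x‖ₑ) ∂μ ≤ A ^ (1 / p') * R := by
      refine (ENNReal.lintegral_mul_le_Lp_mul_Lq μ hconj.symm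
        (hmG.pow_const _).aemeasurable (hmG.add hmD).aemeasurable).trans ?_
      refine mul_le_mul' (le_of_eq ?_) ?_
      · congr 1
        refine lintegral_congr fun x => ?_
        rw [← ENNReal.rpow_mul, hexp]
      · rw [hR, eLpNorm_ofReal _ hp0, eLpNorm_ofReal _ hp0]
        exact ENNReal.lintegral_Lp_add_le hmG.aemeasurable hmD.aemeasurable hp1.le
    have h5 : A ^ (1 / (P : ℝ)) ≤ (C * γ.toNNReal : ℝ≥0) * R * A ^ (1 / p') := by
      rw [← h2]
      calc _ ≤ C * (γ.toNNReal * (A ^ (1 / p') * R)) := by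
            refine h1.trans ?_
            gcongr
            exact h3.trans (by gcongr)
        _ = _ := by push_cast; ring
    rw [eLpNorm_ofReal _ (by positivity), ← hA]
    -- Since `1 / P = 1 / (γ * P) + 1 / p'`, the factor `A ^ (1 / p')` can be cancelled once `A` is
    -- known to be neither `0` nor `⊤`.
    rcases eq_or_ne A 0 with hA0 | hA0
    · rw [hA0, ENNReal.zero_rpow_of_pos (by positivity)]
      exact zero_le
    · have h6 : A ^ (1 / (P : ℝ)) = A ^ (1 / (γ * P)) * A ^ (1 / p') := by
        rw [← ENNReal.rpow_add _ _ hA0 hAtop]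
        congr 1
        linarith
      rw [h6] at h5
      refine (ENNReal.mul_le_mul_iff_left ?_ ?_).1 h5
      · exact (ENNReal.rpow_pos (pos_iff_ne_zero.2 hA0) hAtop).ne'
      · exact ENNReal.rpow_ne_top_of_nonneg (by positivity) hAtop

/-- Hölder's inequality on a set of finite measure. -/
lemma eLpNorm_le_mul_eLpNorm {E : Type*} [NormedAddCommGroup E] {p q : ℝ} (hp : 0 < p)
    (hpq : p ≤ q) : ∃ C : ℝ≥0, ∀ f : Space d → E,
      AEStronglyMeasurable f (volume.restrict (openSimplex b)) →
      eLpNorm f (ENNReal.ofReal p) (volume.restrict (openSimplex b)) ≤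
        C * eLpNorm f (ENNReal.ofReal q) (volume.restrict (openSimplex b)) := by
  set μ := volume.restrict (openSimplex b)
  have hμ : μ Set.univ ≠ ⊤ := by simpa [μ] using (volume_openSimplex_lt_top b).ne
  refine ⟨(μ Set.univ ^ (1 / p - 1 / q)).toNNReal, fun f hf => ?_⟩
  have := eLpNorm_le_eLpNorm_mul_rpow_measure_univ (ENNReal.ofReal_le_ofReal hpq) hf
  rw [ENNReal.toReal_ofReal hp.le, ENNReal.toReal_ofReal (hp.le.trans hpq)] at this
  rw [ENNReal.coe_toNNReal, mul_comm]
  · exact this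
  · exact ENNReal.rpow_ne_top_of_nonneg
      (sub_nonneg.2 (one_div_le_one_div_of_le hp hpq)) hμ

/-- The Poincaré inequality on a simplex, for `C¹` functions. -/
lemma exists_eLpNorm_sub_le {p : ℝ} (hp : 1 ≤ p) : ∃ C : ℝ≥0, ∀ G : Space d → ℝ, ContDiff ℝ 1 G →
    ∃ m : ℝ, eLpNorm (fun x => G x - m) (ENNReal.ofReal p) (volume.restrict (openSimplex b)) ≤
      C * eLpNorm (fderiv ℝ G) (ENNReal.ofReal p) (volume.restrict (openSimplex b)) := by
  set U := openSimplex b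
  have hp0 : 0 < p := by linarith
  obtain ⟨D, hD⟩ := exists_diam_bound b
  refine ⟨((2 ^ d * (D : ℝ≥0∞) ^ p) ^ (1 / p)).toNNReal, fun G hG => ?_⟩
  have hfin : (2 ^ d * (D : ℝ≥0∞) ^ p) ^ (1 / p) ≠ ⊤ :=
    ENNReal.rpow_ne_top_of_nonneg (by positivity) (ENNReal.mul_ne_top (by simp)
      (ENNReal.rpow_ne_top_of_nonneg hp0.le ENNReal.coe_ne_top))
  have h := lintegral_lintegral_sub_rpow_le (convex_openSimplex b)
    (isOpen_openSimplex b).measurableSet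
    (fun x hx y hy => hD x (openSimplex_subset b hx) y (openSimplex_subset b hy)) hp hG
  have hV0 := volume_openSimplex_ne_zero b
  have hVt := (volume_openSimplex_lt_top b).ne
  have hmeas : Measurable fun z : Space d × Space d => ‖G z.1 - G z.2‖ₑ ^ p :=
    (((hG.continuous.comp continuous_fst).sub
      (hG.continuous.comp continuous_snd)).enorm.measurable).pow_const p
  have hmeas' : Measurable fun y => ∫⁻ x in U, ‖G y - G x‖ₑ ^ p := hmeas.lintegral_prod_right'
  -- Some `y` does at least as well as the average over `y` in the double integral, and the constant
  -- is taken to be the value of `G` there.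
  obtain ⟨y, _, hy⟩ := exists_le_setLAverage hV0 hVt hmeas'.aemeasurable
  refine ⟨G y, ?_⟩
  rw [eLpNorm_ofReal _ hp0, eLpNorm_ofReal _ hp0, ENNReal.coe_toNNReal hfin,
    ← ENNReal.mul_rpow_of_nonneg _ _ (by positivity)]
  refine ENNReal.rpow_le_rpow ?_ (by positivity)
  calc ∫⁻ x in U, ‖G x - G y‖ₑ ^ p = ∫⁻ x in U, ‖G y - G x‖ₑ ^ p :=
        lintegral_congr fun x => by rw [enorm_sub_rev]
    _ ≤ _ := hy
    _ ≤ (2 ^ d * D ^ p * volume U * ∫⁻ x in U, ‖fderiv ℝ G x‖ₑ ^ p) / volume U := by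
        rw [setLAverage_eq]
        exact ENNReal.div_le_div_right h _
    _ = _ := by
        rw [mul_right_comm, ENNReal.mul_div_cancel_right hV0 hVt]

/-- The Sobolev–Poincaré inequality on a simplex, for `C¹` functions. -/
theorem exists_eLpNorm_sub_le_eLpNorm_fderiv (hd : 2 ≤ d) {p q : ℝ} (hp : 1 ≤ p) (hq : 1 ≤ q)
    (hpq : 1 - (d : ℝ) / p ≥ -((d : ℝ) / q)) :
    ∃ C : ℝ≥0, ∀ G : Space d → ℝ, ContDiff ℝ 1 G →
      ∃ m : ℝ, eLpNorm (fun x => G x - m) (ENNReal.ofReal q) (volume.restrict (openSimplex b)) ≤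
        C * eLpNorm (fderiv ℝ G) (ENNReal.ofReal p) (volume.restrict (openSimplex b)) := by
  set μ := volume.restrict (openSimplex b)
  have hd1 : (1 : ℝ≥0) < d := by exact_mod_cast hd
  have hP := NNReal.HolderConjugate.conjExponent hd1
  set P := NNReal.conjExponent (d : ℝ≥0)
  have hP0 : (0 : ℝ) < P := hP.coe.symm.pos
  have hd0 : (0 : ℝ) < d := by exact_mod_cast (by omega : 0 < d)
  have hdP : 1 / (d : ℝ) + 1 / P = 1 := by simpa using hP.coe.inv_add_inv_eq_one
  have hcond : 1 / p ≤ 1 / q + 1 / d := by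
    have h1 : (d : ℝ) * (1 / p) ≤ d * (1 / q + 1 / d) := by
      have : (d : ℝ) * (1 / q + 1 / d) = d / q + 1 := by field_simp
      rw [this, mul_one_div]
      linarith
    exact le_of_mul_le_mul_left h1 hd0
  -- The target exponent is raised to `γ * P = max q P`, which the Sobolev inequality can reach, and
  -- `p₀` is the matching gradient exponent. The hypothesis on `p, q` gives `p₀ ≤ p` when `q ≥ P`;
  -- otherwise `p₀ = 1`. Both changes of exponent are Hölder on a bounded set.
  set γ : ℝ := max (q / P) 1 with hγ
  have hγP : γ * P = max q P := by
    rw [hγ, max_mul_of_nonneg _ _ hP0.le, div_mul_cancel₀ _ hP0.ne', one_mul]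
  set p₀ : ℝ := 1 / (1 / (γ * P) + 1 / d) with hp₀
  have hγP0 : 0 < γ * P := by rw [hγP]; exact lt_max_of_lt_right hP0
  have hpos : 0 < 1 / (γ * P) + 1 / (d : ℝ) := by positivity
  have hp₀1 : 1 ≤ p₀ := by
    have h1 : (P : ℝ) ≤ γ * P := by rw [hγP]; exact le_max_right _ _
    have h2 := one_div_le_one_div_of_le hP0 h1
    rw [hp₀, le_div_iff₀ hpos, one_mul]
    linarith
  have hp₀p : p₀ ≤ p := by
    rw [hp₀, div_le_iff₀ hpos, ← div_le_iff₀' (by linarith), hγP]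
    rcases le_total q P with h | h
    · rw [max_eq_right h, add_comm, hdP, div_le_one (by linarith)]
      exact hp
    · rwa [max_eq_left h]
  obtain ⟨C₁, hC₁⟩ := exists_eLpNorm_le_eLpNorm_add b hP (le_max_right (q / P) 1)
    (p := p₀) (by rw [hp₀, one_div_one_div])
  obtain ⟨C₂, hC₂⟩ := exists_eLpNorm_sub_le b hp₀1
  obtain ⟨C₃, hC₃⟩ := eLpNorm_le_mul_eLpNorm (E := ℝ) b (p := q) (q := γ * P) (by linarith)
    (by rw [hγP]; exact le_max_left _ _)
  obtain ⟨C₄, hC₄⟩ := eLpNorm_le_mul_eLpNorm (E := Space d →L[ℝ] ℝ) b (p := p₀) (q := p)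
    (by linarith) hp₀p
  refine ⟨C₃ * (C₁ * ((C₂ + 1) * C₄)), fun G hG => ?_⟩
  obtain ⟨m, hm⟩ := hC₂ G hG
  refine ⟨m, ?_⟩
  have hGm : ContDiff ℝ 1 fun x => G x - m := hG.sub contDiff_const
  have hfd : fderiv ℝ (fun x => G x - m) = fderiv ℝ G := by
    ext1 x
    exact fderiv_sub_const m
  have h1 := hC₁ _ hGm
  rw [hfd] at h1
  calc _ ≤ C₃ * eLpNorm (fun x => G x - m) (ENNReal.ofReal (γ * P)) μ :=
        hC₃ _ hGm.continuous.aestronglyMeasurable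
    _ ≤ C₃ * (C₁ * (C₂ * eLpNorm (fderiv ℝ G) (ENNReal.ofReal p₀) μ +
          eLpNorm (fderiv ℝ G) (ENNReal.ofReal p₀) μ)) := by
        gcongr
        exact h1.trans (by gcongr)
    _ = C₃ * (C₁ * ((C₂ + 1) * eLpNorm (fderiv ℝ G) (ENNReal.ofReal p₀) μ)) := by ring
    _ ≤ C₃ * (C₁ * ((C₂ + 1) * (C₄ * eLpNorm (fderiv ℝ G) (ENNReal.ofReal p) μ))) := by
        gcongr
        exact hC₄ _ (hG.continuous_fderiv one_ne_zero).aestronglyMeasurable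
    _ = _ := by push_cast; ring

end SobolevPoincare

/-! ### Mollification -/

section Mollify

open Filter Topology
open scoped Convolution

variable {d : ℕ} {U : Set (Space d)}

/-- The convolution of `ψ` with the extension of `g` by zero outside `U`. -/
def mollify (U : Set (Space d)) (ψ g : Space d → ℝ) (x : Space d) : ℝ :=
  ∫ t in U, g t * ψ (x - t)

lemma mollify_eq_convolution (hU : MeasurableSet U) (ψ g : Space d → ℝ) :
    mollify U ψ g = U.indicator g ⋆[ContinuousLinearMap.lsmul ℝ ℝ, volume] ψ := by
  ext x
  rw [mollify, convolution_def, ← integral_indicator hU]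
  congr 1
  ext t
  by_cases ht : t ∈ U <;> simp [ht]

/-- The version with the kernel on the left is the one needed for almost everywhere convergence of
mollifications; smoothness and differentiation use the kernel on the right. -/
lemma mollify_eq_convolution_swap (hU : MeasurableSet U) (ψ g : Space d → ℝ) :
    mollify U ψ g = ψ ⋆[ContinuousLinearMap.lsmul ℝ ℝ, volume] U.indicator g := by
  ext x
  rw [mollify, convolution_eq_swap, ← integral_indicator hU]
  congr 1
  ext t
  by_cases ht : t ∈ U <;> simp [ht, mul_comm]

lemma contDiff_mollify (hU : MeasurableSet U) {ψ g : Space d → ℝ} (hψ : Smooth ψ)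
    (hc : HasCompactSupport ψ) (hg : IntegrableOn g U) : Smooth (mollify U ψ g) := by
  rw [mollify_eq_convolution hU]
  exact hc.contDiff_convolution_right _
    ((integrable_indicator_iff hU).2 hg).locallyIntegrable hψ

lemma partialDeriv_mollify (hU : MeasurableSet U) {ψ g : Space d → ℝ} (hψ : Smooth ψ)
    (hc : HasCompactSupport ψ) (hg : IntegrableOn g U) (i : Fin d) :
    partialDeriv i (mollify U ψ g) = mollify U (partialDeriv i ψ) g := by
  have hloc := ((integrable_indicator_iff hU).2 hg).locallyIntegrable
  ext x
  have h1 : ContDiff ℝ 1 ψ := ContDiff.of_le hψ (by norm_cast)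
  rw [partialDeriv, mollify_eq_convolution hU, mollify_eq_convolution hU,
    (hc.hasFDerivAt_convolution_right _ hloc h1 x).fderiv,
    convolution_precompR_apply _ hloc (hc.fderiv ℝ) (h1.continuous_fderiv one_ne_zero)]
  rfl

/-- Differentiation commutes with mollification in the interior. -/
lemma partialDeriv_mollify_of_weakDeriv (hU : MeasurableSet U) {ψ g g' : Space d → ℝ}
    (hψ : Smooth ψ) {r : ℝ} (hr : tsupport ψ ⊆ Metric.closedBall 0 r) (hg : IntegrableOn g U)
    {i : Fin d} (h : IsWeakDeriv U (Pi.single i 1) g g') {x : Space d}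
    (hx : Metric.closedBall x r ⊆ U) :
    partialDeriv i (mollify U ψ g) x = mollify U ψ g' x := by
  have hc : HasCompactSupport ψ :=
    (isCompact_closedBall 0 r).of_isClosed_subset (isClosed_tsupport _) hr
  rw [partialDeriv_mollify hU hψ hc hg]
  -- The reflected and translated kernel is a test function on `U`, because the closed ball around
  -- `x` lies in `U`. The sign from the reflection cancels the sign in the definition of a first
  -- weak derivative.
  set η : Space d → ℝ := ψ ∘ (Homeomorph.subLeft x) with hη
  have htest : IsTest U η := by
    refine ⟨hψ.comp (contDiff_const.sub contDiff_id), hc.comp_homeomorph _, ?_⟩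
    rw [hη, tsupport_comp_eq_preimage]
    intro t ht
    apply hx
    have := hr ht
    simpa [dist_eq_norm, norm_sub_rev] using this
  have hd : ∀ t, partialDeriv i η t = -partialDeriv i ψ (x - t) := by
    intro t
    have h1 : HasFDerivAt (fun t : Space d => x - t) (-ContinuousLinearMap.id ℝ (Space d)) t :=
      (hasFDerivAt_id t).const_sub x
    have h2 : HasFDerivAt η _ t := (hψ.differentiable (x - t)).hasFDerivAt.comp t h1
    rw [partialDeriv, h2.fderiv]
    simp [partialDeriv]
  have h1 := h.integral_eq htest
  simp only [classicalDeriv_single, hd, mul_neg, integral_neg] at h1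
  simp only [Finset.sum_pi_single', Finset.mem_univ, if_true, pow_one, neg_mul, one_mul,
    neg_inj] at h1
  exact h1

/-- Young's inequality for the convolution with a probability density. -/
lemma lintegral_convolution_rpow_le {ψ F : Space d → ℝ≥0∞} (hψ : Measurable ψ)
    (h1 : ∫⁻ x, ψ x = 1) (hF : AEMeasurable F) {p : ℝ} (hp : 1 ≤ p) :
    ∫⁻ x, (∫⁻ t, F t * ψ (x - t)) ^ p ≤ ∫⁻ t, F t ^ p := by
  wlog hFm : Measurable F generalizing F
  · have := this hF.measurable_mk.aemeasurable hF.measurable_mk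
    have e1 : ∀ x, ∫⁻ t, F t * ψ (x - t) = ∫⁻ t, hF.mk F t * ψ (x - t) := fun x =>
      lintegral_congr_ae (by filter_upwards [hF.ae_eq_mk] with t ht; rw [ht])
    have e2 : ∫⁻ t, F t ^ p = ∫⁻ t, hF.mk F t ^ p :=
      lintegral_congr_ae (by filter_upwards [hF.ae_eq_mk] with t ht; rw [ht])
    simpa only [e1, e2] using this
  have hψx : ∀ x, Measurable fun t => ψ (x - t) := fun x =>
    hψ.comp (measurable_const.sub measurable_id)
  -- Jensen for the probability measure with density `ψ (x - t)`. Tonelli and translation invariance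
  -- finish the proof.
  have hx : ∀ x, (∫⁻ t, F t * ψ (x - t)) ^ p ≤ ∫⁻ t, F t ^ p * ψ (x - t) := by
    intro x
    have hprob : IsProbabilityMeasure (volume.withDensity fun t => ψ (x - t)) := by
      refine ⟨?_⟩
      rw [withDensity_apply _ MeasurableSet.univ, Measure.restrict_univ, ← h1]
      exact lintegral_sub_left_eq_self ψ x
    have h2 : ∀ f : Space d → ℝ≥0∞, Measurable f →
        ∫⁻ t, f t ∂(volume.withDensity fun t => ψ (x - t)) = ∫⁻ t, f t * ψ (x - t) := by
      intro f hf
      rw [lintegral_withDensity_eq_lintegral_mul _ (hψx x) hf]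
      simp [mul_comm]
    rw [← h2 F hFm, ← h2 _ (hFm.pow_const p)]
    exact lintegral_rpow_le hFm.aemeasurable hp
  calc ∫⁻ x, (∫⁻ t, F t * ψ (x - t)) ^ p ≤ ∫⁻ x, ∫⁻ t, F t ^ p * ψ (x - t) := lintegral_mono hx
    _ = ∫⁻ t, ∫⁻ x, F t ^ p * ψ (x - t) := by
        have hm : Measurable fun z : Space d × Space d => F z.2 ^ p * ψ (z.1 - z.2) :=
          ((hFm.comp measurable_snd).pow_const p).mul
            (hψ.comp (measurable_fst.sub measurable_snd))
        exact lintegral_lintegral_swap hm.aemeasurable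
    _ = ∫⁻ t, F t ^ p := by
        refine lintegral_congr fun t => ?_
        have hm : Measurable fun x => ψ (x - t) := hψ.comp (measurable_id.sub_const t)
        rw [lintegral_const_mul _ hm, lintegral_sub_right_eq_self ψ t, h1, mul_one]

/-- Young's inequality for the extension of `|g|` by zero. The left side is a norm over the whole
space, so it can be restricted to any subset. -/
lemma eLpNorm_mollify_le (hU : MeasurableSet U) {ψ g : Space d → ℝ} (hψ : Continuous ψ)
    (h0 : ∀ x, 0 ≤ ψ x) (hi : Integrable ψ) (h1 : ∫ x, ψ x = 1) {p : ℝ} (hp : 1 ≤ p)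
    (hg : AEStronglyMeasurable g (volume.restrict U)) :
    eLpNorm (mollify U ψ g) (ENNReal.ofReal p) volume ≤
      eLpNorm g (ENNReal.ofReal p) (volume.restrict U) := by
  have hp0 : 0 < p := by linarith
  rw [eLpNorm_ofReal _ hp0, eLpNorm_ofReal _ hp0]
  refine ENNReal.rpow_le_rpow ?_ (by positivity)
  have h2 : ∫⁻ x, ‖ψ x‖ₑ = 1 := by
    rw [← ofReal_integral_norm_eq_lintegral_enorm hi]
    simp_rw [Real.norm_of_nonneg (h0 _)]
    rw [h1, ENNReal.ofReal_one]
  have hF : AEMeasurable (U.indicator fun t => ‖g t‖ₑ) :=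
    (aemeasurable_indicator_iff hU).2 hg.enorm
  calc ∫⁻ x, ‖mollify U ψ g x‖ₑ ^ p
      ≤ ∫⁻ x, (∫⁻ t, (U.indicator fun t => ‖g t‖ₑ) t * ‖ψ (x - t)‖ₑ) ^ p := by
        refine lintegral_mono fun x => ENNReal.rpow_le_rpow ?_ hp0.le
        refine (enorm_integral_le_lintegral_enorm _).trans_eq ?_
        rw [← lintegral_indicator hU]
        refine lintegral_congr fun t => ?_
        by_cases ht : t ∈ U <;> simp [ht, enorm_mul]
    _ ≤ ∫⁻ t, (U.indicator fun t => ‖g t‖ₑ) t ^ p :=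
        lintegral_convolution_rpow_le hψ.enorm.measurable h2 hF hp
    _ = _ := by
        rw [← lintegral_indicator hU]
        refine lintegral_congr fun t => ?_
        by_cases ht : t ∈ U <;> simp [ht, hp0]

/-- Replaces the operator norm by partial derivatives, for which commutation with mollification is
available. -/
lemma enorm_fderiv_le_sum (f : Space d → ℝ) (x : Space d) :
    ‖fderiv ℝ f x‖ ≤ ∑ i, ‖partialDeriv i f x‖ := by
  refine ContinuousLinearMap.opNorm_le_bound _ (Finset.sum_nonneg fun _ _ => norm_nonneg _)
    fun v => ?_
  rw [fderiv_apply_eq_sum, Finset.sum_mul]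
  refine (norm_sum_le _ _).trans (Finset.sum_le_sum fun i _ => ?_)
  rw [norm_mul, mul_comm]
  gcongr
  exact PiLp.norm_apply_le v i

end Mollify

/-! ### Passage to the limit modulo additive constants -/

section Limit

open Filter Topology

/-- A Fatou lemma up to additive constants. -/
lemma exists_eLpNorm_sub_const_le {α : Type*} [MeasurableSpace α] {μ : Measure α} (hμ : μ ≠ 0)
    {q : ℝ} (hq : 1 ≤ q) {R : ℝ≥0∞} (hR : R ≠ ⊤) {F G : ℕ → α → ℝ} {g : α → ℝ} {m : ℕ → ℝ}
    (hF : ∀ n, AEStronglyMeasurable (F n) μ)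
    (hFR : ∀ n, eLpNorm (F n) (ENNReal.ofReal q) μ ≤ R)
    (hFG : ∀ᵐ x ∂μ, ∀ᶠ n in atTop, F n x = G n x - m n)
    (hG : ∀ᵐ x ∂μ, Tendsto (fun n => G n x) atTop (𝓝 (g x))) :
    ∃ c : ℝ, eLpNorm (fun x => g x - c) (ENNReal.ofReal q) μ ≤ R := by
  have hq0 : 0 < q := by linarith
  -- If the constants return infinitely often to some ball, a subsequence converges and ordinary
  -- Fatou applies with its limit as `c`. Otherwise `|m n| → ∞`, so `|F n| → ∞` almost everywhere
  -- while the norms stay below `R < ⊤`, which contradicts Fatou.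
  by_cases h : ∃ B : ℝ, ∃ᶠ n in atTop, m n ∈ Metric.closedBall (0 : ℝ) B
  · obtain ⟨B, hB⟩ := h
    obtain ⟨c, -, φ, hφ, hc⟩ := tendsto_subseq_of_frequently_bounded Metric.isBounded_closedBall hB
    refine ⟨c, (Lp.eLpNorm_lim_le_liminf_eLpNorm (fun n => hF (φ n)) _ ?_).trans ?_⟩
    · filter_upwards [hFG, hG] with x h1 h2
      refine ((h2.comp hφ.tendsto_atTop).sub hc).congr' ?_
      filter_upwards [hφ.tendsto_atTop.eventually h1] with n hn
      exact hn.symm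
    · refine Filter.liminf_le_of_le (by isBoundedDefault) fun b hb => ?_
      obtain ⟨n, hn⟩ := hb.exists
      exact hn.trans (hFR _)
  · exfalso
    push Not at h
    have hm : Tendsto (fun n => ‖m n‖) atTop atTop := by
      refine tendsto_atTop.2 fun B => ?_
      filter_upwards [h B] with n hn
      simp only [Metric.mem_closedBall, dist_zero_right, not_le] at hn
      exact hn.le
    have hlim : ∀ᵐ x ∂μ, liminf (fun n => ‖F n x‖ₑ ^ q) atTop = ⊤ := by
      filter_upwards [hFG, hG] with x h1 h2
      have h3 : Tendsto (fun n => ‖F n x‖) atTop atTop := by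
        have h4 : Tendsto (fun n => ‖m n‖ - ‖G n x‖) atTop atTop :=
          hm.atTop_add (h2.norm.neg)
        refine tendsto_atTop_mono' _ ?_ h4
        filter_upwards [h1] with n hn
        rw [hn, norm_sub_rev]
        exact norm_sub_norm_le _ _
      have h5 : Tendsto (fun n => ‖F n x‖ₑ) atTop (𝓝 ⊤) := by
        simp_rw [← ofReal_norm]
        exact ENNReal.tendsto_ofReal_atTop.comp h3
      have h6 := h5.ennrpow_const q
      rw [ENNReal.top_rpow_of_pos hq0] at h6
      exact h6.liminf_eq
    have hfatou := lintegral_liminf_le' (μ := μ) (f := fun n x => ‖F n x‖ₑ ^ q) (u := atTop)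
      fun n => (hF n).enorm.pow_const q
    rw [lintegral_congr_ae hlim, lintegral_const, ENNReal.top_mul (by simpa using hμ)] at hfatou
    have hb : liminf (fun n => ∫⁻ x, ‖F n x‖ₑ ^ q ∂μ) atTop ≤ R ^ q := by
      refine Filter.liminf_le_of_le (by isBoundedDefault) fun b hb => ?_
      obtain ⟨n, hn⟩ := hb.exists
      refine hn.trans ?_
      have := hFR n
      rw [eLpNorm_ofReal _ hq0, one_div, ENNReal.rpow_inv_le_iff hq0] at this
      exact this
    exact ENNReal.rpow_ne_top_of_nonneg hq0.le hR (top_le_iff.1 (hfatou.trans hb))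

end Limit

/-! ### The Sobolev–Poincaré inequality for weakly differentiable functions -/

section WeakSobolevPoincare

open Filter Topology
open scoped Convolution

variable {d : ℕ} (b : AffineBasis (Fin (d + 1)) ℝ (Space d))

/-- The Sobolev–Poincaré inequality for a mollification, on a homothetic smaller simplex. -/
lemma eLpNorm_mollify_sub_le {p q : ℝ} (hp : 1 ≤ p) (hq : 1 ≤ q) {C : ℝ≥0}
    (hC : ∀ G : Space d → ℝ, ContDiff ℝ 1 G →
      ∃ m : ℝ, eLpNorm (fun x => G x - m) (ENNReal.ofReal q) (volume.restrict (openSimplex b)) ≤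
        C * eLpNorm (fderiv ℝ G) (ENNReal.ofReal p) (volume.restrict (openSimplex b)))
    {g : Space d → ℝ} {g' : Fin d → Space d → ℝ} (hg : IntegrableOn g (openSimplex b))
    (hg' : ∀ i, IsWeakDeriv (openSimplex b) (Pi.single i 1) g (g' i))
    (hp' : ∀ i, AEStronglyMeasurable (g' i) (volume.restrict (openSimplex b)))
    {y : Space d} {r : ℝ} (hr : Metric.closedBall y r ⊆ openSimplex b) {ε : ℝ} (hε : 0 < ε)
    (hε2 : ε ≤ 1 / 2) (φ : ContDiffBump (0 : Space d)) (hφ : φ.rOut = ε * r) :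
    ∃ m : ℝ, eLpNorm (fun x => mollify (openSimplex b) (φ.normed volume) g x - m)
        (ENNReal.ofReal q)
        (volume.restrict ((fun x => (1 - ε) • x + ε • y) '' openSimplex b)) ≤
      C * 2 ^ d * ∑ i, eLpNorm (g' i) (ENNReal.ofReal p) (volume.restrict (openSimplex b)) := by
  set U := openSimplex b
  have hUm : MeasurableSet U := (isOpen_openSimplex b).measurableSet
  set ψ := φ.normed volume
  have hψ : Smooth ψ := φ.contDiff_normed
  set G := mollify U ψ g with hGdef
  have hε1 : (1 - ε) ≠ 0 := by linarith
  set L := scaleEquiv d (1 - ε) hε1 with hL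
  set H := affineHomeo L (ε • y) with hH
  have hHe : (fun x => (1 - ε) • x + ε • y) = H := rfl
  rw [hHe]
  have hpre : H ⁻¹' (H '' U) = U := Set.preimage_image_eq _ H.injective
  have hGs : Smooth G := contDiff_mollify hUm hψ φ.hasCompactSupport_normed hg
  have hG1 : ContDiff ℝ 1 G := ContDiff.of_le hGs (by norm_cast)
  -- Convexity: a point `w` within `ε * r` of `H z` equals `(1 - ε) • z + ε • (y + ε⁻¹ • (w - H
  -- z))`, and the second point is within `r` of `y`. Hence the contracted simplex keeps a margin
  -- equal to the radius of the kernel.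
  have hball : ∀ x ∈ H '' U, Metric.closedBall x (ε * r) ⊆ U := by
    rintro _ ⟨z, hz, rfl⟩ w hw
    have hy : y + ε⁻¹ • (w - H z) ∈ U := by
      apply hr
      rw [Metric.mem_closedBall, dist_eq_norm] at hw ⊢
      rw [add_sub_cancel_left, norm_smul, Real.norm_of_nonneg (by positivity),
        inv_mul_le_iff₀ hε]
      exact hw
    have : (1 - ε) • z + ε • (y + ε⁻¹ • (w - H z)) ∈ U :=
      convex_openSimplex b hz hy (by linarith) hε.le (by ring)
    convert this using 1
    rw [smul_add, smul_smul, mul_inv_cancel₀ hε.ne', one_smul, hH, affineHomeo_apply, hL,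
      scaleEquiv_apply]
    module
  have hpd : ∀ i, ∀ x ∈ H '' U, partialDeriv i G x = mollify U ψ (g' i) x := fun i x hx =>
    partialDeriv_mollify_of_weakDeriv hUm hψ (φ.tsupport_normed_eq.le.trans (by rw [hφ])) hg
      (hg' i) (hball x hx)
  have hVm : MeasurableSet (H '' U) := (H.isOpenMap _ (isOpen_openSimplex b)).measurableSet
  obtain ⟨m, hm⟩ := hC (G ∘ H) (hG1.comp (contDiff_affineHomeo L _))
  refine ⟨m, ?_⟩
  -- The Jacobian factor is `(1 - ε)⁻ᵈ`, between `1` and `2 ^ d` since `ε ≤ 1/2`. The lower bound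
  -- lets it be dropped on the left side, and the upper one bounds it on the right, so the constant
  -- does not depend on `ε`.
  have hjac1 : 1 ≤ jac L := by
    rw [hL, jac_scaleEquiv, ENNReal.one_le_ofReal, abs_of_nonneg (by
      have : 0 ≤ 1 - ε := by linarith
      positivity)]
    exact (one_le_inv₀ (pow_pos (by linarith) d)).2 (pow_le_one₀ (by linarith) (by linarith))
  have hjac2 : jac L ≤ 2 ^ d := jac_scaleEquiv_le hε1 (by linarith)
  have hjacp : jac L ^ (1 / ENNReal.ofReal p).toReal ≤ 2 ^ d := by
    have h1 : (1 / ENNReal.ofReal p).toReal = 1 / p := by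
      rw [ENNReal.toReal_div, ENNReal.toReal_one, ENNReal.toReal_ofReal (by linarith)]
    rw [h1]
    calc jac L ^ (1 / p) ≤ jac L ^ (1 : ℝ) := ENNReal.rpow_le_rpow_of_exponent_le hjac1
          ((div_le_one (by linarith)).2 hp)
      _ ≤ _ := by rwa [ENNReal.rpow_one]
  have h1 : eLpNorm (fun x => G x - m) (ENNReal.ofReal q) (volume.restrict (H '' U)) ≤
      eLpNorm (fun x => (G ∘ H) x - m) (ENNReal.ofReal q) (volume.restrict U) := by
    have := eLpNorm_comp_affineHomeo L (ε • y) (H '' U) (fun x => G x - m) (ENNReal.ofReal q)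
    rw [← hH, hpre] at this
    change _ ≤ eLpNorm ((fun x => G x - m) ∘ H) (ENNReal.ofReal q) (volume.restrict U)
    rw [this]
    exact le_mul_of_one_le_left' (ENNReal.one_le_rpow hjac1 (by
      rw [ENNReal.toReal_div, ENNReal.toReal_one, ENNReal.toReal_ofReal (by linarith)]
      positivity))
  have h2 : ∀ x, ‖fderiv ℝ (G ∘ H) x‖ ≤ ∑ i, ‖partialDeriv i G (H x)‖ := by
    intro x
    refine le_trans ?_ (enorm_fderiv_le_sum G (H x))
    have h3 : HasFDerivAt (G ∘ H) _ x :=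
      (hGs.differentiable (H x)).hasFDerivAt.comp x (hasFDerivAt_affineHomeo L (ε • y) x)
    rw [h3.fderiv]
    refine ContinuousLinearMap.opNorm_le_bound _ (norm_nonneg _) fun v => ?_
    refine ((fderiv ℝ G (H x)).le_opNorm _).trans ?_
    gcongr
    change ‖(1 - ε) • v‖ ≤ ‖v‖
    rw [norm_smul, Real.norm_of_nonneg (by linarith)]
    exact mul_le_of_le_one_left (norm_nonneg _) (by linarith)
  have hpdc : ∀ i, Continuous (partialDeriv i G) := fun i => (hGs.partialDeriv i).continuous
  calc eLpNorm (fun x => G x - m) (ENNReal.ofReal q) (volume.restrict (H '' U))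
      ≤ C * eLpNorm (fderiv ℝ (G ∘ H)) (ENNReal.ofReal p) (volume.restrict U) := h1.trans hm
    _ ≤ C * eLpNorm (fun x => ∑ i, ‖partialDeriv i G (H x)‖) (ENNReal.ofReal p)
          (volume.restrict U) := by
        gcongr
        exact eLpNorm_mono_real h2
    _ ≤ C * ∑ i, eLpNorm (partialDeriv i G ∘ H) (ENNReal.ofReal p) (volume.restrict U) := by
        gcongr
        have h3 := eLpNorm_sum_le (μ := volume.restrict U) (p := ENNReal.ofReal p)
          (s := Finset.univ) (f := fun i x => ‖partialDeriv i G (H x)‖)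
          (fun i _ => ((hpdc i).comp H.continuous).norm.aestronglyMeasurable)
          (by rwa [ENNReal.one_le_ofReal])
        have h4 : (fun x => ∑ i, ‖partialDeriv i G (H x)‖) =
            ∑ i, fun x => ‖partialDeriv i G (H x)‖ := by
          ext x
          simp
        rw [h4]
        exact h3.trans_eq (Finset.sum_congr rfl fun i _ => eLpNorm_norm (partialDeriv i G ∘ H))
    _ ≤ C * ∑ i, 2 ^ d * eLpNorm (g' i) (ENNReal.ofReal p) (volume.restrict U) := by
        gcongr with i
        have := eLpNorm_comp_affineHomeo L (ε • y) (H '' U) (partialDeriv i G) (ENNReal.ofReal p)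
        rw [← hH, hpre] at this
        rw [this]
        gcongr
        calc eLpNorm (partialDeriv i G) (ENNReal.ofReal p) (volume.restrict (H '' U))
            = eLpNorm (mollify U ψ (g' i)) (ENNReal.ofReal p) (volume.restrict (H '' U)) :=
              eLpNorm_congr_ae ((ae_restrict_iff' hVm).2 (Eventually.of_forall (hpd i)))
          _ ≤ eLpNorm (mollify U ψ (g' i)) (ENNReal.ofReal p) volume :=
              eLpNorm_mono_measure _ Measure.restrict_le_self
          _ ≤ _ := eLpNorm_mollify_le hUm hψ.continuous φ.nonneg_normed φ.integrable_normed
              φ.integral_normed hp (hp' i)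
    _ = _ := by
        rw [← Finset.mul_sum]
        ring

/-- The Sobolev–Poincaré inequality on a simplex for weakly differentiable functions, up to an
additive constant. -/
theorem exists_eLpNorm_sub_const_le_sum (hd : 2 ≤ d) {p q : ℝ} (hp : 1 ≤ p) (hq : 1 ≤ q)
    (hpq : 1 - (d : ℝ) / p ≥ -((d : ℝ) / q)) :
    ∃ C : ℝ≥0, ∀ (g : Space d → ℝ) (g' : Fin d → Space d → ℝ), IntegrableOn g (openSimplex b) →
      (∀ i, IsWeakDeriv (openSimplex b) (Pi.single i 1) g (g' i)) →
      (∀ i, MemLp (g' i) (ENNReal.ofReal p) (volume.restrict (openSimplex b))) →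
      ∃ m : ℝ, eLpNorm (fun x => g x - m) (ENNReal.ofReal q) (volume.restrict (openSimplex b)) ≤
        C * ∑ i, eLpNorm (g' i) (ENNReal.ofReal p) (volume.restrict (openSimplex b)) := by
  obtain ⟨C, hC⟩ := exists_eLpNorm_sub_le_eLpNorm_fderiv b hd hp hq hpq
  refine ⟨C * 2 ^ d, fun g g' hg hg' hp' => ?_⟩
  set U := openSimplex b with hU
  have hUm : MeasurableSet U := (isOpen_openSimplex b).measurableSet
  set μ := volume.restrict U with hμ
  obtain ⟨y, hy⟩ : U.Nonempty := ⟨_, b.centroid_mem_interior_convexHull⟩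
  obtain ⟨r, hr0, hr⟩ := Metric.nhds_basis_closedBall.mem_iff.1 ((isOpen_openSimplex b).mem_nhds hy)
  -- This is `1 / (n + 2)`, shifted so that `ε n ≤ 1/2` already at `n = 0`.
  set ε : ℕ → ℝ := fun n => 1 / ((n + 1 : ℕ) + 1 : ℝ) with hε
  have hε0 : ∀ n, 0 < ε n := fun n => by positivity
  have hε2 : ∀ n, ε n ≤ 1 / 2 := fun n => by
    apply one_div_le_one_div_of_le (by norm_num)
    push_cast
    linarith [(Nat.cast_nonneg n : (0 : ℝ) ≤ n)]
  have hεlim : Tendsto ε atTop (𝓝 0) :=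
    (tendsto_one_div_add_atTop_nhds_zero_nat (𝕜 := ℝ)).comp (tendsto_add_atTop_nat 1)
  -- The outer radius is the margin of the contracted simplex. The fixed ratio `2` of the radii is
  -- required for almost everywhere convergence of the mollifications.
  set φ : ℕ → ContDiffBump (0 : Space d) := fun n =>
    ⟨ε n * r / 2, ε n * r, by have := hε0 n; positivity, by
      have := mul_pos (hε0 n) hr0; linarith⟩ with hφ
  have hstep := fun n => eLpNorm_mollify_sub_le b hp hq hC hg hg' (fun i => (hp' i).1) hr (hε0 n)
    (hε2 n) (φ n) rfl
  choose m hm using hstep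
  set G : ℕ → Space d → ℝ := fun n => mollify U ((φ n).normed volume) g with hG
  set V : ℕ → Set (Space d) := fun n => (fun x => (1 - ε n) • x + ε n • y) '' U with hV
  have hε1 : ∀ n, 1 - ε n ≠ 0 := fun n => by linarith [hε2 n]
  have hVm : ∀ n, MeasurableSet (V n) := fun n =>
    ((affineHomeo (scaleEquiv d (1 - ε n) (hε1 n)) (ε n • y)).isOpenMap _
      (isOpen_openSimplex b)).measurableSet
  have hVU : ∀ n, V n ⊆ U := by
    rintro n _ ⟨x, hx, rfl⟩
    exact convex_openSimplex b hx hy (by linarith [hε2 n]) (hε0 n).le (by ring)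
  have hGc : ∀ n, Continuous (G n) := fun n =>
    (contDiff_mollify hUm (φ n).contDiff_normed (φ n).hasCompactSupport_normed hg).continuous
  have hR : (C * 2 ^ d : ℝ≥0) * ∑ i, eLpNorm (g' i) (ENNReal.ofReal p) μ ≠ ⊤ :=
    ENNReal.mul_ne_top ENNReal.coe_ne_top (ENNReal.sum_ne_top.2 fun i _ => (hp' i).2.ne)
  have hμ0 : μ ≠ 0 := by
    rw [hμ, Ne, Measure.restrict_eq_zero]
    exact volume_openSimplex_ne_zero b
  refine exists_eLpNorm_sub_const_le hμ0 hq hR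
    (F := fun n => (V n).indicator fun x => G n x - m n) (G := G) (m := m) (fun n => ?_)
    (fun n => ?_) ?_ ?_
  · exact ((hGc n).sub continuous_const).aestronglyMeasurable.indicator (hVm n)
  · rw [eLpNorm_indicator_eq_eLpNorm_restrict (hVm n), hμ, Measure.restrict_restrict (hVm n),
      Set.inter_eq_left.2 (hVU n)]
    have := hm n
    push_cast
    exact this
  · refine (ae_restrict_iff' hUm).2 (Eventually.of_forall fun x hx => ?_)
    -- The preimage of `x` under the `n`-th homothety tends to `x`, so it lies in the open set `U`
    -- eventually. Thus every point of `U` is in `V n` for large `n`, where the indicator in `F n`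
    -- is harmless.
    have h1 : Tendsto (fun n => (1 - ε n)⁻¹ • (x - ε n • y)) atTop (𝓝 x) := by
      have h2 : Tendsto (fun n => (1 - ε n)⁻¹) atTop (𝓝 ((1 - 0)⁻¹)) :=
        (tendsto_const_nhds.sub hεlim).inv₀ (by norm_num)
      have h3 : Tendsto (fun n => x - ε n • y) atTop (𝓝 (x - (0 : ℝ) • y)) :=
        tendsto_const_nhds.sub (hεlim.smul_const y)
      simpa using h2.smul h3
    filter_upwards [h1.eventually ((isOpen_openSimplex b).mem_nhds hx)] with n hn
    have : x ∈ V n := ⟨_, hn, by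
      simp only [smul_smul, mul_inv_cancel₀ (hε1 n), one_smul, sub_add_cancel]⟩
    rw [Set.indicator_of_mem this]
  · have hgi : LocallyIntegrable (U.indicator g) volume :=
      ((integrable_indicator_iff hUm).2 hg).locallyIntegrable
    have hrout : Tendsto (fun n => (φ n).rOut) atTop (𝓝 0) := by
      simpa using hεlim.mul_const r
    have := ContDiffBump.ae_convolution_tendsto_right_of_locallyIntegrable (K := 2) hrout
      (Eventually.of_forall fun n => by simp only [hφ]; linarith) hgi
    refine (ae_restrict_iff' hUm).2 ?_
    filter_upwards [this] with x hx hxU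
    rw [Set.indicator_of_mem hxU] at hx
    refine hx.congr fun n => ?_
    rw [← mollify_eq_convolution_swap hUm]

lemma memLp_of_eLpNorm_sub_const {α : Type*} [MeasurableSpace α] {μ : Measure α}
    [IsFiniteMeasure μ] {g : α → ℝ} {m : ℝ} {q : ℝ≥0∞} (hg : AEStronglyMeasurable g μ)
    (h : eLpNorm (fun x => g x - m) q μ < ⊤) : MemLp g q μ := by
  have h1 : MemLp (fun x => g x - m) q μ := ⟨hg.sub aestronglyMeasurable_const, h⟩
  have h2 := h1.add (memLp_const m)
  have e : ((fun x => g x - m) + fun _ => m) = g := by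
    ext x
    simp
  rwa [e] at h2

/-- Subtracting the mean amounts to subtracting `m` and then the mean of `g - m`, and by Jensen that
mean has norm at most that of `g - m`. So the unspecified constant may be replaced by the average at
the cost of a factor `2`. -/
lemma eLpNorm_sub_average_le {α : Type*} [MeasurableSpace α] {μ : Measure α} [IsFiniteMeasure μ]
    [NeZero μ] {g : α → ℝ} (hg : Integrable g μ) {q : ℝ} (hq : 1 ≤ q) (m : ℝ) :
    eLpNorm (fun x => g x - ⨍ y, g y ∂μ) (ENNReal.ofReal q) μ ≤
      2 * eLpNorm (fun x => g x - m) (ENNReal.ofReal q) μ := by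
  have hq0 : 0 < q := by linarith
  have hqe : ENNReal.ofReal q ≠ 0 := by simpa using hq0
  have h1 : (⨍ y, g y ∂μ) - m = ⨍ y, (g y - m) ∂μ := by
    rw [average_eq, average_eq, integral_sub hg (integrable_const m), integral_const, smul_sub,
      smul_smul, inv_mul_cancel₀ (by
        rw [Measure.real, ENNReal.toReal_ne_zero]
        exact ⟨by simpa using NeZero.ne μ, measure_ne_top _ _⟩), one_smul]
  set ν := (μ Set.univ)⁻¹ • μ with hν
  have hμ0 : μ Set.univ ≠ 0 := by simpa using NeZero.ne μ
  have hprob : IsProbabilityMeasure ν := ⟨by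
    rw [hν, Measure.smul_apply, smul_eq_mul, ENNReal.inv_mul_cancel hμ0 (measure_ne_top _ _)]⟩
  have h2 : ‖⨍ y, (g y - m) ∂μ‖ₑ ^ q ≤ ∫⁻ y, ‖g y - m‖ₑ ^ q ∂ν := by
    have hmeas : AEMeasurable (fun y => ‖g y - m‖ₑ) ν :=
      ((hg.1.sub aestronglyMeasurable_const).enorm).mono_ac Measure.smul_absolutelyContinuous
    refine le_trans (ENNReal.rpow_le_rpow ?_ hq0.le) (lintegral_rpow_le hmeas hq)
    exact enorm_integral_le_lintegral_enorm _
  have h3 : eLpNorm (fun _ : α => (⨍ y, g y ∂μ) - m) (ENNReal.ofReal q) μ ≤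
      eLpNorm (fun x => g x - m) (ENNReal.ofReal q) μ := by
    rw [eLpNorm_ofReal _ hq0, eLpNorm_ofReal _ hq0]
    refine ENNReal.rpow_le_rpow ?_ (by positivity)
    rw [lintegral_const, h1]
    refine (mul_le_mul_left h2 _).trans_eq ?_
    rw [hν, lintegral_smul_measure, smul_eq_mul, mul_right_comm,
      ENNReal.inv_mul_cancel hμ0 (measure_ne_top _ _), one_mul]
  have e : (fun x => g x - ⨍ y, g y ∂μ) =
      (fun x => g x - m) - fun _ : α => (⨍ y, g y ∂μ) - m := by
    ext x
    simp
  rw [e, two_mul]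
  refine (eLpNorm_sub_le (hg.1.sub aestronglyMeasurable_const) aestronglyMeasurable_const
    (by rwa [ENNReal.one_le_ofReal])).trans ?_
  exact add_le_add le_rfl h3

/-- The Sobolev–Poincaré inequality on a simplex for weakly differentiable functions. -/
theorem exists_eLpNorm_sub_average_le_sum (hd : 2 ≤ d) {p q : ℝ} (hp : 1 ≤ p) (hq : 1 ≤ q)
    (hpq : 1 - (d : ℝ) / p ≥ -((d : ℝ) / q)) :
    ∃ C : ℝ≥0, ∀ (g : Space d → ℝ) (g' : Fin d → Space d → ℝ), IntegrableOn g (openSimplex b) →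
      (∀ i, IsWeakDeriv (openSimplex b) (Pi.single i 1) g (g' i)) →
      (∀ i, MemLp (g' i) (ENNReal.ofReal p) (volume.restrict (openSimplex b))) →
      MemLp g (ENNReal.ofReal q) (volume.restrict (openSimplex b)) ∧
      eLpNorm (fun x => g x - ⨍ y in openSimplex b, g y) (ENNReal.ofReal q)
          (volume.restrict (openSimplex b)) ≤
        C * ∑ i, eLpNorm (g' i) (ENNReal.ofReal p) (volume.restrict (openSimplex b)) := by
  obtain ⟨C, hC⟩ := exists_eLpNorm_sub_const_le_sum b hd hp hq hpq
  refine ⟨2 * C, fun g g' hg hg' hp' => ?_⟩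
  obtain ⟨m, hm⟩ := hC g g' hg hg' hp'
  have hfin : IsFiniteMeasure (volume.restrict (openSimplex b)) :=
    ⟨by simpa using volume_openSimplex_lt_top b⟩
  have hne : NeZero (volume.restrict (openSimplex b)) :=
    ⟨by rw [Ne, Measure.restrict_eq_zero]; exact volume_openSimplex_ne_zero b⟩
  refine ⟨memLp_of_eLpNorm_sub_const hg.1 (hm.trans_lt ?_),
    (eLpNorm_sub_average_le hg hq m).trans ?_⟩
  · exact ENNReal.mul_lt_top ENNReal.coe_lt_top (ENNReal.sum_lt_top.2 fun i _ => (hp' i).2)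
  · push_cast
    rw [mul_assoc]
    gcongr

end WeakSobolevPoincare

/-! ### Scaled estimates on affine images of a simplex -/

section Scaled

variable {d : ℕ}

lemma toReal_one_div_ofReal {r : ℝ} (hr : 0 ≤ r) : (1 / ENNReal.ofReal r).toReal = 1 / r := by
  rw [ENNReal.toReal_div, ENNReal.toReal_one, ENNReal.toReal_ofReal hr]

lemma integrableOn_of_memLp {U : Set (Space d)} (hU : volume U ≠ ⊤) {f : Space d → ℝ} {p : ℝ}
    (hp : 1 ≤ p) (hf : MemLp f (ENNReal.ofReal p) (volume.restrict U)) : IntegrableOn f U := by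
  have : IsFiniteMeasure (volume.restrict U) := ⟨by simpa using hU.lt_top⟩
  exact hf.integrable (by rwa [ENNReal.one_le_ofReal])

lemma average_comp_affineHomeo (L : Space d ≃L[ℝ] Space d) (s : Space d) (U : Set (Space d))
    (g : Space d → ℝ) :
    ⨍ x in affineHomeo L s ⁻¹' U, g (affineHomeo L s x) = ⨍ x in U, g x := by
  have hJ : (jac L).toReal ≠ 0 := ENNReal.toReal_ne_zero.2 ⟨jac_ne_zero L, jac_ne_top L⟩
  rw [setAverage_eq, setAverage_eq, integral_comp_affineHomeo, Measure.real,
    volume_preimage_affineHomeo, ENNReal.toReal_mul, smul_eq_mul, smul_eq_mul, Measure.real,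
    mul_inv]
  field_simp

/-- The anisotropic Sobolev–Poincaré inequality on affine images of a simplex. -/
theorem exists_anisotropic_sobolev_poincare (b : AffineBasis (Fin (d + 1)) ℝ (Space d))
    (hd : 2 ≤ d) {p q : ℝ} (hp : 1 ≤ p) (hq : 1 ≤ q) (hpq : 1 - (d : ℝ) / p ≥ -((d : ℝ) / q)) :
    ∃ C : ℝ≥0, ∀ (L : Space d ≃L[ℝ] Space d) (s : Space d) (U : Set (Space d)), IsOpen U →
      affineHomeo L s ⁻¹' U = openSimplex b →
      ∀ (g : Space d → ℝ) (g' : Fin d → Space d → ℝ), IntegrableOn g U →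
      (∀ i, IsWeakDeriv U (Pi.single i 1) g (g' i)) →
      (∀ i, MemLp (g' i) (ENNReal.ofReal p) (volume.restrict U)) →
      MemLp g (ENNReal.ofReal q) (volume.restrict U) ∧
      eLpNorm (fun x => g x - ⨍ y in U, g y) (ENNReal.ofReal q) (volume.restrict U) ≤
        C * volume U ^ (1 / q - 1 / p) *
          ∑ i, eLpNorm (fun x => ∑ j, L (EuclideanSpace.single i 1) j * g' j x)
            (ENNReal.ofReal p) (volume.restrict U) := by
  obtain ⟨C, hC⟩ := exists_eLpNorm_sub_average_le_sum b hd hp hq hpq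
  have hV0 := volume_openSimplex_ne_zero b
  have hVt := (volume_openSimplex_lt_top b).ne
  set W := volume (openSimplex b)
  -- Changing variables on both sides leaves `J ^ (1 / p - 1 / q)` with `J = W / volume U`. The part
  -- with `W` depends only on the reference simplex and goes into the constant.
  refine ⟨C * (W ^ (1 / p - 1 / q)).toNNReal, fun L s U hU hpre g g' hg hg' hp' => ?_⟩
  set Φ := affineHomeo L s with hΦ
  have hJ0 := jac_ne_zero L
  have hJt := jac_ne_top L
  set J := jac L
  have hvol : W = J * volume U := by
    rw [← volume_preimage_affineHomeo L s U, ← hΦ, hpre]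
  have hU0 : volume U ≠ 0 := by
    intro h
    rw [hvol, h, mul_zero] at hV0
    exact hV0 rfl
  have hUt : volume U ≠ ⊤ := by
    intro h
    rw [hvol, h, ENNReal.mul_top hJ0] at hVt
    exact hVt rfl
  -- By the chain rule, `N i ∘ Φ` is the `i`-th weak partial derivative of `g ∘ Φ`.
  set N : Fin d → Space d → ℝ := fun i x => ∑ j, L (EuclideanSpace.single i 1) j * g' j x with hN
  have hNp : ∀ i, MemLp (N i) (ENNReal.ofReal p) (volume.restrict U) := fun i =>
    memLp_finsetSum _ fun j _ => (hp' j).const_mul _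
  have hw : ∀ i, IsWeakDeriv (openSimplex b) (Pi.single i 1) (g ∘ Φ) (N i ∘ Φ) := fun i => by
    rw [← hpre]
    exact IsWeakDeriv.comp_affineHomeo_single L s hU hg.locallyIntegrableOn hg' i
  have hgΦ : IntegrableOn (g ∘ Φ) (openSimplex b) := hpre ▸ integrableOn_comp_affineHomeo L s hg
  have hNΦ : ∀ i, MemLp (N i ∘ Φ) (ENNReal.ofReal p) (volume.restrict (openSimplex b)) :=
    fun i => hpre ▸ memLp_comp_affineHomeo L s (hNp i)
  obtain ⟨h1, h2⟩ := hC (g ∘ Φ) (fun i => N i ∘ Φ) hgΦ hw hNΦ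
  have hnorm : ∀ (f : Space d → ℝ) {r : ℝ}, 1 ≤ r →
      eLpNorm (f ∘ Φ) (ENNReal.ofReal r) (volume.restrict (openSimplex b)) =
        J ^ (1 / r) * eLpNorm f (ENNReal.ofReal r) (volume.restrict U) := by
    intro f r hr
    rw [← hpre, hΦ, eLpNorm_comp_affineHomeo, toReal_one_div_ofReal (by linarith)]
  refine ⟨⟨hg.1, ?_⟩, ?_⟩
  · have h3 := h1.2
    rw [hnorm g hq] at h3
    exact (ENNReal.mul_lt_top_iff.1 h3).elim (fun h => h.2) fun h => h.elim
      (fun h => absurd h (ENNReal.rpow_pos (pos_iff_ne_zero.2 hJ0) hJt).ne')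
      fun h => by rw [h]; exact ENNReal.zero_lt_top
  · have hav : ⨍ y in openSimplex b, (g ∘ Φ) y = ⨍ y in U, g y := by
      rw [← hpre]
      exact average_comp_affineHomeo L s U g
    rw [hav] at h2
    change eLpNorm ((fun x => g x - ⨍ y in U, g y) ∘ Φ) _ _ ≤ _ at h2
    rw [hnorm _ hq] at h2
    simp_rw [hnorm _ hp, ← Finset.mul_sum] at h2
    set A := eLpNorm (fun x => g x - ⨍ y in U, g y) (ENNReal.ofReal q) (volume.restrict U)
    set S := ∑ i, eLpNorm (N i) (ENNReal.ofReal p) (volume.restrict U) with hS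
    have hJe : J ^ (1 / p - 1 / q) = W ^ (1 / p - 1 / q) * volume U ^ (1 / q - 1 / p) := by
      rw [hvol, ENNReal.mul_rpow_of_ne_top hJt hUt, mul_assoc, ← ENNReal.rpow_add _ _ hU0 hUt]
      simp
    have h4 : A = J ^ (-(1 / q)) * (J ^ (1 / q) * A) := by
      rw [← mul_assoc, ← ENNReal.rpow_add _ _ hJ0 hJt]
      simp
    calc A ≤ J ^ (-(1 / q)) * (C * (J ^ (1 / p) * S)) := by
          rw [h4]
          gcongr
      _ = C * J ^ (1 / p - 1 / q) * S := by
          rw [show 1 / p - 1 / q = -(1 / q) + 1 / p by ring, ENNReal.rpow_add _ _ hJ0 hJt]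
          ring
      _ = _ := by
          rw [hJe, ENNReal.coe_mul, ENNReal.coe_toNNReal
            (ENNReal.rpow_ne_top_of_ne_zero hV0 hVt)]
          ring

end Scaled

/-! ### Sobolev seminorms -/

section Seminorm

variable {d k : ℕ} {U : Set (Space d)} {p q : ℝ}

lemma sum_rpow_le_rpow_sum {ι : Type*} (s : Finset ι) (a : ι → ℝ≥0∞) {r : ℝ} (hr : 1 ≤ r) :
    ∑ i ∈ s, a i ^ r ≤ (∑ i ∈ s, a i) ^ r := by
  classical
  induction s using Finset.induction_on with
  | empty => simp
  | insert i s hi ih =>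
    rw [Finset.sum_insert hi, Finset.sum_insert hi]
    exact (add_le_add le_rfl ih).trans (ENNReal.add_rpow_le_rpow_add _ _ hr)

/-- The `ℓ^p` norm of the finite family of norms is at most its `ℓ^1` norm, so each derivative may
be estimated separately. -/
lemma sobolevSeminorm_le_sum (hp : 1 ≤ p) (f : Space d → ℝ) :
    sobolevSeminorm U k p f ≤ ∑ α ∈ multiIndices d k,
      eLpNorm (weakDeriv U α f) (ENNReal.ofReal p) (volume.restrict U) := by
  have hp0 : 0 < p := by linarith
  rw [sobolevSeminorm, one_div, ENNReal.rpow_inv_le_iff hp0]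
  exact sum_rpow_le_rpow_sum _ _ hp

lemma eLpNorm_weakDeriv_le_sobolevSeminorm (hp : 1 ≤ p) (f : Space d → ℝ) {α : Fin d → ℕ}
    (hα : α ∈ multiIndices d k) :
    eLpNorm (weakDeriv U α f) (ENNReal.ofReal p) (volume.restrict U) ≤
      sobolevSeminorm U k p f := by
  have hp0 : 0 < p := by linarith
  rw [sobolevSeminorm, one_div, ENNReal.le_rpow_inv_iff hp0]
  exact Finset.single_le_sum (f := fun α => eLpNorm (weakDeriv U α f) (ENNReal.ofReal p)
    (volume.restrict U) ^ p) (fun _ _ => zero_le) hα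

lemma MemSobolev.isWeakDeriv {φ : Space d → ℝ} (h : MemSobolev U k p φ) {α : Fin d → ℕ}
    (hα : ∑ i, α i ≤ k) : IsWeakDeriv U α φ (weakDeriv U α φ) := by
  obtain ⟨g, hg, -⟩ := h α hα
  exact hg.isWeakDeriv_weakDeriv

lemma MemSobolev.memLp (hU : IsOpen U) {φ : Space d → ℝ} (h : MemSobolev U k p φ)
    {α : Fin d → ℕ} (hα : ∑ i, α i ≤ k) :
    MemLp (weakDeriv U α φ) (ENNReal.ofReal p) (volume.restrict U) := by
  obtain ⟨g, hg, hgp⟩ := h α hα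
  exact (memLp_congr_ae (hg.weakDeriv_ae_eq hU)).2 hgp

lemma MemSobolev.mono {l : ℕ} {φ : Space d → ℝ} (h : MemSobolev U k p φ) (hl : l ≤ k) :
    MemSobolev U l p φ := fun α hα => h α (hα.trans hl)

/-- `∂^α (r · ∇) φ = ∑_j r_j ∂^(α + e_j) φ`. -/
lemma MemSobolev.isWeakDeriv_weakDirDeriv {φ : Space d → ℝ} (h : MemSobolev U (k + 1) p φ)
    (r : Space d) {α : Fin d → ℕ} (hα : ∑ i, α i ≤ k) :
    IsWeakDeriv U α (weakDirDeriv U r φ)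
      (fun x => ∑ j, r j * weakDeriv U (α + Pi.single j 1) φ x) := by
  refine IsWeakDeriv.sum Finset.univ (fun j => r j) fun j _ => ?_
  have h1 : IsWeakDeriv U (Pi.single j 1) φ (weakPartial U j φ) :=
    h.isWeakDeriv (by simp)
  refine h1.of_add ?_
  rw [add_comm]
  exact h.isWeakDeriv (by rw [sum_add_single]; omega)

lemma MemSobolev.isWeakDeriv_single {φ : Space d → ℝ} (h : MemSobolev U (k + 1) p φ)
    {α : Fin d → ℕ} (hα : ∑ i, α i ≤ k) (j : Fin d) :
    IsWeakDeriv U (Pi.single j 1) (weakDeriv U α φ) (weakDeriv U (α + Pi.single j 1) φ) :=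
  (h.isWeakDeriv (hα.trans k.le_succ)).of_add (h.isWeakDeriv (by rw [sum_add_single]; omega))

lemma MemSobolev.eLpNorm_dirDeriv_le (hU : IsOpen U) (hp : 1 ≤ p) {φ : Space d → ℝ}
    (h : MemSobolev U (k + 1) p φ) (r : Space d) {α : Fin d → ℕ} (hα : α ∈ multiIndices d k) :
    eLpNorm (fun x => ∑ j, r j * weakDeriv U (α + Pi.single j 1) φ x) (ENNReal.ofReal p)
      (volume.restrict U) ≤ sobolevSeminorm U k p (weakDirDeriv U r φ) := by
  rw [← eLpNorm_congr_ae ((h.isWeakDeriv_weakDirDeriv r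
    (mem_multiIndices.1 hα).le).weakDeriv_ae_eq hU)]
  exact eLpNorm_weakDeriv_le_sobolevSeminorm hp _ hα

/-- Derivatives of order `k` of directional derivatives in rotated coordinates. -/
lemma MemSobolev.eLpNorm_dirDeriv_le_comp (hU : IsOpen U) (hp : 1 ≤ p) {φ : Space d → ℝ}
    (h : MemSobolev U (k + 1) p φ) (R : Space d ≃L[ℝ] Space d) (s : Space d) (hJ : jac R = 1)
    (hR : ∀ i j, |R (EuclideanSpace.single i 1) j| ≤ 1)
    (hR' : ∀ i j, |R.symm (EuclideanSpace.single i 1) j| ≤ 1)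
    (l : Fin d) {α : Fin d → ℕ} (hα : α ∈ multiIndices d k) :
    eLpNorm (fun x => ∑ j, R (EuclideanSpace.single l 1) j *
        weakDeriv U (α + Pi.single j 1) φ x) (ENNReal.ofReal p) (volume.restrict U) ≤
      ((multiIndices d k).card * d ^ k : ℝ≥0) * sobolevSeminorm (affineHomeo R s ⁻¹' U) k p
        (weakPartial (affineHomeo R s ⁻¹' U) l (φ ∘ affineHomeo R s)) := by
  set Φ := affineHomeo R s with hΦ
  set V := Φ ⁻¹' U with hV
  have hVo : IsOpen V := hU.preimage Φ.continuous
  set r : Space d := R (EuclideanSpace.single l 1) with hr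
  set ψ := weakDirDeriv U r φ with hψ
  set ψt := weakPartial V l (φ ∘ Φ) with hψt
  have hφ0 : LocallyIntegrableOn φ U := (h.isWeakDeriv (α := 0) (by simp)).1
  have hψα : ∀ β ∈ multiIndices d k, IsWeakDeriv U β ψ
      (fun x => ∑ j, r j * weakDeriv U (β + Pi.single j 1) φ x) := fun β hβ =>
    h.isWeakDeriv_weakDirDeriv r (mem_multiIndices.1 hβ).le
  have hψl : LocallyIntegrableOn ψ U := (hψα α hα).1
  have hae : ψt =ᵐ[volume.restrict V] ψ ∘ Φ :=
    (IsWeakDeriv.comp_affineHomeo_single R s hU hφ0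
      (fun j => h.isWeakDeriv (α := Pi.single j 1) (by simp)) l).weakDeriv_ae_eq hVo
  -- The chain rule along `R` is used only for the existence of these derivatives. The estimate
  -- comes from the chain rule along the inverse, which expresses `∂^α ψ` through the derivatives of
  -- `ψt`; uniqueness of weak derivatives compares the two formulas.
  have hwt : ∀ β ∈ multiIndices d k, IsWeakDeriv V β ψt (weakDeriv V β ψt) := by
    intro β hβ
    obtain ⟨c, -, hc⟩ := exists_chainRule_coeff R s hR β
    rw [mem_multiIndices.1 hβ] at hc
    have h1 := IsWeakDeriv.comp_affineHomeo R s hU (α := β) (M := multiIndices d k)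
      (β := fun γ => γ) (fun γ hγ => by rw [mem_multiIndices.1 hγ, mem_multiIndices.1 hβ])
      hψl hψα hc
    exact (h1.congr hae.symm (ae_eq_refl _)).isWeakDeriv_weakDeriv
  obtain ⟨c, hcb, hc⟩ := exists_chainRule_coeff R.symm (-R.symm s) hR' α
  rw [mem_multiIndices.1 hα] at hc
  simp_rw [mem_multiIndices.1 hα] at hcb
  set Ψ := affineHomeo R.symm (-R.symm s) with hΨ
  have hΨΦ : Φ.symm = Ψ := affineHomeo_symm R s
  have hpre : Ψ ⁻¹' V = U := by
    rw [← hΨΦ, hV, ← Set.preimage_comp, Homeomorph.self_comp_symm, Set.preimage_id]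
  have hw := IsWeakDeriv.comp_affineHomeo R.symm (-R.symm s) hVo (α := α)
    (M := multiIndices d k) (β := fun γ => γ)
    (fun γ hγ => by rw [mem_multiIndices.1 hγ, mem_multiIndices.1 hα]) (hwt α hα).1 hwt hc
  rw [← hΨ, hpre] at hw
  have hψΨ : ψt ∘ Ψ =ᵐ[volume.restrict U] ψ := by
    have h1 := ae_eq_comp_affineHomeo R.symm (-R.symm s) hae
    rw [← hΨ, hpre, Function.comp_assoc, ← hΨΦ, Homeomorph.self_comp_symm,
      Function.comp_id] at h1
    rwa [← hΨΦ]
  have hfin := (hψα α hα).ae_eq hU (hw.congr hψΨ (ae_eq_refl _))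
  have hJ' : jac R.symm = 1 := by
    have h1 : LinearMap.det (R.symm : Space d →ₗ[ℝ] Space d) *
        LinearMap.det (R : Space d →ₗ[ℝ] Space d) = 1 := R.toLinearEquiv.det_symm_mul_det
    have h2 := (ENNReal.ofReal_eq_one.1 hJ)
    rw [abs_inv, inv_eq_one] at h2
    have h3 := congrArg abs h1
    rw [abs_mul, h2, mul_one, abs_one] at h3
    rw [jac, abs_inv, h3]
    simp
  have hterm : ∀ β ∈ multiIndices d k,
      eLpNorm (fun x => c β * weakDeriv V β ψt (Ψ x)) (ENNReal.ofReal p) (volume.restrict U) ≤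
        ((d : ℝ≥0) ^ k : ℝ≥0) * sobolevSeminorm V k p ψt := by
    intro β hβ
    have h1 : (fun x => c β * weakDeriv V β ψt (Ψ x)) = c β • (weakDeriv V β ψt ∘ Ψ) := rfl
    rw [h1, eLpNorm_const_smul]
    refine mul_le_mul' ?_ ?_
    · rw [Real.enorm_eq_ofReal_abs]
      refine (ENNReal.ofReal_le_ofReal (hcb β)).trans_eq ?_
      rw [mul_one, ENNReal.ofReal_pow (by positivity), ENNReal.ofReal_natCast]
      simp
    · have h2 := eLpNorm_comp_affineHomeo R.symm (-R.symm s) V (weakDeriv V β ψt)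
        (ENNReal.ofReal p)
      rw [← hΨ, hpre, hJ', ENNReal.one_rpow, one_mul] at h2
      rw [h2]
      exact eLpNorm_weakDeriv_le_sobolevSeminorm hp _ hβ
  have hmeas : ∀ β ∈ multiIndices d k, AEStronglyMeasurable
      (fun x => c β * weakDeriv V β ψt (Ψ x)) (volume.restrict U) := by
    intro β hβ
    have h1 := (locallyIntegrableOn_comp_affineHomeo R.symm (-R.symm s) hVo
      (hwt β hβ).2.1).aestronglyMeasurable
    rw [← hΨ, hpre] at h1
    exact h1.const_mul (c β)
  rw [eLpNorm_congr_ae hfin]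
  calc eLpNorm (fun x => ∑ β ∈ multiIndices d k, c β * weakDeriv V β ψt (Ψ x))
        (ENNReal.ofReal p) (volume.restrict U)
      ≤ ∑ β ∈ multiIndices d k, eLpNorm (fun x => c β * weakDeriv V β ψt (Ψ x))
          (ENNReal.ofReal p) (volume.restrict U) := by
        have h1 := eLpNorm_sum_le (μ := volume.restrict U) (p := ENNReal.ofReal p)
          (s := multiIndices d k) (f := fun β x => c β * weakDeriv V β ψt (Ψ x)) hmeas
          (by rwa [ENNReal.one_le_ofReal])
        refine le_trans (le_of_eq ?_) h1
        congr 1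
        ext x
        simp
    _ ≤ ∑ _β ∈ multiIndices d k, ((d : ℝ≥0) ^ k : ℝ≥0) * sobolevSeminorm V k p ψt :=
        Finset.sum_le_sum hterm
    _ = _ := by
        rw [Finset.sum_const, nsmul_eq_mul]
        push_cast
        ring

end Seminorm

/-! ### Polynomials and the interpolation error -/

section Interpolation

variable {d k : ℕ}

lemma smooth_of_mem_polySpace {v : Space d → ℝ} (hv : v ∈ polySpace d k) : Smooth v := by
  obtain ⟨P, -, hP⟩ := hv
  rw [show v = fun x => MvPolynomial.eval (fun i => x i) P from funext hP]
  clear hP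
  induction P using MvPolynomial.induction_on with
  | C a => simpa using contDiff_const
  | add p q hp hq => simpa using hp.add hq
  | mul_X p i hp =>
    simp only [map_mul, MvPolynomial.eval_X]
    exact hp.mul (by fun_prop)

/-- Estimates for `I φ - φ` on an affine image of a simplex. -/
theorem exists_interpolation_error_le (b : AffineBasis (Fin (d + 1)) ℝ (Space d))
    (hd : 2 ≤ d) {p q : ℝ} (hp : 1 ≤ p) (hq : 1 ≤ q) (hpq : 1 - (d : ℝ) / p ≥ -((d : ℝ) / q)) :
    ∃ C : ℝ≥0, ∀ (L : Space d ≃L[ℝ] Space d) (s : Space d) (T : Set (Space d)), IsCompact T →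
      Convex ℝ T → affineHomeo L s ⁻¹' (interior T) = openSimplex b →
      ∀ I : (Space d → ℝ) → (Space d → ℝ), PreservesMeanDerivs T k p I →
      ∀ φ : Space d → ℝ, MemSobolev (interior T) (k + 1) p φ →
        MemSobolev (interior T) k q (I φ - φ) ∧
        ∀ B : Fin d → ℝ≥0∞, (∀ i, ∀ α ∈ multiIndices d k,
          eLpNorm (fun x => ∑ j, L (EuclideanSpace.single i 1) j *
            weakDeriv (interior T) (α + Pi.single j 1) φ x) (ENNReal.ofReal p)
            (volume.restrict (interior T)) ≤ B i) →
        sobolevSeminorm (interior T) k q (I φ - φ) ≤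
          C * volume T ^ (1 / q - 1 / p) * ∑ i, B i := by
  obtain ⟨C, hC⟩ := exists_anisotropic_sobolev_poincare b hd hp hq hpq
  refine ⟨(multiIndices d k).card * C, fun L s T hT hTc hpre I hI φ hφ => ?_⟩
  set U := interior T with hUdef
  have hUo : IsOpen U := isOpen_interior
  -- The boundary of a convex set is null, so means and norms over `T` and over its interior agree.
  have hTU : U =ᵐ[volume] T := interior_ae_eq_of_null_frontier (hTc.addHaar_frontier volume)
  have hrT : volume.restrict T = volume.restrict U := (Measure.restrict_congr_set hTU).symm
  have hvol : volume T = volume U := (measure_congr hTU).symm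
  have hUt : volume U ≠ ⊤ := by rw [← hvol]; exact hT.measure_lt_top.ne
  obtain ⟨hpoly, hder⟩ := hI φ (hφ.mono k.le_succ)
  have hsm := smooth_of_mem_polySpace hpoly
  have hweak : ∀ α : Fin d → ℕ, ∑ i, α i ≤ k → IsWeakDeriv U α (I φ - φ)
      (classicalDeriv α (I φ) - weakDeriv U α φ) := fun α hα =>
    (hsm.isWeakDeriv α).sub (hφ.isWeakDeriv (hα.trans k.le_succ))
  -- The Sobolev–Poincaré inequality for `∂^α φ`. Orders below `k` are included because membership
  -- in $W^{k,q}$ needs $L^q$ integrability of all of them; the estimate itself uses only order `k`.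
  have hsp : ∀ α : Fin d → ℕ, ∑ i, α i ≤ k → _ := fun α hα =>
    hC L s U hUo hpre (weakDeriv U α φ) (fun j => weakDeriv U (α + Pi.single j 1) φ)
      (integrableOn_of_memLp hUt hp (hφ.memLp hUo (hα.trans k.le_succ)))
      (hφ.isWeakDeriv_single hα) (fun j => hφ.memLp hUo (by rw [sum_add_single]; omega))
  refine ⟨fun α hα => ⟨_, hweak α hα, MemLp.sub ?_ (hsp α hα).1⟩, fun B hB => ?_⟩
  · obtain ⟨M, hM⟩ := hT.exists_bound_of_continuousOn (hsm.classicalDeriv α).continuous.continuousOn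
    have : IsFiniteMeasure (volume.restrict U) := ⟨by simpa using hUt.lt_top⟩
    refine MemLp.of_bound (hsm.classicalDeriv α).continuous.aestronglyMeasurable M ?_
    exact (ae_restrict_iff' hUo.measurableSet).2 (Filter.Eventually.of_forall fun x hx =>
      hM x (interior_subset hx))
  · have hterm : ∀ α ∈ multiIndices d k,
        eLpNorm (weakDeriv U α (I φ - φ)) (ENNReal.ofReal q) (volume.restrict U) ≤
          C * volume T ^ (1 / q - 1 / p) * ∑ i, B i := by
      intro α hα
      have hαk := (mem_multiIndices.1 hα).le
      have hae : weakDeriv U α (I φ - φ) =ᵐ[volume.restrict U]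
          -(fun x => weakDeriv U α φ x - ⨍ y in U, weakDeriv U α φ y) := by
        refine ((hweak α hαk).weakDeriv_ae_eq hUo).trans ?_
        refine (ae_restrict_iff' hUo.measurableSet).2 (Filter.Eventually.of_forall fun x hx => ?_)
        rw [Pi.sub_apply, hder α hα x (interior_subset hx), hrT, Pi.neg_apply, neg_sub]
      rw [eLpNorm_congr_ae hae, eLpNorm_neg, hvol]
      refine (hsp α hαk).2.trans ?_
      gcongr with i
      exact hB i α hα
    refine (sobolevSeminorm_le_sum hq _).trans ((Finset.sum_le_sum hterm).trans_eq ?_)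
    rw [Finset.sum_const, nsmul_eq_mul]
    push_cast
    ring

end Interpolation

/-! ### Matrices acting on Euclidean space -/

section MatrixEquiv

variable {d : ℕ}

/-- The linear automorphism of `Space d` given by an invertible matrix. -/
def matEquiv (M : Matrix (Fin d) (Fin d) ℝ) (h : IsUnit M.det) : Space d ≃L[ℝ] Space d :=
  LinearEquiv.toContinuousLinearEquiv
    { toFun := fun x => WithLp.toLp 2 (M.mulVec x.ofLp)
      invFun := fun x => WithLp.toLp 2 (M⁻¹.mulVec x.ofLp)
      map_add' := fun x y => by simp [Matrix.mulVec_add]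
      map_smul' := fun c x => by simp [Matrix.mulVec_smul]
      left_inv := fun x => by simp [Matrix.nonsing_inv_mul M h]
      right_inv := fun x => by simp [Matrix.mul_nonsing_inv M h] }

lemma matEquiv_apply (M : Matrix (Fin d) (Fin d) ℝ) (h : IsUnit M.det) (x : Space d) :
    matEquiv M h x = WithLp.toLp 2 (M.mulVec x.ofLp) := rfl

lemma matEquiv_symm_apply (M : Matrix (Fin d) (Fin d) ℝ) (h : IsUnit M.det) (x : Space d) :
    (matEquiv M h).symm x = WithLp.toLp 2 (M⁻¹.mulVec x.ofLp) := rfl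

lemma matEquiv_single (M : Matrix (Fin d) (Fin d) ℝ) (h : IsUnit M.det) (i j : Fin d) :
    matEquiv M h (EuclideanSpace.single i 1) j = M j i := by
  simp [matEquiv_apply]

lemma matEquiv_symm_single (M : Matrix (Fin d) (Fin d) ℝ) (h : IsUnit M.det) (i j : Fin d) :
    (matEquiv M h).symm (EuclideanSpace.single i 1) j = M⁻¹ j i := by
  simp [matEquiv_symm_apply]

variable {A : Matrix (Fin d) (Fin d) ℝ}

lemma isUnit_det_of_mem_orthogonalGroup (hA : A ∈ Matrix.orthogonalGroup (Fin d) ℝ) :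
    IsUnit A.det := by
  have h := (Matrix.mem_orthogonalGroup_iff (Fin d) ℝ).1 hA
  have h2 := congrArg Matrix.det h
  rw [Matrix.det_mul, Matrix.det_one] at h2
  exact IsUnit.of_mul_eq_one _ h2

lemma norm_mulVec_of_mem_orthogonalGroup (hA : A ∈ Matrix.orthogonalGroup (Fin d) ℝ)
    (v : Fin d → ℝ) : ‖(WithLp.toLp 2 (A.mulVec v) : Space d)‖ = ‖(WithLp.toLp 2 v : Space d)‖ := by
  have h := (Matrix.mem_orthogonalGroup_iff' (Fin d) ℝ).1 hA
  have h2 : ∀ w : Fin d → ℝ, ‖(WithLp.toLp 2 w : Space d)‖ ^ 2 = w ⬝ᵥ w := fun w => by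
    rw [EuclideanSpace.real_norm_sq_eq]
    simp [dotProduct, sq]
  refine (pow_left_inj₀ (norm_nonneg _) (norm_nonneg _) two_ne_zero).1 ?_
  rw [h2, h2, Matrix.dotProduct_mulVec, Matrix.vecMul_mulVec, ← Matrix.dotProduct_mulVec]
  rw [show A.transpose * A = 1 from h, Matrix.one_mulVec]

lemma abs_entry_le_one_of_mem_orthogonalGroup (hA : A ∈ Matrix.orthogonalGroup (Fin d) ℝ)
    (i j : Fin d) : |A i j| ≤ 1 :=
  entry_norm_bound_of_unitary hA i j

lemma inv_mem_orthogonalGroup (hA : A ∈ Matrix.orthogonalGroup (Fin d) ℝ) :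
    A⁻¹ ∈ Matrix.orthogonalGroup (Fin d) ℝ := by
  have h := (Matrix.mem_orthogonalGroup_iff (Fin d) ℝ).1 hA
  rw [Matrix.inv_eq_right_inv h]
  exact Unitary.star_mem hA

/-- An orthogonal map preserves the unit ball, whose volume is finite and positive, so the Jacobian
factor is `1`. -/
lemma jac_matEquiv_of_mem_orthogonalGroup (hA : A ∈ Matrix.orthogonalGroup (Fin d) ℝ) :
    jac (matEquiv A (isUnit_det_of_mem_orthogonalGroup hA)) = 1 := by
  set R := matEquiv A (isUnit_det_of_mem_orthogonalGroup hA) with hR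
  have h1 := volume_preimage_affineHomeo R 0 (Metric.ball 0 1)
  have h2 : affineHomeo R 0 ⁻¹' Metric.ball (0 : Space d) 1 = Metric.ball 0 1 := by
    ext x
    rw [Set.mem_preimage, affineHomeo_apply, add_zero, mem_ball_zero_iff, mem_ball_zero_iff, hR,
      matEquiv_apply, norm_mulVec_of_mem_orthogonalGroup hA]
  rw [h2] at h1
  have h3 : volume (Metric.ball (0 : Space d) 1) ≠ 0 :=
    (Metric.measure_ball_pos volume _ one_pos).ne'
  have h4 : volume (Metric.ball (0 : Space d) 1) ≠ ⊤ := measure_ball_lt_top.ne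
  have h5 : 1 * volume (Metric.ball (0 : Space d) 1) =
    jac R * volume (Metric.ball (0 : Space d) 1) := by rw [one_mul]; exact h1
  exact ((ENNReal.mul_left_inj h3 h4).1 h5).symm

end MatrixEquiv

/-! ### The reference simplices -/

section Reference

/-- By dimension, `d + 1` affinely independent points span the space. The hypothesis is stated as a
linear system so that it can be checked coordinate by coordinate. -/
lemma exists_affineBasis_coe_eq {d : ℕ} (v : Fin (d + 1) → Space d)
    (h : ∀ w : Fin (d + 1) → ℝ, ∑ i, w i = 0 → ∑ i, w i • v i = 0 → ∀ i, w i = 0) :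
    ∃ b : AffineBasis (Fin (d + 1)) ℝ (Space d), ⇑b = v := by
  have hi : AffineIndependent ℝ v := by
    rw [affineIndependent_iff_of_fintype]
    intro w hw hw2
    refine h w hw ?_
    rwa [Finset.univ.weightedVSub_eq_linear_combination hw] at hw2
  exact ⟨⟨v, hi, (hi.affineSpan_eq_top_iff_card_eq_finrank_add_one).2 (by simp)⟩, rfl⟩

lemma exists_affineBasis_triangle : ∃ b : AffineBasis (Fin 3) ℝ (Space 2),
    ⇑b = ![!₂[0, 0], !₂[1, 0], !₂[0, 1]] := by
  refine exists_affineBasis_coe_eq (d := 2) _ fun w h1 h2 => ?_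
  rw [Fin.sum_univ_three] at h1 h2
  have e0 := congrArg (fun x : Space 2 => x 0) h2
  have e1 := congrArg (fun x : Space 2 => x 1) h2
  simp at e0 e1
  rw [Fin.forall_fin_succ, Fin.forall_fin_two]
  simp only [Fin.succ_zero_eq_one, Fin.succ_one_eq_two]
  refine ⟨?_, ?_, ?_⟩ <;> linarith

/-- The parameter covers both reference tetrahedra: `c = 0` is case (i), `c = 1` is case (ii). -/
lemma exists_affineBasis_tetrahedron (c : ℝ) : ∃ b : AffineBasis (Fin 4) ℝ (Space 3),
    ⇑b = ![!₂[0, 0, 0], !₂[1, 0, 0], !₂[c, 1, 0], !₂[0, 0, 1]] := by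
  refine exists_affineBasis_coe_eq (d := 3) _ fun w h1 h2 => ?_
  rw [Fin.sum_univ_four] at h1 h2
  have e0 := congrArg (fun x : Space 3 => x 0) h2
  have e1 := congrArg (fun x : Space 3 => x 1) h2
  have e2 := congrArg (fun x : Space 3 => x 2) h2
  simp at e0 e1 e2
  rw [e1, zero_mul] at e0
  rw [Fin.forall_fin_succ, Fin.forall_fin_succ, Fin.forall_fin_two]
  simp only [Fin.succ_zero_eq_one, Fin.succ_one_eq_two]
  exact ⟨by linarith, by linarith, e1, e2⟩

/-- Every shape has one of two reference simplices. -/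
lemma exists_affineBasis_refVertex {d : ℕ} (hd : d = 2 ∨ d = 3) :
    ∃ b₁ b₂ : AffineBasis (Fin (d + 1)) ℝ (Space d), ∀ S : Shape d,
      S.refVertex = b₁ ∨ S.refVertex = b₂ := by
  rcases hd with rfl | rfl
  · obtain ⟨b, hb⟩ := exists_affineBasis_triangle
    refine ⟨b, b, fun S => Or.inl ?_⟩
    cases S
    exact hb.symm
  · obtain ⟨b₁, hb₁⟩ := exists_affineBasis_tetrahedron 0
    obtain ⟨b₂, hb₂⟩ := exists_affineBasis_tetrahedron 1
    refine ⟨b₁, b₂, fun S => ?_⟩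
    cases S
    · exact Or.inl hb₁.symm
    · exact Or.inr hb₂.symm

end Reference

/-! ### Geometry of the elements -/

namespace Element

variable {d : ℕ} {K : Element d}

/-- The reason for the choice of edges: in case (ii), $\hat p_3-\hat p_2$ rather than $\hat p_3-\hat
p_1$ is the second unit vector. -/
lemma refVertex_edge_sub (S : Shape d) (i : Fin d) :
    S.refVertex (S.edge i).2 - S.refVertex (S.edge i).1 = EuclideanSpace.single i 1 := by
  cases S <;> fin_cases i <;> ext j <;> fin_cases j <;>
    simp [Shape.refVertex, Shape.edge]

/-- The normalizations of the parameters make the columns of `Ã` unit vectors; hence the edges have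
lengths exactly `h_i`. -/
lemma shear_column_norm (hK : K.Admissible) (i : Fin d) : ∑ j, K.shape.shear j i ^ 2 = 1 := by
  obtain ⟨-, -, hS⟩ := hK
  generalize K.shape = S at hS
  cases S with
  | tri s t =>
    simp only [ShapeConditions] at hS
    fin_cases i <;> simp [Shape.shear, Fin.sum_univ_two]
    exact hS.1
  | tet₁ s₁ t₁ s₂₁ s₂₂ t₂ =>
    simp only [ShapeConditions] at hS
    fin_cases i <;> simp [Shape.shear, Fin.sum_univ_three]
    · exact hS.1.1
    · exact hS.2.1.1
  | tet₂ s₁ t₁ s₂₁ s₂₂ t₂ =>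
    simp only [ShapeConditions] at hS
    fin_cases i <;> simp [Shape.shear, Fin.sum_univ_three]
    · exact hS.1.1
    · exact hS.2.1.1

lemma det_shear_ne_zero (hK : K.Admissible) : K.shape.shear.det ≠ 0 := by
  obtain ⟨-, -, hS⟩ := hK
  generalize K.shape = S at hS
  cases S with
  | tri s t =>
    simp only [ShapeConditions] at hS
    simpa [Shape.shear, Matrix.det_fin_two] using hS.2.1.ne'
  | tet₁ s₁ t₁ s₂₁ s₂₂ t₂ =>
    simp only [ShapeConditions] at hS
    simpa [Shape.shear, Matrix.det_fin_three] using ⟨hS.1.2.2.1.ne', hS.2.1.2.1.ne'⟩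
  | tet₂ s₁ t₁ s₂₁ s₂₂ t₂ =>
    simp only [ShapeConditions] at hS
    simpa [Shape.shear, Matrix.det_fin_three] using ⟨hS.1.2.2.1.ne', hS.2.1.2.1.ne'⟩

lemma isUnit_det_map (hK : K.Admissible) :
    IsUnit (K.rot * (K.shape.shear * Matrix.diagonal K.h)).det := by
  rw [Matrix.det_mul, Matrix.det_mul, Matrix.det_diagonal, isUnit_iff_ne_zero]
  exact mul_ne_zero (isUnit_det_of_mem_orthogonalGroup hK.2.1).ne_zero
    (mul_ne_zero (det_shear_ne_zero hK) (Finset.prod_ne_zero_iff.2 fun i _ => (hK.1 i).ne'))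

/-- The linear part of `Φ_T`. -/
def rotEquiv (hK : K.Admissible) : Space d ≃L[ℝ] Space d :=
  matEquiv K.rot (isUnit_det_of_mem_orthogonalGroup hK.2.1)

/-- The linear part of `Φ`. -/
def mapEquiv (hK : K.Admissible) : Space d ≃L[ℝ] Space d :=
  matEquiv (K.rot * (K.shape.shear * Matrix.diagonal K.h)) (isUnit_det_map hK)

lemma coe_affineHomeo_rotEquiv (hK : K.Admissible) :
    ⇑(affineHomeo (rotEquiv hK) K.shift) = K.move := rfl

lemma mapEquiv_apply (hK : K.Admissible) (x : Space d) :
    mapEquiv hK x = rotEquiv hK (K.stretch x) := by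
  rw [mapEquiv, rotEquiv, matEquiv_apply, matEquiv_apply, stretch, Matrix.mulVec_mulVec]

lemma coe_affineHomeo_mapEquiv (hK : K.Admissible) :
    ⇑(affineHomeo (mapEquiv hK) K.shift) = K.map := by
  ext1 x
  rw [affineHomeo_apply, mapEquiv_apply]
  rfl

lemma stretch_single (i j : Fin d) :
    K.stretch (EuclideanSpace.single i 1) j = K.h i * K.shape.shear j i := by
  simp [stretch, mul_comm]

lemma norm_mapEquiv_single (hK : K.Admissible) (i : Fin d) :
    ‖mapEquiv hK (EuclideanSpace.single i 1)‖ = K.h i := by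
  have h1 : ‖mapEquiv hK (EuclideanSpace.single i 1)‖ = ‖K.stretch (EuclideanSpace.single i 1)‖ := by
    rw [mapEquiv_apply, rotEquiv, matEquiv_apply, norm_mulVec_of_mem_orthogonalGroup hK.2.1]
  rw [h1]
  refine (pow_left_inj₀ (norm_nonneg _) (hK.1 i).le two_ne_zero).1 ?_
  rw [EuclideanSpace.real_norm_sq_eq]
  simp_rw [stretch_single, mul_pow]
  rw [← Finset.mul_sum, shear_column_norm hK, mul_one]

lemma vertex_sub_vertex (hK : K.Admissible) (i j : Fin (d + 1)) :
    K.vertex i - K.vertex j = mapEquiv hK (K.shape.refVertex i - K.shape.refVertex j) := by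
  rw [vertex, vertex, ← coe_affineHomeo_mapEquiv hK, affineHomeo_apply, affineHomeo_apply, map_sub]
  abel

/-- The source of the anisotropy: differentiation along the `i`-th reference axis is `h_i` times
differentiation along the edge direction `r_i`. -/
lemma mapEquiv_single (hK : K.Admissible) (i : Fin d) :
    mapEquiv hK (EuclideanSpace.single i 1) = K.h i • K.dir i := by
  have h1 : K.vertex (K.shape.edge i).2 - K.vertex (K.shape.edge i).1 =
      mapEquiv hK (EuclideanSpace.single i 1) := by
    rw [vertex_sub_vertex hK, refVertex_edge_sub]
  rw [dir, h1, norm_mapEquiv_single, smul_smul, mul_inv_cancel₀ (hK.1 i).ne', one_smul]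

lemma len_edge (hK : K.Admissible) (i : Fin d) :
    K.len (K.shape.edge i).1 (K.shape.edge i).2 = K.h i := by
  rw [len, dist_comm, dist_eq_norm, vertex_sub_vertex hK, refVertex_edge_sub,
    norm_mapEquiv_single]

lemma mapEquiv_single_eq_sum (hK : K.Admissible) (i : Fin d) :
    mapEquiv hK (EuclideanSpace.single i 1) =
      ∑ l, (K.h i * K.shape.shear l i) • rotEquiv hK (EuclideanSpace.single l 1) := by
  rw [mapEquiv_apply, eq_sum_single (K.stretch _), map_sum]
  simp_rw [map_smul, stretch_single]

lemma simplex_eq_image (hK : K.Admissible) :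
    K.simplex = affineHomeo (mapEquiv hK) K.shift '' K.refSimplex := by
  rw [coe_affineHomeo_mapEquiv]
  rfl

lemma isCompact_simplex (hK : K.Admissible) : IsCompact K.simplex := by
  rw [simplex_eq_image hK]
  exact ((Set.finite_range _).isCompact_convexHull (𝕜 := ℝ)).image (Homeomorph.continuous _)

lemma convex_simplex (hK : K.Admissible) : Convex ℝ K.simplex := by
  have h1 : K.simplex = (fun x => x + K.shift) '' (mapEquiv hK '' K.refSimplex) := by
    rw [simplex_eq_image hK, Set.image_image]
    rfl
  have h2 : Convex ℝ (mapEquiv hK '' K.refSimplex) :=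
    (convex_convexHull ℝ _).linear_image (mapEquiv hK).toLinearEquiv.toLinearMap
  rw [h1, Set.image_add_right]
  exact h2.translate_preimage_left _

lemma preimage_interior_simplex (hK : K.Admissible) {b : AffineBasis (Fin (d + 1)) ℝ (Space d)}
    (hb : K.shape.refVertex = b) :
    affineHomeo (mapEquiv hK) K.shift ⁻¹' interior K.simplex = openSimplex b := by
  rw [simplex_eq_image hK, ← Homeomorph.image_interior, Homeomorph.preimage_image, refSimplex, hb]
  rfl

lemma interior_tildeSimplex (hK : K.Admissible) :
    interior K.tildeSimplex = affineHomeo (rotEquiv hK) K.shift ⁻¹' interior K.simplex := by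
  rw [Homeomorph.preimage_interior]
  rfl

lemma abs_shear_le_one (hK : K.Admissible) (l i : Fin d) : |K.shape.shear l i| ≤ 1 := by
  rw [← sq_le_one_iff_abs_le_one, ← shear_column_norm hK i]
  exact Finset.single_le_sum (f := fun j => K.shape.shear j i ^ 2) (fun _ _ => sq_nonneg _)
    (Finset.mem_univ l)

/-- The entries of `Ã diag(h)` are controlled by the diagonal ones. -/
lemma abs_entry_le {M : ℝ} (hM : 0 < M) (hK : K.Admissible) (hG : GeometricBound M K K.shape)
    (i l : Fin d) : K.h i * |K.shape.shear l i| ≤ (M + 2) * K.tildeH l := by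
  have hlen := len_edge hK
  have hrow : ∀ l i, K.h i * |K.shape.shear l i| ≤ K.h i := fun l i =>
    mul_le_of_le_one_right (hK.1 i).le (abs_shear_le_one hK l i)
  have hpos := hK.1
  have hS := hK.2.2
  -- Off-diagonal entries of the first row are at most the column length `h_i`, which is at most `2
  -- * h_1`. Only the entry with `s₂₂` needs the constant `M`.
  have key : ∀ a x : ℝ, 0 ≤ x → a ≤ 2 * x → a ≤ (M + 2) * x := fun a x hx ha => by nlinarith
  -- Needed in case (ii), where `p_1 p_4` is not among the edges compared with `p_1 p_2`. Since `p_2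
  -- p_4` is, this gives `h_3 ≤ 2 * h_1`.
  have htri : K.len 0 3 ≤ K.len 0 1 + K.len 1 3 := dist_triangle _ _ _
  rw [tildeH]
  clear hK
  obtain ⟨h, S, A, b⟩ := K
  cases S with
  | tri s t =>
    simp only [ShapeConditions] at hS
    have h0 := hpos 0
    have h1 := hpos 1
    have r := hrow 0 1
    have ht := mul_pos h1 hS.2.1
    fin_cases i <;> fin_cases l <;> simp [Shape.shear, Shape.diag] at r ⊢
    · linarith [mul_pos hM h0]
    · positivity
    · exact key _ _ h0.le (by linarith)
    · rw [abs_of_pos hS.2.1]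
      exact key _ _ ht.le (by linarith)
  | tet₁ s₁ t₁ s₂₁ s₂₂ t₂ =>
    simp only [ShapeConditions] at hS
    simp only [GeometricBound] at hG
    have h0 := hpos 0
    have h1 := hpos 1
    have h2 := hpos 2
    have l0 := hlen 0
    have l1 := hlen 1
    have l2 := hlen 2
    have r1 := hrow 0 1
    have r2 := hrow 0 2
    simp [Shape.edge] at l0 l1 l2 hG
    have m1 := hS.2.2.1 0 1 (by decide)
    have m2 := hS.2.2.2.1
    have ht₁ := mul_pos h1 hS.1.2.2.1
    have ht₂ := mul_pos h2 hS.2.1.2.1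
    have g : h 2 * |s₂₂| ≤ M * (h 1 * t₁) := by
      rw [← mul_div_assoc, le_div_iff₀ h2] at hG
      linarith
    rw [l0] at m1 m2 htri
    rw [l1] at m1
    rw [l2] at m2 htri
    fin_cases i <;> fin_cases l <;> simp [Shape.shear, Shape.diag] at r1 r2 ⊢
    · linarith [mul_pos hM h0]
    · positivity
    · positivity
    · exact key _ _ h0.le (by linarith)
    · rw [abs_of_pos hS.1.2.2.1]
      exact key _ _ ht₁.le (by linarith)
    · positivity
    · exact key _ _ h0.le (by linarith)
    · linarith
    · rw [abs_of_pos hS.2.1.2.1]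
      exact key _ _ ht₂.le (by linarith)
  | tet₂ s₁ t₁ s₂₁ s₂₂ t₂ =>
    simp only [ShapeConditions] at hS
    simp only [GeometricBound] at hG
    have h0 := hpos 0
    have h1 := hpos 1
    have h2 := hpos 2
    have l0 := hlen 0
    have l1 := hlen 1
    have l2 := hlen 2
    have r1 := hrow 0 1
    have r2 := hrow 0 2
    simp [Shape.edge] at l0 l1 l2 hG
    have m1 := hS.2.2.1 0 1 (by decide)
    have m2 := hS.2.2.2.1
    have ht₁ := mul_pos h1 hS.1.2.2.1
    have ht₂ := mul_pos h2 hS.2.1.2.1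
    have g : h 2 * |s₂₂| ≤ M * (h 1 * t₁) := by
      rw [← mul_div_assoc, le_div_iff₀ h2] at hG
      linarith
    rw [l0] at m1 m2 htri
    rw [l1] at m1
    rw [l2] at htri
    fin_cases i <;> fin_cases l <;> simp [Shape.shear, Shape.diag] at r1 r2 ⊢
    · linarith [mul_pos hM h0]
    · positivity
    · positivity
    · exact key _ _ h0.le (by linarith)
    · rw [abs_of_pos hS.1.2.2.1]
      exact key _ _ ht₁.le (by linarith)
    · positivity
    · exact key _ _ h0.le (by linarith)
    · linarith
    · rw [abs_of_pos hS.2.1.2.1]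
      exact key _ _ ht₂.le (by linarith)

end Element

/-! ### The interpolation error on elements -/

section Elements

variable {d k : ℕ}

/-- The interpolation error on all elements, in terms of bounds for `∂^α (∂φ/∂x̂_i)`. -/
theorem Element.exists_interpolation_error_le (hd : d = 2 ∨ d = 3) {p q : ℝ} (hp : 1 ≤ p)
    (hq : 1 ≤ q) (hpq : 1 - (d : ℝ) / p ≥ -((d : ℝ) / q)) :
    ∃ C : ℝ≥0, ∀ (K : Element d) (hK : K.Admissible) (I : (Space d → ℝ) → (Space d → ℝ)),
      PreservesMeanDerivs K.simplex k p I →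
      ∀ φ : Space d → ℝ, MemSobolev (interior K.simplex) (k + 1) p φ →
        MemSobolev (interior K.simplex) k q (I φ - φ) ∧
        ∀ B : Fin d → ℝ≥0∞, (∀ i, ∀ α ∈ multiIndices d k,
          eLpNorm (fun x => ∑ j, mapEquiv hK (EuclideanSpace.single i 1) j *
            weakDeriv (interior K.simplex) (α + Pi.single j 1) φ x) (ENNReal.ofReal p)
            (volume.restrict (interior K.simplex)) ≤ B i) →
        sobolevSeminorm (interior K.simplex) k q (I φ - φ) ≤
          C * volume K.simplex ^ (1 / q - 1 / p) * ∑ i, B i := by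
  obtain ⟨b₁, b₂, hb⟩ := exists_affineBasis_refVertex hd
  have hd2 : 2 ≤ d := by omega
  obtain ⟨C₁, h₁⟩ := Aniso.exists_interpolation_error_le (k := k) b₁ hd2 hp hq hpq
  obtain ⟨C₂, h₂⟩ := Aniso.exists_interpolation_error_le (k := k) b₂ hd2 hp hq hpq
  -- One constant for both possible reference simplices.
  refine ⟨C₁ + C₂, fun K hK I hI φ hφ => ?_⟩
  rcases hb K.shape with h | h
  · obtain ⟨h3, h4⟩ := h₁ (mapEquiv hK) K.shift K.simplex (isCompact_simplex hK)
      (convex_simplex hK) (preimage_interior_simplex hK h) I hI φ hφ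
    refine ⟨h3, fun B hB => (h4 B hB).trans ?_⟩
    gcongr
    exact le_self_add
  · obtain ⟨h3, h4⟩ := h₂ (mapEquiv hK) K.shift K.simplex (isCompact_simplex hK)
      (convex_simplex hK) (preimage_interior_simplex hK h) I hI φ hφ
    refine ⟨h3, fun B hB => (h4 B hB).trans ?_⟩
    gcongr
    exact le_add_self

/-- Derivatives of order `k` of `h_i ∂φ/∂r_i`. -/
lemma Element.eLpNorm_mapEquiv_le {K : Element d} (hK : K.Admissible) {p : ℝ} (hp : 1 ≤ p)
    {φ : Space d → ℝ} (hφ : MemSobolev (interior K.simplex) (k + 1) p φ) (i : Fin d)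
    {α : Fin d → ℕ} (hα : α ∈ multiIndices d k) :
    eLpNorm (fun x => ∑ j, mapEquiv hK (EuclideanSpace.single i 1) j *
      weakDeriv (interior K.simplex) (α + Pi.single j 1) φ x) (ENNReal.ofReal p)
      (volume.restrict (interior K.simplex)) ≤ ENNReal.ofReal (K.h i) *
        sobolevSeminorm (interior K.simplex) k p
          (weakDirDeriv (interior K.simplex) (K.dir i) φ) := by
  have h1 : (fun x => ∑ j, mapEquiv hK (EuclideanSpace.single i 1) j *
      weakDeriv (interior K.simplex) (α + Pi.single j 1) φ x) =
      K.h i • fun x => ∑ j, K.dir i j *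
        weakDeriv (interior K.simplex) (α + Pi.single j 1) φ x := by
    ext x
    simp [mapEquiv_single, Finset.mul_sum, mul_assoc]
  rw [h1, eLpNorm_const_smul, Real.enorm_eq_ofReal (hK.1 i).le]
  gcongr
  exact hφ.eLpNorm_dirDeriv_le isOpen_interior hp _ hα

/-- Derivatives of order `k` of `∂φ/∂x̂_i` in terms of `φ ∘ Φ_T`. -/
lemma Element.eLpNorm_mapEquiv_le_tilde {M : ℝ} (hM : 0 < M) {K : Element d} (hK : K.Admissible)
    (hG : GeometricBound M K K.shape) {p : ℝ} (hp : 1 ≤ p)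
    {φ : Space d → ℝ} (hφ : MemSobolev (interior K.simplex) (k + 1) p φ) (i : Fin d)
    {α : Fin d → ℕ} (hα : α ∈ multiIndices d k) :
    eLpNorm (fun x => ∑ j, mapEquiv hK (EuclideanSpace.single i 1) j *
      weakDeriv (interior K.simplex) (α + Pi.single j 1) φ x) (ENNReal.ofReal p)
      (volume.restrict (interior K.simplex)) ≤
      ∑ l, ((multiIndices d k).card * d ^ k * (M + 2).toNNReal : ℝ≥0) *
        (ENNReal.ofReal (K.tildeH l) * sobolevSeminorm (interior K.tildeSimplex) k p
          (weakPartial (interior K.tildeSimplex) l (φ ∘ K.move))) := by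
  set U := interior K.simplex with hU
  have hUo : IsOpen U := isOpen_interior
  have hrot := hK.2.1
  set F : Fin d → Space d → ℝ := fun l x => ∑ j, rotEquiv hK (EuclideanSpace.single l 1) j *
    weakDeriv U (α + Pi.single j 1) φ x with hF
  have hα' : ∀ j : Fin d, ∑ i, (α + Pi.single j 1 : Fin d → ℕ) i ≤ k + 1 := fun j => by
    rw [sum_add_single, mem_multiIndices.1 hα]
  have hFm : ∀ l, AEStronglyMeasurable (F l) (volume.restrict U) := fun l =>
    Finset.aestronglyMeasurable_fun_sum _ fun j _ =>
      (hφ.memLp hUo (hα' j)).aestronglyMeasurable.const_mul _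
  -- The `i`-th edge derivative is expanded in derivatives along the rotated axes. Its coefficients
  -- are the entries of `Ã diag(h)`, bounded by `abs_entry_le`.
  have h1 : (fun x => ∑ j, mapEquiv hK (EuclideanSpace.single i 1) j *
      weakDeriv U (α + Pi.single j 1) φ x) =
      ∑ l, (K.h i * K.shape.shear l i) • F l := by
    ext x
    rw [mapEquiv_single_eq_sum]
    simp only [WithLp.ofLp_sum, WithLp.ofLp_smul, Finset.sum_apply, Pi.smul_apply, smul_eq_mul,
      hF, Finset.mul_sum, Finset.sum_mul]
    rw [Finset.sum_comm]
    simp only [mul_assoc]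
  rw [h1]
  refine (eLpNorm_sum_le (fun l _ => (hFm l).const_smul _)
    (by rwa [ENNReal.one_le_ofReal])).trans (Finset.sum_le_sum fun l _ => ?_)
  rw [eLpNorm_const_smul, Real.enorm_eq_ofReal_abs, abs_mul, abs_of_pos (hK.1 i)]
  have h2 := hφ.eLpNorm_dirDeriv_le_comp hUo hp (rotEquiv hK) K.shift
    (jac_matEquiv_of_mem_orthogonalGroup hrot)
    (fun i j => by
      rw [rotEquiv, matEquiv_single]
      exact abs_entry_le_one_of_mem_orthogonalGroup hrot _ _)
    (fun i j => by
      rw [rotEquiv, matEquiv_symm_single]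
      exact abs_entry_le_one_of_mem_orthogonalGroup (inv_mem_orthogonalGroup hrot) _ _) l hα
  rw [← interior_tildeSimplex, coe_affineHomeo_rotEquiv] at h2
  refine (mul_le_mul' (ENNReal.ofReal_le_ofReal (abs_entry_le hM hK hG i l)) h2).trans_eq ?_
  rw [ENNReal.ofReal_mul (by linarith), ENNReal.coe_mul (_ * _) (M + 2).toNNReal,
    show ENNReal.ofReal (M + 2) = ((M + 2).toNNReal : ℝ≥0∞) from rfl]
  ring

end Elements

end Aniso

end

theorem theorem2 (d k : ℕ) (hd : d = 2 ∨ d = 3) (hk : 1 ≤ k) (p q : ℝ) (hp : 1 ≤ p) (hq : 1 ≤ q)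
    (hpq : 1 - (d : ℝ) / p ≥ -((d : ℝ) / q)) :
    (∃ c : ℝ≥0, ∀ K : Aniso.Element d, K.Admissible →
      ∀ I : (Aniso.Space d → ℝ) → (Aniso.Space d → ℝ),
        Aniso.PreservesMeanDerivs K.simplex k p I →
        ∀ φ : Aniso.Space d → ℝ, Aniso.MemSobolev (interior K.simplex) (k + 1) p φ →
          Aniso.MemSobolev (interior K.simplex) k q (I φ - φ) ∧
          Aniso.sobolevSeminorm (interior K.simplex) k q (I φ - φ) ≤
            c * volume K.simplex ^ (1 / q - 1 / p) *
              ∑ i, ENNReal.ofReal (K.h i) *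
                Aniso.sobolevSeminorm (interior K.simplex) k p
                  (Aniso.weakDirDeriv (interior K.simplex) (K.dir i) φ)) ∧
    (∀ M : ℝ, 0 < M → ∃ c : ℝ≥0, ∀ K : Aniso.Element d, K.Admissible →
      Aniso.GeometricBound M K K.shape →
      ∀ I : (Aniso.Space d → ℝ) → (Aniso.Space d → ℝ),
        Aniso.PreservesMeanDerivs K.simplex k p I →
        ∀ φ : Aniso.Space d → ℝ, Aniso.MemSobolev (interior K.simplex) (k + 1) p φ →
          Aniso.sobolevSeminorm (interior K.simplex) k q (I φ - φ) ≤
            c * volume K.simplex ^ (1 / q - 1 / p) *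
              ∑ i, ENNReal.ofReal (K.tildeH i) *
                Aniso.sobolevSeminorm (interior K.tildeSimplex) k p
                  (Aniso.weakPartial (interior K.tildeSimplex) i (φ ∘ K.move))) := by
  refine ⟨?_, fun M hM => ?_⟩
  · obtain ⟨C, hC⟩ := Aniso.Element.exists_interpolation_error_le (k := k) hd hp hq hpq
    refine ⟨C, fun K hK I hI φ hφ => ?_⟩
    obtain ⟨h1, h2⟩ := hC K hK I hI φ hφ
    exact ⟨h1, h2 _ fun i α hα => Aniso.Element.eLpNorm_mapEquiv_le hK hp hφ i hα⟩
  · obtain ⟨C, hC⟩ := Aniso.Element.exists_interpolation_error_le (k := k) hd hp hq hpq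
    -- The bound for the `i`-th reference direction does not depend on `i`, so summing over the
    -- directions gives the factor `d`.
    refine ⟨C * (d * ((Aniso.multiIndices d k).card * d ^ k * (M + 2).toNNReal)),
      fun K hK hG I hI φ hφ => ?_⟩
    obtain ⟨-, h2⟩ := hC K hK I hI φ hφ
    refine (h2 _ fun i α hα =>
      Aniso.Element.eLpNorm_mapEquiv_le_tilde hM hK hG hp hφ i hα).trans_eq ?_
    rw [← Finset.mul_sum, Finset.sum_const, Finset.card_univ, Fintype.card_fin, nsmul_eq_mul]
    push_cast
    ring
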